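/- Fix $N\ge 2$ agents. On a filtered probability space carrying a Brownian motion $W$, let $d\mu_t=-\beta\mu_t\,dt+\sigma\,dW_t$ with constant initial value $\mu_0$ and $\beta,\sigma>0$; let $\gamma,\rho,\lambda>0$. Agent $n$ holds the position $\varphi^n$, $\varphi^n_0=0$, trades at the rate $\dot\varphi^n$, and maximizes $$J^n=E\Big[\int_0^\infty e^{-\rho t}\Big(\mu_t\varphi^n_t-\tfrac{\gamma}{2}(\varphi^n_t)^2-\lambda\dot\varphi^n_t\sum_{i=1}^N\dot\varphi^i_t\Big)dt\Big].$$ A feedback control $u:\mathbb{R}^{1+N}\to\mathbb{R}^N$ is admissible if $d\varphi_t=u(\mu_t,\varphi_t)\,dt$, $\varphi_0=0$, has a unique solution and all $X\in\{\varphi^n,\dot\varphi^n\}$ are progressively measurable with $E\int_0^\infty e^{-\rho t}X_t^2\,dt<\infty$. It is a closed-loop Nash equilibrium if no agent can increase $J^n$ by changing the $n$-th component of $u$ to another function such that the resulting control is admissible (the feedback functions of the others being fixed). For $\lambda>0$, $y\in\mathbb{R}$ put $$\Theta=\frac{1}{4N^2}\Big[\lambda(N+1)^2\Big(\sqrt{\rho^2+\tfrac{8\gamma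 N^2-4\rho(3N+1)y\sqrt{\gamma\lambda}}{\lambda(N+1)^2}-\tfrac{4\gamma(3N+1)y^2}{\lambda(N-1)(N+1)^2}}-\rho\Big)+(6N+2)y\sqrt{\gamma\lambda}\Big],$$ $$\Psi=\frac{2(N-1)(\Theta-\Theta N+2y\sqrt{\gamma\lambda})^2}{(N+1)\big(\rho\lambda(N^2-1)+4\Theta(N-1)+2(N-3)y\sqrt{\gamma\lambda}\big)},$$ $$\Phi_N(\lambda,y)=\frac{y\big((N+1)\sqrt{\gamma\lambda}(\rho\lambda(N^2-1)-2\Psi)+\gamma\lambda((N-6)N+1)y\big)-2\Theta^2(N-1)^2N+\Theta(N-1)\big(N\Psi+8Ny\sqrt{\gamma\lambda}+\Psi\big)}{\lambda(N-1)(N+1)^2}.$$ For $y$ in $I_N=\big(0,\sqrt2N\sqrt{(N-1)/(3N+1)}\big]$ one has $\Phi_N(\lambda,y)\to\gamma\,\Phi^0_N(y)$ as $\lambda\downarrow0$, where $\Phi^0_N$ depends only on $N$; $\Phi^0_N$ has a unique root $\delta^*_N$ in $I_N$. Put $$\Delta(N)=\frac{1}{2N^2}\sqrt{\frac{2N^3-2N^2-(3N+1)(\delta_N^*)^2}{N-1}}+\frac{(2N+1)\delta^*_N}{2N^2}>0.$$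 Let $\delta(\lambda)\to\delta^*_N$ be roots, $\Phi_N(\lambda,\delta(\lambda))=0$, for small $\lambda>0$, and let $(a,b,c,d,e,f,g,\bar a,\bar b,\bar c)$ (depending on $\lambda$) with $d=\sqrt{\gamma\lambda}\,\delta(\lambda)$ and $a=\Theta(\lambda,\delta(\lambda))$ solve, with $k=(N-2)\bar b-\bar c$, $$0=\tfrac{\rho a}{2}-\tfrac{\gamma}{2}-d\bar b+\tfrac{(a+\lambda(N-1)\bar b)^2}{4\lambda},\qquad 0=-\tfrac{\rho b}{2}+bk+\tfrac{(d+\lambda(N-1)k)^2}{4\lambda},$$ $$0=\rho d+b\bar b-dk+\tfrac{(a+\lambda(N-1)\bar b)(d+\lambda(N-1)k)}{2\lambda},\qquad g=\tfrac{\sigma^2}{2\rho}c,$$ $$0=-\tfrac{\rho+2\beta}{2}c+f\bar a+\tfrac{(e-\lambda(N-1)\bar a)^2}{4\lambda},\qquad 0=-(\rho+\beta)e+1-d\bar a+\bar bf-\tfrac{(e-\lambda(N-1)\bar a)(a+\lambda(N-1)\bar b)}{2\lambda},$$ $$b\bar a+fk=(\rho+\beta)f+\tfrac{(e-\lambda(N-1)\bar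 a)(d+\lambda(N-1)k)}{2\lambda},$$ $$\bar a=\tfrac{e}{(N+1)\lambda},\qquad \bar b=\tfrac{-aN+a+2d}{\lambda-\lambda N^2},\qquad \bar c=-\tfrac{d-aN}{\lambda+\lambda N}.$$ Such families exist for all small $\lambda>0$, and for each of them, with $M_{rate}=\bar c-(N-1)\bar b$ and $M_{aim}=\gamma\bar a/M_{rate}$, the following holds for all sufficiently small $\lambda>0$. The feedback $\dot\varphi^n=\bar a\mu+\bar b\sum_{m\ne n}\varphi^m-\bar c\varphi^n$, $n=1,\dots,N$, is a closed-loop Nash equilibrium; $M_{rate},M_{aim}>0$; along the equilibrium $\dot\varphi^n_t=M_{rate}(M_{aim}\mu_t/\gamma-\varphi^n_t)$; and, as $\lambda\downarrow0$, $$M_{rate}=\sqrt{\gamma/\lambda}\,\Delta(N)+O(1),\qquad M_{aim}=1+O(\sqrt\lambda).$$ If $\mu_0=0$, the equilibrium value of each agent's goal functional satisfies $$J^n=\frac{\sigma^2}{2\rho\gamma(2\beta+\rho)}-\frac{\sqrt\lambda\,\sigma^2(1+2\Delta(N)^2N)}{4\gamma^{3/2}\rho\,\Delta(N)}+O(\lambda).$$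 The constants in the $O$-terms do not depend on $\lambda$ or on the probability space. -/

import Mathlib

open MeasureTheory ProbabilityTheory Filter Topology Set
open scoped NNReal ENNReal

noncomputable section

namespace PriceImpactGame

/-! ### The financial market -/

section Market

variable {Ω : Type*} [mΩ : MeasurableSpace Ω]

/-- `W` is a standard Brownian motion relative to the filtration `𝓕`, and `μ` is the
Ornstein-Uhlenbeck signal `dμ_t = -β μ_t dt + σ dW_t` started at the constant `m0`.
As the noise is additive, the equation is its pathwise integrated form. -/
structure IsSignal (P : Measure Ω) (𝓕 : Filtration ℝ≥0 mΩ) (β σ m0 : ℝ)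
    (W μ : ℝ≥0 → Ω → ℝ) : Prop where
  brownian : IsBrownianReal W P
  adapted_noise : StronglyAdapted 𝓕 W
  indep_increments : ∀ s t : ℝ≥0, s ≤ t →
    Indep (MeasurableSpace.comap (fun ω => W t ω - W s ω) inferInstance) (𝓕 s) P
  adapted : StronglyAdapted 𝓕 μ
  continuous_path : ∀ ω, Continuous fun t => μ t ω
  dynamics : ∀ᵐ ω ∂P, ∀ t : ℝ≥0,
    μ t ω = m0 - β * (∫ s in (0 : ℝ)..t, μ s.toNNReal ω) + σ * W t ω

/-- The class `𝒜_ρ`: progressively measurable processes `X` with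
`E ∫₀^∞ e^{-ρ t} X_t² dt < ∞`. -/
def IsAdmissibleProcess (P : Measure Ω) (𝓕 : Filtration ℝ≥0 mΩ) (ρ : ℝ)
    (X : ℝ≥0 → Ω → ℝ) : Prop :=
  IsStronglyProgressive 𝓕 X ∧
    ∫⁻ ω, (∫⁻ t in Ioi (0 : ℝ),
      ENNReal.ofReal (Real.exp (-ρ * t) * X t.toNNReal ω ^ 2)) ∂P < ∞

/-! ### Feedback controls and the game -/

/-- A feedback trading rate: a function of the signal and of the positions of the `N` agents,
with values in `ℝ^N`. -/
abbrev Feedback (N : ℕ) := ℝ → (Fin N → ℝ) → (Fin N → ℝ)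

/-- The trading rates `u(μ_t, φ_t)` generated by the feedback `u` along `(μ, φ)`. -/
def rate {N : ℕ} (u : Feedback N) (μ : ℝ≥0 → Ω → ℝ) (φ : Fin N → ℝ≥0 → Ω → ℝ) :
    Fin N → ℝ≥0 → Ω → ℝ :=
  fun n t ω => u (μ t ω) (fun i => φ i t ω) n

/-- `φ` is a (progressively measurable) solution of the system `dφ_t = u(μ_t, φ_t) dt`
with zero initial positions. -/
structure IsPosition {N : ℕ} (P : Measure Ω) (𝓕 : Filtration ℝ≥0 mΩ) (μ : ℝ≥0 → Ω → ℝ)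
    (u : Feedback N) (φ : Fin N → ℝ≥0 → Ω → ℝ) : Prop where
  progressive : ∀ n, IsStronglyProgressive 𝓕 (φ n)
  dynamics : ∀ᵐ ω ∂P, ∀ (n : Fin N) (t : ℝ≥0),
    IntervalIntegrable (fun s : ℝ => rate u μ φ n s.toNNReal ω) volume 0 t ∧
      φ n t ω = ∫ s in (0 : ℝ)..t, rate u μ φ n s.toNNReal ω

/-- Admissible feedback trading rates: the controlled system has a solution, this solution is
unique (up to indistinguishability), and both the positions and the trading rates belong
to `𝒜_ρ`. -/
def IsAdmissibleFeedback {N : ℕ} (P : Measure Ω) (𝓕 : Filtration ℝ≥0 mΩ) (ρ : ℝ)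
    (μ : ℝ≥0 → Ω → ℝ) (u : Feedback N) : Prop :=
  ∃ φ : Fin N → ℝ≥0 → Ω → ℝ, IsPosition P 𝓕 μ u φ ∧
    (∀ ψ : Fin N → ℝ≥0 → Ω → ℝ, IsPosition P 𝓕 μ u ψ →
      ∀ᵐ ω ∂P, ∀ (n : Fin N) (t : ℝ≥0), ψ n t ω = φ n t ω) ∧
    (∀ n, IsAdmissibleProcess P 𝓕 ρ (φ n)) ∧
    (∀ n, IsAdmissibleProcess P 𝓕 ρ (rate u μ φ n))

/-- The goal functional of agent `n`,
`E ∫₀^∞ e^{-ρ t} (μ_t φⁿ_t - (γ/2) (φⁿ_t)² - lam φ̇ⁿ_t ∑ᵢ φ̇ⁱ_t) dt`, where the positions `φ`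
are traded at the rates `φ'`. -/
def goal {N : ℕ} (P : Measure Ω) (γ ρ lam : ℝ) (μ : ℝ≥0 → Ω → ℝ)
    (φ φ' : Fin N → ℝ≥0 → Ω → ℝ) (n : Fin N) : ℝ :=
  ∫ ω, (∫ t in Ioi (0 : ℝ), Real.exp (-ρ * t) *
    (μ t.toNNReal ω * φ n t.toNNReal ω - γ / 2 * φ n t.toNNReal ω ^ 2
      - lam * φ' n t.toNNReal ω * ∑ i, φ' i t.toNNReal ω)) ∂P

/-- Agent `n` deviates to the feedback `v`; the feedback functions of the others are fixed. -/
def deviate {N : ℕ} (u : Feedback N) (n : Fin N) (v : ℝ → (Fin N → ℝ) → ℝ) : Feedback N :=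
  fun m x => Function.update (u m x) n (v m x)

/-- Closed-loop Nash equilibrium: an admissible feedback from which no agent can profitably
deviate to another admissible feedback. -/
def IsClosedLoopNash {N : ℕ} (P : Measure Ω) (𝓕 : Filtration ℝ≥0 mΩ) (γ ρ lam : ℝ)
    (μ : ℝ≥0 → Ω → ℝ) (u : Feedback N) : Prop :=
  IsAdmissibleFeedback P 𝓕 ρ μ u ∧
    ∀ (n : Fin N) (v : ℝ → (Fin N → ℝ) → ℝ), IsAdmissibleFeedback P 𝓕 ρ μ (deviate u n v) →
      ∀ φ ψ : Fin N → ℝ≥0 → Ω → ℝ,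
        IsPosition P 𝓕 μ u φ → IsPosition P 𝓕 μ (deviate u n v) ψ →
        goal P γ ρ lam μ ψ (rate (deviate u n v) μ ψ) n ≤ goal P γ ρ lam μ φ (rate u μ φ) n

end Market

/-! ### The equilibrium system -/

/-- The ten unknowns: the coefficients of the quadratic value function
`-(a/2)x² + (b/2)y² + (c/2)m² - dxy + exm + fym + g` of one agent (own position `x`, common
position `y` of the others, signal `m`) and the coefficients of the linear feedback. -/
structure Coeffs where
  a : ℝ
  b : ℝ
  c : ℝ
  d : ℝ
  e : ℝ
  f : ℝ
  g : ℝ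
  abar : ℝ
  bbar : ℝ
  cbar : ℝ

/-- The symmetric linear feedback
`φ̇ⁿ = abar * μ + bbar * ∑_{m ≠ n} φᵐ - cbar * φⁿ`, `n = 1, …, N`. -/
def Coeffs.feedback (S : Coeffs) (N : ℕ) : Feedback N :=
  fun m x n => S.abar * m + S.bbar * (∑ i ∈ Finset.univ.erase n, x i) - S.cbar * x n

/-- The relative trading rate of the symmetric feedback. -/
def Coeffs.Mrate (S : Coeffs) (N : ℕ) : ℝ := S.cbar - ((N : ℝ) - 1) * S.bbar

/-- The multiple of `μ / γ` that is tracked: `abar = Mrate * Maim / γ`. -/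
def Coeffs.Maim (S : Coeffs) (N : ℕ) (γ : ℝ) : ℝ := γ * S.abar / S.Mrate N

/-- The ten equations: seven from the Hamilton-Jacobi-Bellman equation of one agent, and
three consistency conditions that express symmetry. -/
structure Coeffs.SolvesSystem (S : Coeffs) (N : ℕ) (β σ γ ρ lam : ℝ) : Prop where
  eq_a : 0 = ρ * S.a / 2 - γ / 2 - S.d * S.bbar
    + (S.a + lam * ((N : ℝ) - 1) * S.bbar) ^ 2 / (4 * lam)
  eq_b : 0 = -(ρ * S.b / 2) + S.b * (((N : ℝ) - 2) * S.bbar - S.cbar)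
    + (S.d + lam * ((N : ℝ) - 1) * (((N : ℝ) - 2) * S.bbar - S.cbar)) ^ 2 / (4 * lam)
  eq_d : 0 = ρ * S.d + S.b * S.bbar - S.d * (((N : ℝ) - 2) * S.bbar - S.cbar)
    + (S.a + lam * ((N : ℝ) - 1) * S.bbar)
      * (S.d + lam * ((N : ℝ) - 1) * (((N : ℝ) - 2) * S.bbar - S.cbar)) / (2 * lam)
  eq_g : 0 = -S.g + σ ^ 2 / (2 * ρ) * S.c
  eq_c : 0 = -((ρ + 2 * β) / 2) * S.c + S.f * S.abar
    + (S.e - lam * ((N : ℝ) - 1) * S.abar) ^ 2 / (4 * lam)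
  eq_e : 0 = -(ρ + β) * S.e + 1 - S.d * S.abar + S.bbar * S.f
    - (S.e - lam * ((N : ℝ) - 1) * S.abar) * (S.a + lam * ((N : ℝ) - 1) * S.bbar) / (2 * lam)
  eq_f : S.b * S.abar + S.f * (((N : ℝ) - 2) * S.bbar - S.cbar) = (ρ + β) * S.f
    + (S.e - lam * ((N : ℝ) - 1) * S.abar)
      * (S.d + lam * ((N : ℝ) - 1) * (((N : ℝ) - 2) * S.bbar - S.cbar)) / (2 * lam)
  eq_abar : S.abar = S.e / (((N : ℝ) + 1) * lam)
  eq_bbar : S.bbar = (-S.a * N + S.a + 2 * S.d) / (lam - lam * (N : ℝ) ^ 2)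
  eq_cbar : S.cbar = -((S.d - S.a * N) / (lam + lam * N))

/-! ### The scalar equation -/

/-- `Θ_N(lam, y)`: the coefficient `a` as a function of `d = √(γ lam) y`. -/
def Theta (N : ℕ) (γ ρ lam y : ℝ) : ℝ :=
  1 / (4 * (N : ℝ) ^ 2) *
    (lam * ((N : ℝ) + 1) ^ 2 *
      (√(ρ ^ 2
          + (8 * γ * (N : ℝ) ^ 2 - 4 * ρ * (3 * (N : ℝ) + 1) * y * √(γ * lam))
            / (lam * ((N : ℝ) + 1) ^ 2)
          - 4 * γ * (3 * (N : ℝ) + 1) * y ^ 2 / (lam * ((N : ℝ) - 1) * ((N : ℝ) + 1) ^ 2)) - ρ)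
      + (6 * (N : ℝ) + 2) * y * √(γ * lam))

/-- `Ψ_N(lam, y)`: the coefficient `b` as a function of `d = √(γ lam) y`. -/
def Psi (N : ℕ) (γ ρ lam y : ℝ) : ℝ :=
  2 * ((N : ℝ) - 1)
      * (Theta N γ ρ lam y - Theta N γ ρ lam y * N + 2 * y * √(γ * lam)) ^ 2
    / (((N : ℝ) + 1) * (ρ * lam * ((N : ℝ) ^ 2 - 1) + 4 * Theta N γ ρ lam y * ((N : ℝ) - 1)
        + 2 * ((N : ℝ) - 3) * y * √(γ * lam)))

/-- `Φ_N(lam, y)`, the left-hand side of the scalar equation `Φ_N(lam, y) = 0`, for `lam > 0`. -/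
def Phi (N : ℕ) (γ ρ lam y : ℝ) : ℝ :=
  1 / (lam * ((N : ℝ) - 1) * ((N : ℝ) + 1) ^ 2) *
    (y * (((N : ℝ) + 1) * √(γ * lam) * (ρ * lam * ((N : ℝ) ^ 2 - 1) - 2 * Psi N γ ρ lam y)
        + γ * lam * (((N : ℝ) - 6) * N + 1) * y)
      - 2 * Theta N γ ρ lam y ^ 2 * ((N : ℝ) - 1) ^ 2 * N
      + Theta N γ ρ lam y * ((N : ℝ) - 1)
        * (N * Psi N γ ρ lam y + 8 * N * y * √(γ * lam) + Psi N γ ρ lam y))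

/-- The limit of `Θ_N(lam, y) / √(γ lam)` as `lam → 0`. -/
def Theta0 (N : ℕ) (y : ℝ) : ℝ :=
  1 / (4 * (N : ℝ) ^ 2) *
    (((N : ℝ) + 1) * √(8 * (N : ℝ) ^ 2 - 4 * (3 * (N : ℝ) + 1) * y ^ 2 / ((N : ℝ) - 1))
      + (6 * (N : ℝ) + 2) * y)

/-- The limit of `Ψ_N(lam, y) / √(γ lam)` as `lam → 0`. -/
def Psi0 (N : ℕ) (y : ℝ) : ℝ :=
  2 * ((N : ℝ) - 1) * (Theta0 N y - Theta0 N y * N + 2 * y) ^ 2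
    / (((N : ℝ) + 1) * (4 * Theta0 N y * ((N : ℝ) - 1) + 2 * ((N : ℝ) - 3) * y))

/-- The limit of `Φ_N(lam, y) / γ` as `lam → 0`; it depends on `N` only. -/
def Phi0 (N : ℕ) (y : ℝ) : ℝ :=
  1 / (((N : ℝ) - 1) * ((N : ℝ) + 1) ^ 2) *
    (y * (-2 * ((N : ℝ) + 1) * Psi0 N y + (((N : ℝ) - 6) * N + 1) * y)
      - 2 * Theta0 N y ^ 2 * ((N : ℝ) - 1) ^ 2 * N
      + Theta0 N y * ((N : ℝ) - 1) * (N * Psi0 N y + 8 * N * y + Psi0 N y))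

/-- The interval `(0, √2 N √((N-1)/(3N+1))]` of positive arguments at which the square root in
the limiting scalar equation is that of a nonnegative number. -/
def rootInterval (N : ℕ) : Set ℝ :=
  Ioc 0 (√2 * N * √(((N : ℝ) - 1) / (3 * (N : ℝ) + 1)))

/-- `Δ(N)`, in terms of the root `δ` of the limiting scalar equation. -/
def Delta (N : ℕ) (δ : ℝ) : ℝ :=
  1 / (2 * (N : ℝ) ^ 2) *
      √((2 * (N : ℝ) ^ 3 - 2 * (N : ℝ) ^ 2 - 3 * N * δ ^ 2 - δ ^ 2) / ((N : ℝ) - 1))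
    + (2 * (N : ℝ) + 1) * δ / (2 * (N : ℝ) ^ 2)

/-- The equilibrium coefficients for small `lam > 0`: the solution `S lam` of the ten equations
whose coefficients `d` and `a` come from the root `δ lam` of the scalar equation that tends to
the root `δ0` of the limiting equation. -/
structure IsEquilibriumBranch (N : ℕ) (β σ γ ρ δ0 : ℝ) (δ : ℝ → ℝ) (S : ℝ → Coeffs) :
    Prop where
  tendsto_root : Tendsto δ (𝓝[>] 0) (𝓝 δ0)
  solves : ∀ᶠ lam in 𝓝[>] (0 : ℝ),
    Phi N γ ρ lam (δ lam) = 0 ∧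
    (S lam).d = √(γ * lam) * δ lam ∧
    (S lam).a = Theta N γ ρ lam (δ lam) ∧
    (S lam).SolvesSystem N β σ γ ρ lam

end PriceImpactGame

end

/-! The algebra. In units built from √γ and √lam, the equations for `a`, `b`, `d` depend on lam only
through η = ρ√(lam/γ). Put d = √(γ lam) y, let z be the rescaled ratio a/d from `ratio`, and h =
(N-1)η/(2y). The feedback coefficients `bbar`, `cbar` are then linear in z, the `b`-equation gives b
as a rational function, the `a`-equation reads y² · `profile` = 1/2, and the `d`-equation becomes
(2h+1-2Nz²)(2z+1+h) + (N-1)z³ = 0. At h = 0 this is -`cubic` = 0, which has exactly one positive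
root and none among the nonpositive z that can occur (`cubic_neg`). Along `Theta0` the ratio z
strictly decreases in y (`ratio_theta_lt`), so `Phi0` changes sign exactly once. This yields the
unique limiting root and, by the intermediate value theorem, nearby roots for small lam. The
coefficients `e`, `f`, `c`, `g` follow from linear equations (`Coeffs.ofScaled_solves`).

The expansions. The rate and the tracking multiple are differentiable functions of the scaled
variables (z, h, e), which lie within O(√lam) of (z₀, 0, 0) because z₀ is a simple root of the cubic
(`isBigO_branchVar`). The coefficient `c` is an explicit function of rate, multiple and √(lam/γ),
stationary in the multiple at its limit 1, so that errors of order √lam there cost only O(lam)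
(`isBigO_valueFun`).

The game. No stochastic integral is needed. For processes that are square-integrable under P ⊗
e^{-ρt}dt, the product rule and the Laplace transform of a primitive give linear relations among
discounted second moments (`pairing_primitive`, `IsNoise.signal_moments`). Weighting these by the
coefficients of the quadratic value function, and the HJB equations by the moments, completes the
square (`Coeffs.SolvesSystem.completion`): every admissible deviation earns c m0²/2 + g minus lam
times the discounted mean square of the deviation from the linear feedback. Hence the Nash property,
and for m0 = 0 the equilibrium value is g. -/

noncomputable section

namespace PriceImpactGame

/-! ### The limiting cubic equation -/

/-- The cubic whose positive root determines the limiting equilibrium. -/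
def cubic (n z : ℝ) : ℝ := (3 * n + 1) * z ^ 3 + 2 * n * z ^ 2 - 2 * z - 1

theorem exists_cubic_root {n : ℝ} (hn : 2 ≤ n) : ∃ z, 0 < z ∧ cubic n z = 0 := by
  have hc : ContinuousOn (cubic n) (Icc 0 1) := by unfold cubic; fun_prop
  have h0 : (0 : ℝ) ∈ Icc (cubic n 0) (cubic n 1) := by
    constructor <;> norm_num [cubic]
    linarith
  obtain ⟨z, hz, hz0⟩ := intermediate_value_Icc zero_le_one hc h0
  refine ⟨z, lt_of_le_of_ne hz.1 ?_, hz0⟩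
  rintro rfl
  norm_num [cubic] at hz0

/-- The cofactor of `z - z0` in the cubic, when `z0` is a root. -/
def cubicCofactor (n z0 z : ℝ) : ℝ := (3 * n + 1) * (z ^ 2 + z * z0) + 2 * n * z + 1 / z0

/-- In the quotient by z - z0 the terms free of z are (3n+1)z0² + 2n z0 - 2, which the root equation
turns into 1/z0. The cofactor is therefore at least 1/z0 on z > 0; this makes z0 the only positive
root and a simple one. -/
theorem cubic_eq_mul_cofactor {n z z0 : ℝ} (h0 : 0 < z0) (h : cubic n z0 = 0) :
    cubic n z = (z - z0) * cubicCofactor n z0 z := by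
  have hz0 : z0 ≠ 0 := h0.ne'
  have h' : 1 / z0 = (3 * n + 1) * z0 ^ 2 + 2 * n * z0 - 2 := by
    unfold cubic at h
    field_simp
    linarith
  rw [cubicCofactor, h']
  unfold cubic at *
  linear_combination h

theorem cubicCofactor_ge {n z z0 : ℝ} (hn : 2 ≤ n) (h0 : 0 < z0) (hz : 0 < z) :
    1 / z0 ≤ cubicCofactor n z0 z := by
  unfold cubicCofactor
  have : 0 ≤ (3 * n + 1) * (z ^ 2 + z * z0) + 2 * n * z := by positivity
  linarith

theorem cubicCofactor_pos {n z z0 : ℝ} (hn : 2 ≤ n) (h0 : 0 < z0) (hz : 0 < z) :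
    0 < cubicCofactor n z0 z :=
  lt_of_lt_of_le (by positivity) (cubicCofactor_ge hn h0 hz)

/-- A quantitative inverse: a small defect in the cubic equation forces z to be proportionally close
to the root. It supplies the rate of convergence of the ratio z along a branch. -/
theorem abs_sub_le_cubic {n z z0 : ℝ} (hn : 2 ≤ n) (h0 : 0 < z0) (hz : 0 < z)
    (h : cubic n z0 = 0) : |z - z0| ≤ z0 * |cubic n z| := by
  have h2 := cubicCofactor_ge hn h0 hz
  rw [cubic_eq_mul_cofactor h0 h, abs_mul, abs_of_pos (cubicCofactor_pos hn h0 hz)]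
  have h3 : 1 ≤ z0 * cubicCofactor n z0 z := by
    have := mul_le_mul_of_nonneg_left h2 h0.le
    rwa [mul_one_div_cancel h0.ne'] at this
  nlinarith [abs_nonneg (z - z0)]

/-- On the nonpositive part of the admissible range the cubic is negative. -/
theorem cubic_neg {N : ℕ} (hN : 2 ≤ N) {z : ℝ} (hz : z ≤ 0)
    (hz' : -((N : ℝ) + 1) ≤ 2 * (N : ℝ) ^ 2 * z) : cubic N z < 0 := by
  unfold cubic
  -- The estimate below rests on (3n+1)(n+1) < 2n³, which holds for n ≥ 3 but fails at n = 2.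
  rcases hN.eq_or_lt with rfl | hN'
  · norm_num at *
    nlinarith [mul_nonneg (neg_nonneg.2 hz) (by linarith : 0 ≤ z + 3 / 8),
      mul_nonneg (sq_nonneg z) (by linarith : 0 ≤ z + 3 / 8), sq_nonneg z]
  · have h3 : (3 : ℝ) ≤ N := by exact_mod_cast hN'
    set n : ℝ := (N : ℝ)
    have h1 : 2 * n * z ^ 2 * n ≤ -(n + 1) * z := by nlinarith
    have h2 : -(3 * n + 1) * z < n := by
      have : (3 * n + 1) * (n + 1) < 2 * n ^ 3 := by
        nlinarith [mul_nonneg (sub_nonneg.2 h3) (sub_nonneg.2 h3),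
          mul_nonneg (mul_nonneg (sub_nonneg.2 h3) (sub_nonneg.2 h3)) (sub_nonneg.2 h3)]
      have h4 : 2 * n ^ 2 * (-(3 * n + 1) * z) < 2 * n ^ 2 * n := by nlinarith
      exact lt_of_mul_lt_mul_left h4 (by positivity)
    have h5 : z ^ 3 ≤ 0 := by nlinarith [sq_nonneg z]
    -- By `h1` the left-hand side is at most -(3n+1)z - n, which is negative by `h2`. The cubic term
    -- of `cubic` only helps, since z³ ≤ 0.
    have h6 : n * (2 * n * z ^ 2 - 2 * z - 1) < 0 := by nlinarith
    have h7 : 2 * n * z ^ 2 - 2 * z - 1 < 0 := by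
      by_contra hc
      push Not at hc
      nlinarith
    nlinarith

theorem two_mul_add_one_pos {n z : ℝ} (hn : 2 ≤ n) (hz' : -(n + 1) ≤ 2 * n ^ 2 * z) :
    0 < 2 * z + 1 := by
  have : 0 < n ^ 2 * (2 * z + 1) := by nlinarith
  exact pos_of_mul_pos_right this (by positivity)

/-! ### The scaled functions -/

/-- `Theta` in the units `√(γ lam)`, as a function of `η = ρ √(lam / γ)`. -/
def thetaS (n η y : ℝ) : ℝ :=
  1 / (4 * n ^ 2) *
    ((n + 1) ^ 2 * (√(η ^ 2 + (8 * n ^ 2 - 4 * η * (3 * n + 1) * y) / (n + 1) ^ 2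
        - 4 * (3 * n + 1) * y ^ 2 / ((n - 1) * (n + 1) ^ 2)) - η) + (6 * n + 2) * y)

/-- The denominator of `psiS`, up to the factor `n + 1`. -/
def psiDen (n η y : ℝ) : ℝ :=
  η * (n ^ 2 - 1) + 4 * thetaS n η y * (n - 1) + 2 * (n - 3) * y

/-- `Psi` in the units `√(γ lam)`. -/
def psiS (n η y : ℝ) : ℝ :=
  2 * (n - 1) * (thetaS n η y - thetaS n η y * n + 2 * y) ^ 2 / ((n + 1) * psiDen n η y)

/-- `Phi` in the units `γ`. -/
def phiS (n η y : ℝ) : ℝ :=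
  1 / ((n - 1) * (n + 1) ^ 2) *
    (y * ((n + 1) * (η * (n ^ 2 - 1) - 2 * psiS n η y) + ((n - 6) * n + 1) * y)
      - 2 * thetaS n η y ^ 2 * (n - 1) ^ 2 * n
      + thetaS n η y * (n - 1) * (n * psiS n η y + 8 * n * y + psiS n η y))

section Scaling

variable {N : ℕ} {ρ q s : ℝ}

theorem sqrt_sq_mul_sq (hq : 0 < q) (hs : 0 < s) : √(q ^ 2 * s ^ 2) = q * s := by
  rw [← mul_pow, Real.sqrt_sq (by positivity)]

/-- With q = √γ and s = √lam this is a homogeneity: the radicand carries a factor (q/s)². Passing to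
q and s makes all later identities rational. -/
theorem theta_scale (hN : 2 ≤ N) (hq : 0 < q) (hs : 0 < s) (y : ℝ) :
    Theta N (q ^ 2) ρ (s ^ 2) y = q * s * thetaS N (ρ * (s / q)) y := by
  have hn : (2 : ℝ) ≤ N := by exact_mod_cast hN
  unfold Theta thetaS
  rw [sqrt_sq_mul_sq hq hs]
  set n : ℝ := (N : ℝ)
  have h1 : n - 1 ≠ 0 := by linarith
  have h2 : n + 1 ≠ 0 := by linarith
  have h3 : n ≠ 0 := by linarith
  have key : ρ ^ 2 + (8 * q ^ 2 * n ^ 2 - 4 * ρ * (3 * n + 1) * y * (q * s)) / (s ^ 2 * (n + 1) ^ 2)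
      - 4 * q ^ 2 * (3 * n + 1) * y ^ 2 / (s ^ 2 * (n - 1) * (n + 1) ^ 2)
      = (q / s) ^ 2 * ((ρ * (s / q)) ^ 2
        + (8 * n ^ 2 - 4 * (ρ * (s / q)) * (3 * n + 1) * y) / (n + 1) ^ 2
        - 4 * (3 * n + 1) * y ^ 2 / ((n - 1) * (n + 1) ^ 2)) := by
    field_simp
  rw [key, Real.sqrt_mul (by positivity), Real.sqrt_sq (by positivity)]
  field_simp

theorem psi_scale (hN : 2 ≤ N) (hq : 0 < q) (hs : 0 < s) (y : ℝ) :
    Psi N (q ^ 2) ρ (s ^ 2) y = q * s * psiS N (ρ * (s / q)) y := by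
  unfold Psi psiS psiDen
  rw [sqrt_sq_mul_sq hq hs, theta_scale hN hq hs]
  set T := thetaS N (ρ * (s / q)) y
  set n : ℝ := (N : ℝ)
  have h1 : (n + 1) * (ρ * s ^ 2 * (n ^ 2 - 1) + 4 * (q * s * T) * (n - 1)
      + 2 * (n - 3) * y * (q * s)) = (q * s) * ((n + 1) * (ρ * (s / q) * (n ^ 2 - 1)
        + 4 * T * (n - 1) + 2 * (n - 3) * y)) := by
    field_simp
  have h2 : 2 * (n - 1) * (q * s * T - q * s * T * n + 2 * y * (q * s)) ^ 2
      = (q * s) * (q * s * (2 * (n - 1) * (T - T * n + 2 * y) ^ 2)) := by ring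
  rw [h1, h2, mul_div_mul_left _ _ (by positivity), mul_div_assoc]

theorem phi_scale (hN : 2 ≤ N) (hq : 0 < q) (hs : 0 < s) (y : ℝ) :
    Phi N (q ^ 2) ρ (s ^ 2) y = q ^ 2 * phiS N (ρ * (s / q)) y := by
  have hn : (2 : ℝ) ≤ N := by exact_mod_cast hN
  unfold Phi phiS
  rw [sqrt_sq_mul_sq hq hs, theta_scale hN hq hs, psi_scale hN hq hs]
  set T := thetaS N (ρ * (s / q)) y
  set B := psiS N (ρ * (s / q)) y
  set n : ℝ := (N : ℝ)
  have h1 : n - 1 ≠ 0 := by linarith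
  have h2 : n + 1 ≠ 0 := by linarith
  field_simp

theorem theta0_eq (hN : 2 ≤ N) (y : ℝ) : Theta0 N y = thetaS N 0 y := by
  have hn : (2 : ℝ) ≤ N := by exact_mod_cast hN
  unfold Theta0 thetaS
  set n : ℝ := (N : ℝ)
  have h1 : n - 1 ≠ 0 := by linarith
  have h2 : n + 1 ≠ 0 := by linarith
  have key : (8 * n ^ 2 - 4 * (3 * n + 1) * y ^ 2 / (n - 1))
      = (n + 1) ^ 2 * (0 ^ 2 + (8 * n ^ 2 - 4 * 0 * (3 * n + 1) * y) / (n + 1) ^ 2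
        - 4 * (3 * n + 1) * y ^ 2 / ((n - 1) * (n + 1) ^ 2)) := by
    field_simp
    ring
  rw [key, Real.sqrt_mul (by positivity), Real.sqrt_sq (by positivity)]
  ring

theorem psi0_eq (hN : 2 ≤ N) (y : ℝ) : Psi0 N y = psiS N 0 y := by
  unfold Psi0 psiS psiDen
  rw [theta0_eq hN, zero_mul, zero_add]

theorem phi0_eq (hN : 2 ≤ N) (y : ℝ) : Phi0 N y = phiS N 0 y := by
  unfold Phi0 phiS
  rw [theta0_eq hN, psi0_eq hN]
  ring

end Scaling

section Scaled

variable {n η y : ℝ}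

/-- The square root is dropped. The bound also holds where the radicand is negative, as `√` is then
0. -/
theorem thetaS_ge (hn : 2 ≤ n) :
    (6 * n + 2) * y - (n + 1) ^ 2 * η ≤ 4 * n ^ 2 * thetaS n η y := by
  have h3 : n ≠ 0 := by linarith
  unfold thetaS
  rw [← mul_assoc, mul_one_div_cancel (by positivity), one_mul]
  nlinarith [mul_nonneg (sq_nonneg (n + 1)) (Real.sqrt_nonneg
    (η ^ 2 + (8 * n ^ 2 - 4 * η * (3 * n + 1) * y) / (n + 1) ^ 2
        - 4 * (3 * n + 1) * y ^ 2 / ((n - 1) * (n + 1) ^ 2)))]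

/-- After multiplication by n², `thetaS_ge` bounds the denominator below by (2n³-4n-2)y +
(n²-n-1)(n²-1)η. The radicand plays no role, so `phiS` is continuous at every point with η ≥ 0 and y
> 0. -/
theorem psiDen_pos (hn : 2 ≤ n) (hη : 0 ≤ η) (hy : 0 < y) : 0 < psiDen n η y := by
  have h := thetaS_ge (η := η) (y := y) hn
  have h1 : 0 < n ^ 2 * psiDen n η y := by
    unfold psiDen
    have h2 := mul_le_mul_of_nonneg_left h (by linarith : 0 ≤ n - 1)
    have h3 : 0 < (2 * n ^ 3 - 4 * n - 2) * y := by
      apply mul_pos _ hy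
      nlinarith [mul_nonneg (sub_nonneg.2 hn) (sub_nonneg.2 hn),
        mul_nonneg (mul_nonneg (sub_nonneg.2 hn) (sub_nonneg.2 hn)) (sub_nonneg.2 hn)]
    have h4 : 0 ≤ (n ^ 2 - n - 1) * ((n - 1) * (n + 1) * η) := by
      apply mul_nonneg
      · nlinarith
      · exact mul_nonneg (mul_nonneg (by linarith) (by linarith)) hη
    nlinarith
  exact pos_of_mul_pos_right h1 (by positivity)

theorem continuousAt_phiS (hn : 2 ≤ n) (hη : 0 ≤ η) (hy : 0 < y) :
    ContinuousAt (fun p : ℝ × ℝ => phiS n p.1 p.2) (η, y) := by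
  have hT : Continuous (fun p : ℝ × ℝ => thetaS n p.1 p.2) := by unfold thetaS; fun_prop
  have hD : Continuous (fun p : ℝ × ℝ => psiDen n p.1 p.2) := by unfold psiDen; fun_prop
  have hB : ContinuousAt (fun p : ℝ × ℝ => psiS n p.1 p.2) (η, y) := by
    unfold psiS
    refine ContinuousAt.div (by fun_prop) (by fun_prop) ?_
    exact mul_ne_zero (by linarith) (psiDen_pos hn hη hy).ne'
  unfold phiS
  fun_prop

/-- The first equation in scaled form holds along `thetaS` when the root is real. -/
theorem thetaS_quadratic (hn : 2 ≤ n)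
    (h : 0 ≤ η ^ 2 + (8 * n ^ 2 - 4 * η * (3 * n + 1) * y) / (n + 1) ^ 2
        - 4 * (3 * n + 1) * y ^ 2 / ((n - 1) * (n + 1) ^ 2)) :
    η * thetaS n η y / 2 - 1 / 2 - y * (((n - 1) * thetaS n η y - 2 * y) / (n ^ 2 - 1))
      + ((n * thetaS n η y - y) / (n + 1)) ^ 2 = 0 := by
  have h1 : n - 1 ≠ 0 := by linarith
  have h2 : n + 1 ≠ 0 := by linarith
  have h3 : n ≠ 0 := by linarith
  have h4 : n ^ 2 - 1 ≠ 0 := by nlinarith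
  have hs := Real.sq_sqrt h
  unfold thetaS
  set r := √(η ^ 2 + (8 * n ^ 2 - 4 * η * (3 * n + 1) * y) / (n + 1) ^ 2
        - 4 * (3 * n + 1) * y ^ 2 / ((n - 1) * (n + 1) ^ 2))
  have h5 : n ^ 2 - 1 = (n - 1) * (n + 1) := by ring
  rw [h5]
  field_simp at hs ⊢
  linear_combination 2 * (n + 1) ^ 2 * hs

/-- The value of `phiS` in terms of the ratio `z` and the scaled rate `h`. -/
theorem phiS_of_ratio {z h : ℝ} (hn : 2 ≤ n) (hy : 0 < y) (hp : 2 * z + 1 + h ≠ 0)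
    (hη : (n - 1) * η = 2 * h * y) (hT : (n - 1) * thetaS n η y = y * ((n + 1) * z + 2)) :
    psiS n η y = y * (z ^ 2 * (n - 1) / (2 * z + 1 + h)) ∧
    (n - 1) * (2 * z + 1 + h) * phiS n η y
      = y ^ 2 * ((2 * h + 1 - 2 * n * z ^ 2) * (2 * z + 1 + h) + (n - 1) * z ^ 3) := by
  have h1 : n - 1 ≠ 0 := by linarith
  have h2 : n + 1 ≠ 0 := by linarith
  have hT' : thetaS n η y = y * ((n + 1) * z + 2) / (n - 1) := by field_simp; linarith
  have hη' : η = 2 * h * y / (n - 1) := by field_simp; linarith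
  have hB : psiS n η y = y * (z ^ 2 * (n - 1) / (2 * z + 1 + h)) := by
    have hden : psiDen n η y = 2 * (n + 1) * y * (2 * z + 1 + h) := by
      unfold psiDen
      rw [hT', hη']
      field_simp
      ring
    unfold psiS
    rw [hden, hT']
    field_simp
    ring
  refine ⟨hB, ?_⟩
  unfold phiS
  rw [hB, hT', hη']
  field_simp
  ring

end Scaled

end PriceImpactGame
end

noncomputable section

namespace PriceImpactGame

/-! ### The root of the limiting equation -/

/-- The ratio that parametrizes the coefficient `a` in terms of `d`. -/
def ratio (n A y : ℝ) : ℝ := ((n - 1) * (A / y) - 2) / (n + 1)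

/-- In the units of `ratio`, the first equation is `y ^ 2 * profile n z h = 1 / 2`. -/
def profile (n z h : ℝ) : ℝ :=
  (h * ((n + 1) * z + 2) - (n - 1) * z + (n * z + 1) ^ 2) / (n - 1) ^ 2

theorem ratio_spec {n A y : ℝ} (hn : 2 ≤ n) (hy : 0 < y) :
    (n - 1) * A = y * ((n + 1) * ratio n A y + 2) := by
  have h2 : n + 1 ≠ 0 := by linarith
  unfold ratio
  field_simp
  ring

theorem profile_eq {n η A y z h : ℝ} (hn : 2 ≤ n) (hη : (n - 1) * η = 2 * h * y)
    (hA : (n - 1) * A = y * ((n + 1) * z + 2)) :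
    η * A / 2 - 1 / 2 - y * (((n - 1) * A - 2 * y) / (n ^ 2 - 1))
      + ((n * A - y) / (n + 1)) ^ 2 = y ^ 2 * profile n z h - 1 / 2 := by
  have h1 : n - 1 ≠ 0 := by linarith
  have h2 : n + 1 ≠ 0 := by linarith
  have hA' : A = y * ((n + 1) * z + 2) / (n - 1) := by field_simp; linarith
  have hη' : η = 2 * h * y / (n - 1) := by field_simp; linarith
  have h5 : n ^ 2 - 1 = (n - 1) * (n + 1) := by ring
  rw [hA', hη', h5]
  unfold profile
  field_simp
  ring

theorem profile_zero_pos {n z : ℝ} (hn : 2 ≤ n) (hz : 0 < z) : 0 < profile n z 0 := by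
  unfold profile
  have : 0 < n - 1 := by linarith
  refine div_pos ?_ (by positivity)
  nlinarith [sq_nonneg (n * z)]

theorem mem_rootInterval_iff {N : ℕ} (hN : 2 ≤ N) {y : ℝ} :
    y ∈ rootInterval N ↔ 0 < y ∧ (3 * (N : ℝ) + 1) * y ^ 2 ≤ 2 * (N : ℝ) ^ 2 * ((N : ℝ) - 1) := by
  have hn : (2 : ℝ) ≤ N := by exact_mod_cast hN
  unfold rootInterval
  set n : ℝ := (N : ℝ)
  have h1 : 0 < n - 1 := by linarith
  have h2 : 0 < 3 * n + 1 := by linarith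
  rw [mem_Ioc, and_congr_right_iff]
  intro hy
  rw [← sq_le_sq₀ hy.le (by positivity), mul_pow, mul_pow, Real.sq_sqrt (by positivity),
    Real.sq_sqrt (by positivity), mul_div_assoc', le_div_iff₀ h2, mul_comm (3 * n + 1)]

/-- `thetaS_ge` in terms of the ratio. This is the range in which `cubic_neg` excludes nonpositive
roots and `two_mul_add_one_pos` keeps the denominator 2z+1 positive. -/
theorem ratio_theta_ge {n y : ℝ} (hn : 2 ≤ n) (hy : 0 < y) :
    -(n + 1) ≤ 2 * n ^ 2 * ratio n (thetaS n 0 y) y := by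
  have h := thetaS_ge (η := 0) (y := y) hn
  have hz := ratio_spec (A := thetaS n 0 y) hn hy
  set z := ratio n (thetaS n 0 y) y
  have h1 : 0 < n - 1 := by linarith
  have h2 := mul_le_mul_of_nonneg_left h h1.le
  have h3 : (n - 1) * ((6 * n + 2) * y) ≤ 4 * n ^ 2 * (y * ((n + 1) * z + 2)) := by
    rw [← hz]; linarith
  have h4 : 0 ≤ (2 * (n + 1) * y) * (2 * n ^ 2 * z + (n + 1)) := by linarith
  have := nonneg_of_mul_nonneg_right h4 (by positivity)
  linarith

/-- The factor on the left is positive, so in the limit the sign of `phiS` is opposite to that of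
the cubic at the ratio. -/
theorem phiS_zero_eq {n y : ℝ} (hn : 2 ≤ n) (hy : 0 < y) :
    (n - 1) * (2 * ratio n (thetaS n 0 y) y + 1) * phiS n 0 y
      = -(y ^ 2 * cubic n (ratio n (thetaS n 0 y) y)) := by
  have hp := two_mul_add_one_pos hn (ratio_theta_ge hn hy)
  have := (phiS_of_ratio (h := 0) (η := 0) hn hy (by rw [add_zero]; exact hp.ne') (by simp)
    (ratio_spec hn hy)).2
  rw [add_zero] at this
  rw [this, cubic]
  ring

/-- Up to an additive constant, Θ/y is a positive multiple of the square root divided by y; the root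
strictly decreases in y as long as the radicand at the larger point is nonnegative. -/
theorem ratio_theta_lt {n y₁ y₂ : ℝ} (hn : 2 ≤ n) (h₁ : 0 < y₁) (h₁₂ : y₁ < y₂)
    (h₂ : (3 * n + 1) * y₂ ^ 2 ≤ 2 * n ^ 2 * (n - 1)) :
    ratio n (thetaS n 0 y₂) y₂ < ratio n (thetaS n 0 y₁) y₁ := by
  have hn1 : 0 < n - 1 := by linarith
  have key : thetaS n 0 y₂ / y₂ < thetaS n 0 y₁ / y₁ := by
    rw [div_lt_div_iff₀ (h₁.trans h₁₂) h₁]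
    have hlt : √(0 ^ 2 + (8 * n ^ 2 - 4 * 0 * (3 * n + 1) * y₂) / (n + 1) ^ 2
        - 4 * (3 * n + 1) * y₂ ^ 2 / ((n - 1) * (n + 1) ^ 2))
        < √(0 ^ 2 + (8 * n ^ 2 - 4 * 0 * (3 * n + 1) * y₁) / (n + 1) ^ 2
        - 4 * (3 * n + 1) * y₁ ^ 2 / ((n - 1) * (n + 1) ^ 2)) := by
      apply Real.sqrt_lt_sqrt
      · have : 0 ^ 2 + (8 * n ^ 2 - 4 * 0 * (3 * n + 1) * y₂) / (n + 1) ^ 2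
          - 4 * (3 * n + 1) * y₂ ^ 2 / ((n - 1) * (n + 1) ^ 2)
          = 4 * (2 * n ^ 2 * (n - 1) - (3 * n + 1) * y₂ ^ 2) / ((n - 1) * (n + 1) ^ 2) := by
          have : n + 1 ≠ 0 := by linarith
          field_simp
          ring
        rw [this]
        exact div_nonneg (by linarith) (by positivity)
      · simp only [mul_zero, zero_mul, sub_zero]
        gcongr
    unfold thetaS
    set r₂ := √(0 ^ 2 + (8 * n ^ 2 - 4 * 0 * (3 * n + 1) * y₂) / (n + 1) ^ 2
        - 4 * (3 * n + 1) * y₂ ^ 2 / ((n - 1) * (n + 1) ^ 2))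
    set r₁ := √(0 ^ 2 + (8 * n ^ 2 - 4 * 0 * (3 * n + 1) * y₁) / (n + 1) ^ 2
        - 4 * (3 * n + 1) * y₁ ^ 2 / ((n - 1) * (n + 1) ^ 2))
    have h0 : 0 ≤ r₂ := Real.sqrt_nonneg _
    have h3 : r₂ * y₁ < r₁ * y₂ := by nlinarith
    have h4 : 0 < 1 / (4 * n ^ 2) * (n + 1) ^ 2 := by positivity
    nlinarith
  unfold ratio
  gcongr

theorem phiS_zero_neg {N : ℕ} (hN : 2 ≤ N) {y₀ y : ℝ}
    (h₀ : (3 * (N : ℝ) + 1) * y₀ ^ 2 ≤ 2 * (N : ℝ) ^ 2 * ((N : ℝ) - 1))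
    (hz : 0 < ratio N (thetaS N 0 y₀) y₀) (hc : cubic N (ratio N (thetaS N 0 y₀) y₀) = 0)
    (hy : 0 < y) (hlt : y < y₀) : phiS N 0 y < 0 := by
  have hn : (2 : ℝ) ≤ N := by exact_mod_cast hN
  have h1 := phiS_zero_eq hn hy
  have h2 := ratio_theta_lt hn hy hlt h₀
  have h3 : 0 < cubic N (ratio N (thetaS N 0 y) y) := by
    rw [cubic_eq_mul_cofactor hz hc]
    exact mul_pos (sub_pos.2 h2) (cubicCofactor_pos hn hz (hz.trans h2))
  have h4 := two_mul_add_one_pos hn (ratio_theta_ge hn hy)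
  have h5 : 0 < ((N : ℝ) - 1) * (2 * ratio N (thetaS N 0 y) y + 1) :=
    mul_pos (by linarith) h4
  have h6 : 0 < y ^ 2 * cubic N (ratio N (thetaS N 0 y) y) := by positivity
  by_contra hcon
  push Not at hcon
  have := mul_nonneg h5.le hcon
  linarith

theorem phiS_zero_pos {N : ℕ} (hN : 2 ≤ N) {y₀ y : ℝ}
    (hy₀ : 0 < y₀)
    (hz : 0 < ratio N (thetaS N 0 y₀) y₀) (hc : cubic N (ratio N (thetaS N 0 y₀) y₀) = 0)
    (hlt : y₀ < y) (h : (3 * (N : ℝ) + 1) * y ^ 2 ≤ 2 * (N : ℝ) ^ 2 * ((N : ℝ) - 1)) :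
    0 < phiS N 0 y := by
  have hn : (2 : ℝ) ≤ N := by exact_mod_cast hN
  have hy := hy₀.trans hlt
  have h1 := phiS_zero_eq hn hy
  have h2 := ratio_theta_lt hn hy₀ hlt h
  have h3 : cubic N (ratio N (thetaS N 0 y) y) < 0 := by
    rcases le_or_gt (ratio N (thetaS N 0 y) y) 0 with hle | hgt
    · exact cubic_neg hN hle (ratio_theta_ge hn hy)
    · rw [cubic_eq_mul_cofactor hz hc]
      exact mul_neg_of_neg_of_pos (sub_neg.2 h2) (cubicCofactor_pos hn hz hgt)
  have h4 := two_mul_add_one_pos hn (ratio_theta_ge hn hy)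
  have h5 : 0 < ((N : ℝ) - 1) * (2 * ratio N (thetaS N 0 y) y + 1) :=
    mul_pos (by linarith) h4
  have h6 : 0 < -(y ^ 2 * cubic N (ratio N (thetaS N 0 y) y)) := by
    have : 0 < y ^ 2 := by positivity
    nlinarith
  rw [← h1] at h6
  exact pos_of_mul_pos_right h6 h5.le

/-- The limiting root, in terms of the positive root `z` of the cubic. -/
structure IsLimitRoot (n z y : ℝ) : Prop where
  pos_z : 0 < z
  pos : 0 < y
  cubic_eq : cubic n z = 0
  profile_eq : y ^ 2 * profile n z 0 = 1 / 2

theorem exists_isLimitRoot {n : ℝ} (hn : 2 ≤ n) : ∃ z y, IsLimitRoot n z y := by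
  obtain ⟨z, hz, hc⟩ := exists_cubic_root hn
  have hH := profile_zero_pos hn hz
  refine ⟨z, (√(2 * profile n z 0))⁻¹, hz, by positivity, hc, ?_⟩
  rw [inv_pow, Real.sq_sqrt (by positivity)]
  field_simp

namespace IsLimitRoot

/-- The profile equation turns the radicand into a perfect square. Since z > 0, its positive root is
the branch that `thetaS` selects, so the ratio of `thetaS` at y is z itself. -/
theorem sqrt_arg_eq {n z y : ℝ} (hn : 2 ≤ n) (h : IsLimitRoot n z y) :
    0 ^ 2 + (8 * n ^ 2 - 4 * 0 * (3 * n + 1) * y) / (n + 1) ^ 2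
      - 4 * (3 * n + 1) * y ^ 2 / ((n - 1) * (n + 1) ^ 2)
      = (y * (2 * (n + 1) + 4 * n ^ 2 * z) / ((n - 1) * (n + 1))) ^ 2 := by
  have h1 : n - 1 ≠ 0 := by linarith
  have h2 : n + 1 ≠ 0 := by linarith
  have hp := h.profile_eq
  unfold profile at hp
  field_simp at hp ⊢
  linear_combination (-8 * n ^ 2) * hp

/-- Strictness leaves points of the interval to the right of the root, where the sign change needed
for nearby roots takes place. -/
theorem lt_endpoint {n z y : ℝ} (hn : 2 ≤ n) (h : IsLimitRoot n z y) :
    (3 * n + 1) * y ^ 2 < 2 * n ^ 2 * (n - 1) := by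
  have h1 : 0 < n - 1 := by linarith
  have h2 : 0 < n + 1 := by linarith
  have hz := h.pos_z
  have hy := h.pos
  have key := h.sqrt_arg_eq hn
  have hpos : 0 < (y * (2 * (n + 1) + 4 * n ^ 2 * z) / ((n - 1) * (n + 1))) ^ 2 := by positivity
  rw [← key] at hpos
  have e : 0 ^ 2 + (8 * n ^ 2 - 4 * 0 * (3 * n + 1) * y) / (n + 1) ^ 2
      - 4 * (3 * n + 1) * y ^ 2 / ((n - 1) * (n + 1) ^ 2)
      = 4 / ((n - 1) * (n + 1) ^ 2) * (2 * n ^ 2 * (n - 1) - (3 * n + 1) * y ^ 2) := by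
    field_simp
    ring
  rw [e] at hpos
  have := pos_of_mul_pos_right hpos (by positivity)
  linarith

theorem thetaS_eq {n z y : ℝ} (hn : 2 ≤ n) (h : IsLimitRoot n z y) :
    (n - 1) * thetaS n 0 y = y * ((n + 1) * z + 2) := by
  have h1 : 0 < n - 1 := by linarith
  have h2 : 0 < n + 1 := by linarith
  have hz := h.pos_z
  have hy := h.pos
  unfold thetaS
  rw [h.sqrt_arg_eq hn, Real.sqrt_sq (by positivity)]
  field_simp
  ring

theorem ratio_eq {n z y : ℝ} (hn : 2 ≤ n) (h : IsLimitRoot n z y) :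
    ratio n (thetaS n 0 y) y = z := by
  have h2 : n + 1 ≠ 0 := by linarith
  have hy := h.pos.ne'
  have := h.thetaS_eq hn
  unfold ratio
  rw [mul_div_assoc', this]
  field_simp
  ring

variable {N : ℕ} {z y : ℝ}

theorem mem_rootInterval (hN : 2 ≤ N) (h : IsLimitRoot N z y) : y ∈ rootInterval N :=
  (mem_rootInterval_iff hN).2 ⟨h.pos, (h.lt_endpoint (by exact_mod_cast hN)).le⟩

theorem phiS_neg (hN : 2 ≤ N) (h : IsLimitRoot N z y) {y' : ℝ} (hy : 0 < y') (hlt : y' < y) :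
    phiS N 0 y' < 0 := by
  have hn : (2 : ℝ) ≤ N := by exact_mod_cast hN
  have hr := h.ratio_eq hn
  refine phiS_zero_neg hN (h.lt_endpoint hn).le ?_ ?_ hy hlt <;> rw [hr]
  exacts [h.pos_z, h.cubic_eq]

theorem phiS_pos (hN : 2 ≤ N) (h : IsLimitRoot N z y) {y' : ℝ} (hlt : y < y')
    (hy : (3 * (N : ℝ) + 1) * y' ^ 2 ≤ 2 * (N : ℝ) ^ 2 * ((N : ℝ) - 1)) :
    0 < phiS N 0 y' := by
  have hn : (2 : ℝ) ≤ N := by exact_mod_cast hN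
  have hr := h.ratio_eq hn
  refine phiS_zero_pos hN h.pos ?_ ?_ hlt hy <;> rw [hr]
  exacts [h.pos_z, h.cubic_eq]

theorem phi0_eq_zero (hN : 2 ≤ N) (h : IsLimitRoot N z y) : Phi0 N y = 0 := by
  have hn : (2 : ℝ) ≤ N := by exact_mod_cast hN
  have h1 := phiS_zero_eq hn h.pos
  rw [h.ratio_eq hn, h.cubic_eq, mul_zero, neg_zero] at h1
  have hz := h.pos_z
  rw [phi0_eq hN]
  refine (mul_eq_zero.1 h1).resolve_left (mul_ne_zero (by linarith) (by linarith))

theorem unique (hN : 2 ≤ N) (h : IsLimitRoot N z y) {y' : ℝ} (hy' : y' ∈ rootInterval N)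
    (h0 : Phi0 N y' = 0) : y' = y := by
  rw [mem_rootInterval_iff hN] at hy'
  rw [phi0_eq hN] at h0
  rcases lt_trichotomy y' y with hlt | heq | hgt
  · exact absurd h0 (h.phiS_neg hN hy'.1 hlt).ne
  · exact heq
  · exact absurd h0 (h.phiS_pos hN hgt hy'.2).ne'

/-- The radicand in `Delta` is the same perfect square up to a factor. The right-hand side is the
scaled trading rate `rateFun` in the limit, because y is the inverse root of twice the profile. -/
theorem delta_eq (hN : 2 ≤ N) (h : IsLimitRoot N z y) :
    Delta N y = (z + 1) * y / ((N : ℝ) - 1) := by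
  have hn : (2 : ℝ) ≤ N := by exact_mod_cast hN
  have hz := h.pos_z
  have hy := h.pos
  have key := h.sqrt_arg_eq hn
  unfold Delta
  set n : ℝ := (N : ℝ)
  have h1 : 0 < n - 1 := by linarith
  have e : (2 * n ^ 3 - 2 * n ^ 2 - 3 * n * y ^ 2 - y ^ 2) / (n - 1)
      = (y * (n + 1 + 2 * n ^ 2 * z) / (n - 1)) ^ 2 := by
    field_simp at key ⊢
    linear_combination key / 4
  rw [e, Real.sqrt_sq (by positivity)]
  field_simp
  ring

theorem delta_pos (hN : 2 ≤ N) (h : IsLimitRoot N z y) : 0 < Delta N y := by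
  have hn : (2 : ℝ) ≤ N := by exact_mod_cast hN
  have hz := h.pos_z
  have hy := h.pos
  rw [h.delta_eq hN]
  exact div_pos (by positivity) (by linarith)

end IsLimitRoot

/-! ### Roots of the scalar equation for small transaction costs -/

theorem tendsto_scale (γ ρ : ℝ) : Tendsto (fun lam => ρ * (√lam / √γ)) (𝓝[>] 0) (𝓝 0) := by
  have h : Continuous (fun lam => ρ * (√lam / √γ)) := by fun_prop
  have := h.tendsto 0
  simp only [Real.sqrt_zero, zero_div, mul_zero] at this
  exact this.mono_left nhdsWithin_le_nhds

theorem phi_eq_phiS {N : ℕ} (hN : 2 ≤ N) {γ ρ lam : ℝ} (hγ : 0 < γ) (hl : 0 < lam) (y : ℝ) :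
    Phi N γ ρ lam y = γ * phiS N (ρ * (√lam / √γ)) y := by
  have := phi_scale (ρ := ρ) hN (Real.sqrt_pos.2 hγ) (Real.sqrt_pos.2 hl) y
  rwa [Real.sq_sqrt hγ.le, Real.sq_sqrt hl.le] at this

theorem tendsto_phi {N : ℕ} (hN : 2 ≤ N) {γ ρ : ℝ} (hγ : 0 < γ) {y : ℝ} (hy : 0 < y) :
    Tendsto (fun lam => Phi N γ ρ lam y) (𝓝[>] 0) (𝓝 (γ * Phi0 N y)) := by
  have hn : (2 : ℝ) ≤ N := by exact_mod_cast hN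
  have h1 : Tendsto (fun lam => γ * phiS N (ρ * (√lam / √γ)) y) (𝓝[>] 0) (𝓝 (γ * phiS N 0 y)) := by
    have := (continuousAt_phiS (η := 0) hn le_rfl hy).tendsto.comp
      ((tendsto_scale γ ρ).prodMk_nhds (tendsto_const_nhds (x := y)))
    exact this.const_mul γ
  rw [phi0_eq hN]
  refine h1.congr' ?_
  filter_upwards [self_mem_nhdsWithin] with lam hlam
  rw [phi_eq_phiS hN hγ hlam]

/-- One selection must serve all κ. For each x, a solution is picked whose distance to a exceeds the
infimum of such distances by less than x; the infimum tends to 0 with x. -/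
theorem exists_tendsto_of_forall_near {p : ℝ → ℝ → Prop} {a : ℝ}
    (h : ∀ κ > 0, ∀ᶠ x in 𝓝[>] (0 : ℝ), ∃ y, |y - a| < κ ∧ p x y) :
    ∃ δ : ℝ → ℝ, Tendsto δ (𝓝[>] 0) (𝓝 a) ∧ ∀ᶠ x in 𝓝[>] (0 : ℝ), p x (δ x) := by
  classical
  have hex : ∀ x : ℝ, 0 < x → (∃ y, p x y) →
      ∃ y, p x y ∧ ∀ y', p x y' → |y - a| < |y' - a| + x := by
    rintro x hx ⟨y₀, hy₀⟩
    set S := (fun y => |y - a|) '' {y | p x y}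
    have hne : S.Nonempty := ⟨_, y₀, hy₀, rfl⟩
    have hbdd : BddBelow S := ⟨0, by rintro _ ⟨y, _, rfl⟩; exact abs_nonneg _⟩
    obtain ⟨_, ⟨y, hy, rfl⟩, hlt⟩ := exists_lt_of_csInf_lt hne (lt_add_of_pos_right (sInf S) hx)
    refine ⟨y, hy, fun y' hy' => hlt.trans_le ?_⟩
    have := csInf_le hbdd ⟨y', hy', rfl⟩
    linarith
  choose! δ hδ using hex
  refine ⟨δ, ?_, ?_⟩
  · rw [Metric.tendsto_nhds]
    intro κ hκ
    have hx2 : ∀ᶠ x in 𝓝[>] (0 : ℝ), x < κ / 2 :=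
      nhdsWithin_le_nhds (Iio_mem_nhds (by positivity))
    filter_upwards [h (κ / 2) (by positivity), hx2, self_mem_nhdsWithin] with x ⟨y, hy, hp⟩ hx hx0
    rw [Real.dist_eq]
    have := (hδ x hx0 ⟨y, hp⟩).2 y hp
    linarith
  · filter_upwards [h 1 one_pos, self_mem_nhdsWithin] with x ⟨y, _, hp⟩ hx0
    exact (hδ x hx0 ⟨y, hp⟩).1

theorem IsLimitRoot.exists_branch_root {N : ℕ} {z y : ℝ} (hN : 2 ≤ N) (h : IsLimitRoot N z y)
    {γ ρ : ℝ} (hγ : 0 < γ) (hρ : 0 < ρ) :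
    ∃ δ : ℝ → ℝ, Tendsto δ (𝓝[>] 0) (𝓝 y) ∧ ∀ᶠ lam in 𝓝[>] (0 : ℝ), Phi N γ ρ lam (δ lam) = 0 := by
  have hn : (2 : ℝ) ≤ N := by exact_mod_cast hN
  refine exists_tendsto_of_forall_near (p := fun lam y => Phi N γ ρ lam y = 0) ?_
  intro κ hκ
  have hend : ∀ᶠ y' in 𝓝[>] y,
      (3 * (N : ℝ) + 1) * y' ^ 2 < 2 * (N : ℝ) ^ 2 * ((N : ℝ) - 1) := by
    have hc : Continuous fun y' : ℝ => (3 * (N : ℝ) + 1) * y' ^ 2 := by fun_prop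
    exact nhdsWithin_le_nhds (hc.continuousAt.eventually_lt continuousAt_const (h.lt_endpoint hn))
  have hnear : ∀ᶠ y' in 𝓝[>] y, y' < y + κ := nhdsWithin_le_nhds (Iio_mem_nhds (by linarith))
  -- The points y₁ < y < y₂ bracket the limiting root within κ, y₂ before the endpoint and y₁ above
  -- y/2 so that it is positive. The strict signs of the limit at y₁ and y₂ persist for small lam.
  obtain ⟨y₂, ⟨hy₂, hy₂'⟩, hy₂lt⟩ := ((hend.and hnear).and self_mem_nhdsWithin).exists
  have hm : max (y / 2) (y - κ) < y := by
    rw [max_lt_iff]; constructor <;> linarith [h.pos]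
  obtain ⟨y₁, hy₁, hy₁lt⟩ := exists_between hm
  rw [max_lt_iff] at hy₁
  have hy₁pos : 0 < y₁ := by linarith [h.pos]
  have h1 := h.phiS_neg hN hy₁pos hy₁lt
  have h2 := h.phiS_pos hN hy₂lt hy₂.le
  have t1 := tendsto_phi (ρ := ρ) hN hγ hy₁pos
  have t2 := tendsto_phi (ρ := ρ) hN hγ (h.pos.trans hy₂lt)
  rw [phi0_eq hN] at t1 t2
  filter_upwards [t1.eventually_lt_const (mul_neg_of_pos_of_neg hγ h1),
    t2.eventually_const_lt (mul_pos hγ h2), self_mem_nhdsWithin] with lam hl1 hl2 hlam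
  have hcont : ContinuousOn (fun y' => Phi N γ ρ lam y') (Icc y₁ y₂) := by
    intro y' hy'
    have hpos : 0 < y' := hy₁pos.trans_le hy'.1
    have hη : 0 ≤ ρ * (√lam / √γ) := by positivity
    have hc := (continuousAt_phiS hn hη hpos).comp (f := fun y'' : ℝ => (ρ * (√lam / √γ), y''))
      (by fun_prop : ContinuousAt (fun y'' : ℝ => (ρ * (√lam / √γ), y'')) y')
    have hc' := hc.const_mul γ
    refine (hc'.congr ?_).continuousWithinAt
    filter_upwards with y''
    simp only [Function.comp, phi_eq_phiS hN hγ hlam]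
  obtain ⟨y', hy', hroot⟩ := intermediate_value_Icc (hy₁lt.trans hy₂lt).le hcont
    ⟨hl1.le, hl2.le⟩
  refine ⟨y', ?_, hroot⟩
  rw [abs_lt]
  constructor <;> linarith [hy'.1, hy'.2, hy₁.2]

end PriceImpactGame
end

noncomputable section

namespace PriceImpactGame

/-! ### The equilibrium system in scaled variables -/

/-- The ratio of the scaled coefficients `f` and `abar`. -/
def crossGain (n z h e : ℝ) : ℝ :=
  (n - 1) * ((n - 1) * z ^ 2 / (2 * z + 1 + h) + 2 * z) / (2 * z + 1 + (n - 1) * e)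

/-- The denominator of the scaled coefficient `abar`. -/
def gainDen (n z h e : ℝ) : ℝ :=
  (n ^ 2 - 1) * e + 2 * n * z + n + 1 - z * crossGain n z h e

/-- The scaled relative trading rate. -/
def rateFun (n z h : ℝ) : ℝ := (z + 1) / (n - 1) * (√(2 * profile n z h))⁻¹

/-- The tracking multiple. -/
def aimFun (n z h e : ℝ) : ℝ :=
  (n - 1) / gainDen n z h e * (2 * (n - 1) * profile n z h / (z + 1))

section System

variable {N : ℕ} {S : Coeffs} {β σ ρ q s y z h e : ℝ}

/-- This explains the normalization of the ratio: z is `bbar` in the unit √(γ/lam) y/(N-1). -/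
theorem Coeffs.SolvesSystem.bbar_eq (hN : 2 ≤ N) (hs : 0 < s)
    (hS : S.SolvesSystem N β σ (q ^ 2) ρ (s ^ 2))
    (hd : S.d = q * s * y) (ha : ((N : ℝ) - 1) * S.a = q * s * (y * (((N : ℝ) + 1) * z + 2))) :
    S.bbar = q / s * (y * z / ((N : ℝ) - 1)) ∧
      S.cbar = q / s * (y * ((N : ℝ) * z + 1) / ((N : ℝ) - 1)) := by
  have hn : (2 : ℝ) ≤ N := by exact_mod_cast hN
  have e1 := hS.eq_bbar
  have e2 := hS.eq_cbar
  set n : ℝ := (N : ℝ)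
  have h1 : n - 1 ≠ 0 := by linarith
  have h2 : n + 1 ≠ 0 := by linarith
  have ha' : S.a = q * s * (y * ((n + 1) * z + 2)) / (n - 1) := by field_simp; linarith
  have h3 : s ^ 2 - s ^ 2 * n ^ 2 = -(s ^ 2 * ((n - 1) * (n + 1))) := by ring
  have h4 : s ^ 2 + s ^ 2 * n = s ^ 2 * (n + 1) := by ring
  rw [h3] at e1
  rw [h4] at e2
  constructor
  · rw [e1, ha', hd]
    field_simp
    ring
  · rw [e2, ha', hd]
    field_simp
    ring

theorem Coeffs.SolvesSystem.rate_eq (hN : 2 ≤ N) (hs : 0 < s)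
    (hS : S.SolvesSystem N β σ (q ^ 2) ρ (s ^ 2))
    (hd : S.d = q * s * y) (ha : ((N : ℝ) - 1) * S.a = q * s * (y * (((N : ℝ) + 1) * z + 2))) :
    S.Mrate N = q / s * ((z + 1) / ((N : ℝ) - 1) * y) := by
  have hn : (2 : ℝ) ≤ N := by exact_mod_cast hN
  obtain ⟨e1, e2⟩ := hS.bbar_eq hN hs hd ha
  have h1 : (N : ℝ) - 1 ≠ 0 := by linarith
  rw [Coeffs.Mrate, e1, e2]
  field_simp
  ring

/-- The `a`-equation determines y from (z, h), so that the rate and the tracking multiple can be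
written without y. -/
theorem Coeffs.SolvesSystem.profile_eq (hN : 2 ≤ N) (hq : 0 < q) (hs : 0 < s)
    (hS : S.SolvesSystem N β σ (q ^ 2) ρ (s ^ 2))
    (hd : S.d = q * s * y) (ha : ((N : ℝ) - 1) * S.a = q * s * (y * (((N : ℝ) + 1) * z + 2)))
    (hh : ((N : ℝ) - 1) * (ρ * s) = 2 * h * y * q) :
    y ^ 2 * profile N z h = 1 / 2 := by
  have hn : (2 : ℝ) ≤ N := by exact_mod_cast hN
  obtain ⟨e1, e2⟩ := hS.bbar_eq hN hs hd ha
  have ea := hS.eq_a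
  rw [e1, hd] at ea
  unfold profile
  set n : ℝ := (N : ℝ)
  have h1 : n - 1 ≠ 0 := by linarith
  have ha' : S.a = q * s * (y * ((n + 1) * z + 2)) / (n - 1) := by field_simp; linarith
  have hρ : ρ = 2 * h * y * q / ((n - 1) * s) := by field_simp; linarith
  rw [ha', hρ] at ea
  field_simp at ea ⊢
  apply mul_left_cancel₀ (pow_ne_zero 2 hq.ne')
  linear_combination (-1 / 4) * ea

theorem Coeffs.SolvesSystem.b_eq (hN : 2 ≤ N) (hq : 0 < q) (hs : 0 < s) (hy : 0 < y)
    (hS : S.SolvesSystem N β σ (q ^ 2) ρ (s ^ 2))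
    (hd : S.d = q * s * y) (ha : ((N : ℝ) - 1) * S.a = q * s * (y * (((N : ℝ) + 1) * z + 2)))
    (hh : ((N : ℝ) - 1) * (ρ * s) = 2 * h * y * q) (hp : 2 * z + 1 + h ≠ 0) :
    S.b = q * s * (y * (z ^ 2 * ((N : ℝ) - 1) / (2 * z + 1 + h))) := by
  have hn : (2 : ℝ) ≤ N := by exact_mod_cast hN
  obtain ⟨e1, e2⟩ := hS.bbar_eq hN hs hd ha
  have eb := hS.eq_b
  rw [e1, e2, hd] at eb
  set n : ℝ := (N : ℝ)
  have h1 : n - 1 ≠ 0 := by linarith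
  have hρ : ρ = 2 * h * y * q / ((n - 1) * s) := by field_simp; linarith
  rw [hρ] at eb
  field_simp at eb ⊢
  apply mul_left_cancel₀ (mul_ne_zero hy.ne' hq.ne')
  linear_combination eb / 4

/-- The `d`-equation after `b` has been eliminated through the `b`-equation. At h = 0 the left-hand
side is minus the cubic. -/
theorem Coeffs.SolvesSystem.cubic_eq (hN : 2 ≤ N) (hq : 0 < q) (hs : 0 < s) (hy : 0 < y)
    (hS : S.SolvesSystem N β σ (q ^ 2) ρ (s ^ 2))
    (hd : S.d = q * s * y) (ha : ((N : ℝ) - 1) * S.a = q * s * (y * (((N : ℝ) + 1) * z + 2)))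
    (hh : ((N : ℝ) - 1) * (ρ * s) = 2 * h * y * q) (hp : 2 * z + 1 + h ≠ 0) :
    (2 * h + 1 - 2 * N * z ^ 2) * (2 * z + 1 + h) + ((N : ℝ) - 1) * z ^ 3 = 0 := by
  have hn : (2 : ℝ) ≤ N := by exact_mod_cast hN
  obtain ⟨e1, e2⟩ := hS.bbar_eq hN hs hd ha
  have e3 := hS.b_eq hN hq hs hy hd ha hh hp
  have ed := hS.eq_d
  rw [e1, e2, hd, e3] at ed
  set n : ℝ := (N : ℝ)
  have h1 : n - 1 ≠ 0 := by linarith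
  have ha' : S.a = q * s * (y * ((n + 1) * z + 2)) / (n - 1) := by field_simp; linarith
  have hρ : ρ = 2 * h * y * q / ((n - 1) * s) := by field_simp; linarith
  rw [ha', hρ] at ed
  field_simp at ed
  apply mul_left_cancel₀ (mul_ne_zero (pow_ne_zero 2 hy.ne') (pow_ne_zero 2 hq.ne'))
  linear_combination (-1 / 2) * ed

/-- Once `a`, `b`, `d` are known, the `e`- and `f`-equations are linear in `abar` and `f`. The
second gives `f` as `crossGain` times `abar` in scaled units (`E2`); inserting it into the first
(`E1`) leaves the factor `gainDen`. -/
theorem Coeffs.SolvesSystem.abar_eq (hN : 2 ≤ N) (hq : 0 < q) (hs : 0 < s) (hy : 0 < y)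
    (hS : S.SolvesSystem N β σ (q ^ 2) ρ (s ^ 2))
    (hd : S.d = q * s * y) (ha : ((N : ℝ) - 1) * S.a = q * s * (y * (((N : ℝ) + 1) * z + 2)))
    (hh : ((N : ℝ) - 1) * (ρ * s) = 2 * h * y * q) (hp : 2 * z + 1 + h ≠ 0)
    (he : e * y * q = (ρ + β) * s) (hp' : 2 * z + 1 + ((N : ℝ) - 1) * e ≠ 0) :
    S.abar * (y * q * s) * gainDen N z h e = N - 1 := by
  have hn : (2 : ℝ) ≤ N := by exact_mod_cast hN
  obtain ⟨e1, e2⟩ := hS.bbar_eq hN hs hd ha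
  have e3 := hS.b_eq hN hq hs hy hd ha hh hp
  have ee := hS.eq_e
  have ef := hS.eq_f
  have eab := hS.eq_abar
  unfold gainDen crossGain
  rw [e1, hd] at ee
  rw [e1, e2, hd, e3] at ef
  set n : ℝ := (N : ℝ)
  have h1 : n - 1 ≠ 0 := by linarith
  have h2 : n + 1 ≠ 0 := by linarith
  have ha' : S.a = q * s * (y * ((n + 1) * z + 2)) / (n - 1) := by field_simp; linarith
  have he' : S.e = (n + 1) * s ^ 2 * S.abar := by rw [eab]; field_simp
  have hτ : ρ + β = e * y * q / s := by field_simp; linarith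
  rw [ha', he', hτ] at ee
  rw [he', hτ] at ef
  have E1 : ((n ^ 2 - 1) * e + 2 * n * z + n + 1) * (S.abar * (y * q * s)) - z * (S.f * (y * q) / s) = n - 1 := by
    field_simp at ee ⊢
    linear_combination ee / 2
  have E2 : S.f * (y * q) / s = crossGain n z h e * (S.abar * (y * q * s)) := by
    unfold crossGain
    rw [mul_comm 2 z] at hp hp' ef ⊢
    field_simp at ef ⊢
    linear_combination (-1 / 2) * ef
  unfold crossGain at E2
  rw [E2] at E1
  linear_combination E1

end System

end PriceImpactGame
end

/-! ### Tracking multiple, explicit solution of the system, and the coefficient of the value -/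

noncomputable section

namespace PriceImpactGame

section System

variable {N : ℕ} {S : Coeffs} {β σ ρ q s y z h e : ℝ}

theorem eq_inv_sqrt_profile {n : ℝ} (hy : 0 < y) (hp : y ^ 2 * profile n z h = 1 / 2) :
    y = (√(2 * profile n z h))⁻¹ := by
  have : 2 * profile n z h = (y⁻¹) ^ 2 := by
    field_simp
    linarith
  rw [this, Real.sqrt_sq (by positivity), inv_inv]

theorem Coeffs.SolvesSystem.aim_eq (hN : 2 ≤ N) (hq : 0 < q) (hs : 0 < s) (hy : 0 < y)
    (hz : 0 < z) (hS : S.SolvesSystem N β σ (q ^ 2) ρ (s ^ 2))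
    (hd : S.d = q * s * y) (ha : ((N : ℝ) - 1) * S.a = q * s * (y * (((N : ℝ) + 1) * z + 2)))
    (hh : ((N : ℝ) - 1) * (ρ * s) = 2 * h * y * q) (hp : 2 * z + 1 + h ≠ 0)
    (he : e * y * q = (ρ + β) * s) (hp' : 2 * z + 1 + ((N : ℝ) - 1) * e ≠ 0)
    (hg : gainDen N z h e ≠ 0) :
    S.Maim N (q ^ 2) = aimFun N z h e := by
  have hn : (2 : ℝ) ≤ N := by exact_mod_cast hN
  have h1 := hS.abar_eq hN hq hs hy hd ha hh hp he hp'
  have h2 := hS.profile_eq hN hq hs hd ha hh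
  have h3 : (N : ℝ) - 1 ≠ 0 := by linarith
  have h4 : z + 1 ≠ 0 := by linarith
  have h5 : S.abar = ((N : ℝ) - 1) / (y * q * s * gainDen N z h e) := by
    field_simp
    linarith
  have h6 : profile N z h = 1 / (2 * y ^ 2) := by field_simp; linarith
  rw [Coeffs.Maim, hS.rate_eq hN hs hd ha, aimFun, h5, h6]
  field_simp

/-- The solution of the equilibrium system in terms of the scaled variables. -/
def Coeffs.ofScaled (n β σ ρ q s y z h e : ℝ) : Coeffs :=
  let abar := (n - 1) / (y * q * s * gainDen n z h e)
  let f := s / (y * q) * (crossGain n z h e * ((n - 1) / gainDen n z h e))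
  let c := 2 / (ρ + 2 * β) * (f * abar + s ^ 2 * abar ^ 2)
  { a := q * s * (y * ((n + 1) * z + 2) / (n - 1))
    b := q * s * (y * (z ^ 2 * (n - 1) / (2 * z + 1 + h)))
    c := c
    d := q * s * y
    e := (n + 1) * s ^ 2 * abar
    f := f
    g := σ ^ 2 / (2 * ρ) * c
    abar := abar
    bbar := q / s * (y * z / (n - 1))
    cbar := q / s * (y * (n * z + 1) / (n - 1)) }

/-- Only the equations for `a` and `d` impose conditions on (y, z, h): these are the profile
equation and the perturbed cubic. The other unknowns are defined by solving their equations, the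
denominators being nonzero by assumption. -/
theorem Coeffs.ofScaled_solves (hN : 2 ≤ N) (hβ : 0 < β) (hρ : 0 < ρ)
    (hq : 0 < q) (hs : 0 < s) (hy : 0 < y)
    (hpr : y ^ 2 * profile N z h = 1 / 2)
    (hc : (2 * h + 1 - 2 * N * z ^ 2) * (2 * z + 1 + h) + ((N : ℝ) - 1) * z ^ 3 = 0)
    (hh : ((N : ℝ) - 1) * (ρ * s) = 2 * h * y * q) (hp : 2 * z + 1 + h ≠ 0)
    (he : e * y * q = (ρ + β) * s) (hp' : 2 * z + 1 + ((N : ℝ) - 1) * e ≠ 0)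
    (hg : gainDen N z h e ≠ 0) :
    (Coeffs.ofScaled N β σ ρ q s y z h e).SolvesSystem N β σ (q ^ 2) ρ (s ^ 2) := by
  have hn : (2 : ℝ) ≤ N := by exact_mod_cast hN
  have h1 : (N : ℝ) - 1 ≠ 0 := by linarith
  have h2 : (N : ℝ) + 1 ≠ 0 := by linarith
  have hρ' : ρ = 2 * h * y * q / (((N : ℝ) - 1) * s) := by field_simp; linarith
  have hτ : ρ + β = e * y * q / s := by field_simp; linarith
  unfold profile at hpr
  constructor
  · simp only [Coeffs.ofScaled]
    rw [hρ']
    field_simp at hpr ⊢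
    linear_combination (-4) * q ^ 2 * hpr
  · simp only [Coeffs.ofScaled]
    rw [hρ']
    generalize hpd : 2 * z + 1 + h = p at hp ⊢
    field_simp
    rw [← hpd]
    ring
  · simp only [Coeffs.ofScaled]
    rw [hρ']
    generalize hpd : 2 * z + 1 + h = p at hp hc ⊢
    field_simp
    rw [← hpd] at hc ⊢
    linear_combination (-2) * (y ^ 2 * q ^ 2) * hc
  · simp [Coeffs.ofScaled]
  · simp only [Coeffs.ofScaled]
    have : ρ + 2 * β ≠ 0 := by positivity
    generalize gainDen (N : ℝ) z h e = G at hg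
    generalize crossGain (N : ℝ) z h e = K
    field_simp
    ring
  · simp only [Coeffs.ofScaled]
    rw [hτ]
    have hG : gainDen (N : ℝ) z h e = ((N : ℝ) ^ 2 - 1) * e + 2 * (N : ℝ) * z + (N : ℝ) + 1 - z * crossGain (N : ℝ) z h e := rfl
    generalize gainDen (N : ℝ) z h e = G at hg hG
    generalize crossGain (N : ℝ) z h e = K at hG
    field_simp
    linear_combination (-2) * hG
  · simp only [Coeffs.ofScaled]
    rw [hτ]
    have hK : crossGain (N : ℝ) z h e * (2 * z + 1 + ((N : ℝ) - 1) * e)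
        = ((N : ℝ) - 1) * (((N : ℝ) - 1) * z ^ 2 / (2 * z + 1 + h) + 2 * z) := by
      unfold crossGain
      rw [div_mul_cancel₀ _ hp']
    generalize gainDen (N : ℝ) z h e = G at hg
    generalize crossGain (N : ℝ) z h e = K at hK
    rw [mul_comm 2 z] at hp hp' hK ⊢
    field_simp at hK ⊢
    linear_combination (-2) * hK
  · simp only [Coeffs.ofScaled]
    field_simp
  · simp only [Coeffs.ofScaled]
    have h3 : s ^ 2 - s ^ 2 * (N : ℝ) ^ 2 = -(s ^ 2 * (((N : ℝ) - 1) * ((N : ℝ) + 1))) := by ring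
    rw [h3]
    field_simp
    ring
  · simp only [Coeffs.ofScaled]
    have h4 : s ^ 2 + s ^ 2 * (N : ℝ) = s ^ 2 * ((N : ℝ) + 1) := by ring
    rw [h4]
    field_simp
    ring

end System

/-! ### The value of the game -/

/-- The scaled coefficient `c` as a function of the scaled trading rate `m`, the tracking
multiple `κ` and `ε = √(lam / γ)`. -/
def valueFun (n ρ β m κ ε : ℝ) : ℝ :=
  -(n * (m * κ) ^ 2) + m * κ * (1 + 2 * n * m * (m * κ)
    - (1 / 2 + n * m ^ 2) / (m + ρ / 2 * ε) * (m * κ)) / (m + (ρ + β) * ε)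

theorem Coeffs.SolvesSystem.c_eq {N : ℕ} {S : Coeffs} {β σ ρ q s m κ : ℝ} (hN : 2 ≤ N)
    (hβ : 0 < β) (hρ : 0 < ρ) (hq : 0 < q) (hs : 0 < s) (hm : 0 < m)
    (hS : S.SolvesSystem N β σ (q ^ 2) ρ (s ^ 2))
    (hM : S.Mrate N = q / s * m) (hκ : S.Maim N (q ^ 2) = κ) :
    q ^ 2 * S.c * (ρ + 2 * β) / 2 = valueFun N ρ β m κ (s / q) := by
  have hn : (2 : ℝ) ≤ N := by exact_mod_cast hN
  have hab : S.abar = m * κ / (q * s) := by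
    rw [← hκ, Coeffs.Maim, hM]
    field_simp
  have e1 := hS.eq_a
  have e2 := hS.eq_b
  have e3 := hS.eq_d
  have e4 := hS.eq_c
  have e5 := hS.eq_e
  have e6 := hS.eq_f
  have ead : S.a + S.d = (N + 1) * s ^ 2 * S.Mrate N := by
    have h2 : (N : ℝ) + 1 ≠ 0 := by linarith
    have h1 : (N : ℝ) - 1 ≠ 0 := by linarith
    have h3 : s ^ 2 - s ^ 2 * (N : ℝ) ^ 2 = -(s ^ 2 * (((N : ℝ) - 1) * (N + 1))) := by ring
    have h4 : s ^ 2 + s ^ 2 * (N : ℝ) = s ^ 2 * (N + 1) := by ring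
    rw [Coeffs.Mrate, hS.eq_bbar, hS.eq_cbar, h3, h4]
    field_simp
    ring
  have ee : S.e = (N + 1) * s ^ 2 * S.abar := by
    have h2 : (N : ℝ) + 1 ≠ 0 := by linarith
    rw [hS.eq_abar]
    field_simp
  set n : ℝ := (N : ℝ)
  have hcb : S.cbar = S.Mrate N + (n - 1) * S.bbar := by rw [Coeffs.Mrate]; ring
  generalize S.Mrate N = M at hM ead hcb
  have hd : S.d = (n + 1) * s ^ 2 * M - S.a := by linarith
  rw [hcb, hd] at e2 e3 e6
  rw [hd] at e1 e5
  rw [ee] at e4 e5 e6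
  -- In equilibrium all positions coincide, and on the diagonal x = y the value function is -(P/2)x²
  -- + (c/2)m² + (e+f)xm + g. The combinations P and e+f satisfy closed linear equations involving
  -- only the rate M and `abar`, which avoids z altogether.
  set P := S.a + 2 * S.d - S.b with hP
  have hPM : P * (m + ρ / 2 * (s / q)) = s * q * (1 / 2 + n * m ^ 2) := by
    have : P * (M + ρ / 2) = q ^ 2 / 2 + s ^ 2 * n * M ^ 2 := by
      rw [hP, hd]
      field_simp at e1 e2 e3 ⊢
      apply mul_left_cancel₀ (pow_ne_zero 2 hs.ne')
      linear_combination (-1 / 4) * e1 + (-1 / 4) * e2 - e3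
    rw [hM] at this
    field_simp at this ⊢
    linear_combination this
  have hRM : (S.e + S.f) * (m + (ρ + β) * (s / q)) = s / q * (1 + 2 * s ^ 2 * n * M * S.abar - P * S.abar) := by
    have : (S.e + S.f) * (ρ + β + M) = 1 + 2 * s ^ 2 * n * M * S.abar - P * S.abar := by
      rw [hP, hd, ee]
      field_simp at e5 e6 ⊢
      linear_combination e5 / 2 - e6 / 2
    rw [hM] at this ⊢
    field_simp at this ⊢
    linear_combination this
  have hpos1 : 0 < m + ρ / 2 * (s / q) := by positivity
  have hpos2 : 0 < m + (ρ + β) * (s / q) := by positivity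
  have hc : q ^ 2 * S.c * (ρ + 2 * β) / 2
      = q ^ 2 * (-(s ^ 2 * n * S.abar ^ 2) + (S.e + S.f) * S.abar) := by
    rw [ee]
    field_simp at e4 ⊢
    linear_combination e4 / 4
  rw [hc, eq_div_of_mul_eq hpos2.ne' hRM, eq_div_of_mul_eq hpos1.ne' hPM, hab, hM]
  unfold valueFun
  field_simp

/-- The second-order remainder of the expansion of `valueFun` around `κ = 1`, `ε = 0`. -/
theorem valueFun_expansion {n ρ β m x ε : ℝ} (hm : m ≠ 0) (h1 : m + ρ / 2 * ε ≠ 0)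
    (h2 : m + (ρ + β) * ε ≠ 0) :
    valueFun n ρ β m (1 + x) ε - 1 / 2 + ε * ((ρ / 2 + β) * (1 + 2 * n * m ^ 2) / (2 * m))
      = ε ^ 2 * ((-((ρ + β) * (ρ / 2) * (n * m ^ 2 + 1 / 2))
          + (ρ / 2 + β) * ((ρ + β + ρ / 2) * m + (ρ + β) * (ρ / 2) * ε) * (1 + 2 * n * m ^ 2) / (2 * m))
          / ((m + ρ / 2 * ε) * (m + (ρ + β) * ε)))
        + x * ε * ((-(2 * n * m ^ 3 * (ρ / 2 + β)) + m * (ρ / 2)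
          - 2 * n * m ^ 2 * ((ρ + β) * (ρ / 2)) * ε) / ((m + ρ / 2 * ε) * (m + (ρ + β) * ε)))
        + x ^ 2 * ((-(m ^ 2 / 2) - n * m ^ 3 * ε * (ρ / 2 + β)
          - n * m ^ 2 * ((ρ + β) * (ρ / 2)) * ε ^ 2) / ((m + ρ / 2 * ε) * (m + (ρ + β) * ε))) := by
  unfold valueFun
  generalize hτ : ρ + β = τ at *
  generalize hθ : ρ / 2 = θ at *
  have hτθ : θ + β = τ - θ := by rw [← hτ, ← hθ]; ring
  rw [hτθ]
  generalize hK₁ : m + θ * ε = K₁ at *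
  generalize hK₂ : m + τ * ε = K₂ at *
  field_simp
  rw [← hK₁, ← hK₂]
  ring

end PriceImpactGame
end

noncomputable section

namespace PriceImpactGame

/-! ### Asymptotics along a branch -/

theorem gainDen_eq {n z : ℝ} (hz : 0 < z) : gainDen n z 0 0 * (2 * z + 1) ^ 2
    = (2 * n * z + n + 1) * (2 * z + 1) ^ 2
      - z * (n - 1) * ((n - 1) * z ^ 2 + 2 * z * (2 * z + 1)) := by
  have hp : 2 * z + 1 ≠ 0 := by positivity
  unfold gainDen crossGain
  simp only [add_zero, mul_zero, zero_add]
  generalize hpd : 2 * z + 1 = p at hp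
  field_simp

/-- The cubic equation in the form 2z+1 = (3n+1)z³ + 2nz² dominates the subtracted terms: (n-1)²z³ ≤
(n/3)(2z+1) and 2(n-1)z² ≤ 2z+1. -/
theorem gainDen_pos {n z : ℝ} (hn : 2 ≤ n) (hz : 0 < z) (hc : cubic n z = 0) :
    0 < gainDen n z 0 0 := by
  have h := gainDen_eq (n := n) hz
  have h1 : 0 < gainDen n z 0 0 * (2 * z + 1) ^ 2 := by
    rw [h]
    unfold cubic at hc
    have hz3 : 0 < z ^ 3 := by positivity
    have e1 : (n - 1) ^ 2 * z ^ 3 ≤ n / 3 * (2 * z + 1) := by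
      have : n / 3 * (2 * z + 1) = n / 3 * ((3 * n + 1) * z ^ 3 + 2 * n * z ^ 2) := by
        congr 1; linarith
      rw [this]
      have h2 : 0 ≤ n / 3 * (2 * n * z ^ 2) := by positivity
      have h3 : (n - 1) ^ 2 * z ^ 3 ≤ n / 3 * (3 * n + 1) * z ^ 3 :=
        mul_le_mul_of_nonneg_right (by nlinarith) hz3.le
      linarith
    have e2 : 2 * (n - 1) * z ^ 2 * (2 * z + 1) ≤ (2 * z + 1) ^ 2 := by
      have : 2 * (n - 1) * z ^ 2 ≤ 2 * z + 1 := by nlinarith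
      nlinarith
    have e3 : n / 3 * (2 * z + 1) ≤ n / 3 * (2 * z + 1) ^ 2 := by
      apply mul_le_mul_of_nonneg_left _ (by linarith)
      nlinarith
    have e4 : 0 < (2 * n * z + n * (2 / 3)) * (2 * z + 1) ^ 2 := by positivity
    linarith
  exact pos_of_mul_pos_left h1 (by positivity)

/-- After clearing denominators, the claim differs from an identity by (n-1)(3z+1) times the cubic.
Hence the limiting target is exactly the frictionless position μ/γ. -/
theorem aimFun_limit {n z : ℝ} (hn : 2 ≤ n) (hz : 0 < z) (hc : cubic n z = 0) :
    aimFun n z 0 0 = 1 := by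
  have hp : 2 * z + 1 ≠ 0 := by positivity
  have hz1 : z + 1 ≠ 0 := by positivity
  have hg := (gainDen_pos hn hz hc).ne'
  have h := gainDen_eq (n := n) hz
  have h1 : n - 1 ≠ 0 := by linarith
  unfold cubic at hc
  have key : 2 * ((n * z + 1) ^ 2 - (n - 1) * z) = (z + 1) * gainDen n z 0 0 := by
    apply mul_right_cancel₀ (pow_ne_zero 2 hp)
    rw [mul_assoc (z + 1), h]
    linear_combination (n - 1) * (3 * z + 1) * hc
  unfold aimFun profile
  field_simp
  linear_combination key

section Branch

variable {N : ℕ} {z₀ y₀ : ℝ} {δ : ℝ → ℝ}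

/-- The scaled variables `(z, h, e)` along a branch of roots. -/
def branchVar (N : ℕ) (β γ ρ : ℝ) (δ : ℝ → ℝ) (lam : ℝ) : ℝ × ℝ × ℝ :=
  (ratio N (thetaS N (ρ * (√lam / √γ)) (δ lam)) (δ lam),
    ((N : ℝ) - 1) * (ρ * (√lam / √γ)) / (2 * δ lam), (ρ + β) * (√lam / √γ) / δ lam)

theorem tendsto_thetaS {n a b : ℝ} {l : Filter ℝ} {u v : ℝ → ℝ} (hu : Tendsto u l (𝓝 a))
    (hv : Tendsto v l (𝓝 b)) : Tendsto (fun x => thetaS n (u x) (v x)) l (𝓝 (thetaS n a b)) := by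
  unfold thetaS
  exact ((((((hu.pow 2).add ((((hu.const_mul 4).mul_const _).mul hv |>.const_sub _).div_const _)).sub
    (((hv.pow 2).const_mul _).div_const _)).sqrt.sub hu).const_mul _).add
      (hv.const_mul _)).const_mul _

theorem tendsto_branchVar (hN : 2 ≤ N) (h₀ : IsLimitRoot N z₀ y₀) (β γ ρ : ℝ)
    (hδ : Tendsto δ (𝓝[>] 0) (𝓝 y₀)) :
    Tendsto (branchVar N β γ ρ δ) (𝓝[>] 0) (𝓝 (z₀, 0, 0)) := by
  have hn : (2 : ℝ) ≤ N := by exact_mod_cast hN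
  have t1 := tendsto_thetaS (n := N) (tendsto_scale γ ρ) hδ
  have t2 : Tendsto (fun lam => ratio N (thetaS N (ρ * (√lam / √γ)) (δ lam)) (δ lam)) (𝓝[>] 0)
      (𝓝 z₀) := by
    have : Tendsto (fun lam => (((N : ℝ) - 1) * (thetaS N (ρ * (√lam / √γ)) (δ lam) / δ lam) - 2)
        / ((N : ℝ) + 1)) (𝓝[>] 0) (𝓝 ((((N : ℝ) - 1) * (thetaS N 0 y₀ / y₀) - 2) / ((N : ℝ) + 1))) :=
      (((t1.div hδ h₀.pos.ne').const_mul _).sub_const _).div_const _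
    rwa [← ratio, h₀.ratio_eq hn] at this
  have t3 : Tendsto (fun lam => ((N : ℝ) - 1) * (ρ * (√lam / √γ)) / (2 * δ lam)) (𝓝[>] 0) (𝓝 0) := by
    have := ((tendsto_scale γ ρ).const_mul ((N : ℝ) - 1)).div (hδ.const_mul 2)
      (by linarith [h₀.pos])
    rwa [mul_zero, zero_div] at this
  have t4 : Tendsto (fun lam => (ρ + β) * (√lam / √γ) / δ lam) (𝓝[>] 0) (𝓝 0) := by
    have := (tendsto_scale γ (ρ + β)).div hδ h₀.pos.ne'
    rwa [zero_div] at this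
  unfold branchVar
  exact t2.prodMk_nhds (t3.prodMk_nhds t4)

theorem isBigO_scale (h₀ : IsLimitRoot N z₀ y₀) (hδ : Tendsto δ (𝓝[>] 0) (𝓝 y₀)) (c γ : ℝ) :
    (fun lam => c * (√lam / √γ) / δ lam) =O[𝓝[>] 0] (fun lam => √lam) := by
  have h1 : (fun lam => (δ lam)⁻¹) =O[𝓝[>] 0] (fun _ => (1 : ℝ)) :=
    (hδ.inv₀ h₀.pos.ne').isBigO_one ℝ
  have h2 := ((Asymptotics.isBigO_refl (fun lam => √lam) (𝓝[>] 0)).const_mul_left (c / √γ)).mul h1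
  simp only [mul_one] at h2
  refine h2.congr_left fun lam => ?_
  ring

/-- A branch is only assumed to converge; the rate comes from the equations. The last two components
are of order √lam by definition. The perturbed cubic differs from the cubic by h times a bounded
factor, and `abs_sub_le_cubic` converts this into a bound for z - z₀. -/
theorem isBigO_branchVar (hN : 2 ≤ N) (h₀ : IsLimitRoot N z₀ y₀) (β γ ρ : ℝ)
    (hδ : Tendsto δ (𝓝[>] 0) (𝓝 y₀))
    (hc : ∀ᶠ lam in 𝓝[>] (0 : ℝ),
      let v := branchVar N β γ ρ δ lam
      (2 * v.2.1 + 1 - 2 * N * v.1 ^ 2) * (2 * v.1 + 1 + v.2.1) + ((N : ℝ) - 1) * v.1 ^ 3 = 0) :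
    (fun lam => branchVar N β γ ρ δ lam - (z₀, 0, 0)) =O[𝓝[>] 0] (fun lam => √lam) := by
  have hn : (2 : ℝ) ≤ N := by exact_mod_cast hN
  have ht := tendsto_branchVar hN h₀ β γ ρ hδ
  have hz : Tendsto (fun lam => (branchVar N β γ ρ δ lam).1) (𝓝[>] 0) (𝓝 z₀) :=
    (continuous_fst.tendsto _).comp ht
  have hh : Tendsto (fun lam => (branchVar N β γ ρ δ lam).2.1) (𝓝[>] 0) (𝓝 0) :=
    ((continuous_fst.comp continuous_snd).tendsto _).comp ht
  have o2 : (fun lam => (branchVar N β γ ρ δ lam).2.1) =O[𝓝[>] 0] (fun lam => √lam) := by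
    refine (isBigO_scale h₀ hδ (((N : ℝ) - 1) * ρ / 2) γ).congr_left fun lam => ?_
    simp only [branchVar]
    ring
  have o3 : (fun lam => (branchVar N β γ ρ δ lam).2.2) =O[𝓝[>] 0] (fun lam => √lam) :=
    isBigO_scale h₀ hδ (ρ + β) γ
  have o1 : (fun lam => (branchVar N β γ ρ δ lam).1 - z₀) =O[𝓝[>] 0] (fun lam => √lam) := by
    have hb : (fun lam => 2 * (2 * (branchVar N β γ ρ δ lam).1 + 1 + (branchVar N β γ ρ δ lam).2.1)
        + 1 - 2 * N * (branchVar N β γ ρ δ lam).1 ^ 2) =O[𝓝[>] 0] (fun _ => (1 : ℝ)) :=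
      Tendsto.isBigO_one ℝ
        ((((((hz.const_mul 2).add_const 1).add hh).const_mul 2).add_const 1).sub
          ((hz.pow 2).const_mul _))
    have h1 : (fun lam => (branchVar N β γ ρ δ lam).1 - z₀) =O[𝓝[>] 0]
        (fun lam => cubic N (branchVar N β γ ρ δ lam).1) := by
      refine Asymptotics.IsBigO.of_bound z₀ ?_
      filter_upwards [hz.eventually_const_lt h₀.pos_z] with lam hpos
      exact abs_sub_le_cubic hn h₀.pos_z hpos h₀.cubic_eq
    refine h1.trans (((o2.mul hb).congr' ?_ (by simp)))
    filter_upwards [hc] with lam hl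
    simp only at hl
    unfold cubic
    linear_combination hl
  exact (o1.prod_left (o2.prod_left o3)).congr_left fun lam => by simp [Prod.ext_iff]

theorem isBigO_comp_sub {f : ℝ × ℝ × ℝ → ℝ} {v : ℝ → ℝ × ℝ × ℝ} {v₀ : ℝ × ℝ × ℝ} {l : Filter ℝ}
    {g : ℝ → ℝ} (hf : DifferentiableAt ℝ f v₀) (hv : Tendsto v l (𝓝 v₀))
    (ho : (fun x => v x - v₀) =O[l] g) : (fun x => f (v x) - f v₀) =O[l] g :=
  (hf.isBigO_sub.comp_tendsto hv).trans ho

theorem differentiableAt_rateFun {n z : ℝ} (hn : 2 ≤ n) (hz : 0 < z) :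
    DifferentiableAt ℝ (fun v : ℝ × ℝ × ℝ => rateFun n v.1 v.2.1) (z, 0, 0) := by
  have h1 := profile_zero_pos hn hz
  have hp : DifferentiableAt ℝ (fun v : ℝ × ℝ × ℝ => profile n v.1 v.2.1) (z, 0, 0) := by
    unfold profile
    fun_prop
  unfold rateFun
  refine DifferentiableAt.fun_mul (by fun_prop) ?_
  refine DifferentiableAt.fun_inv ?_ ?_
  · exact (hp.const_mul 2).sqrt (by simp only; positivity)
  · simp only
    positivity

theorem differentiableAt_div {f g : ℝ × ℝ × ℝ → ℝ} {v : ℝ × ℝ × ℝ} (hf : DifferentiableAt ℝ f v)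
    (hg : DifferentiableAt ℝ g v) (h : g v ≠ 0) : DifferentiableAt ℝ (fun v => f v / g v) v := by
  simp only [div_eq_mul_inv]
  exact hf.fun_mul (hg.fun_inv h)

theorem differentiableAt_aimFun {n z : ℝ} (hn : 2 ≤ n) (hz : 0 < z) (hc : cubic n z = 0) :
    DifferentiableAt ℝ (fun v : ℝ × ℝ × ℝ => aimFun n v.1 v.2.1 v.2.2) (z, 0, 0) := by
  have hg : DifferentiableAt ℝ (fun v : ℝ × ℝ × ℝ => gainDen n v.1 v.2.1 v.2.2) (z, 0, 0) := by
    unfold gainDen crossGain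
    refine DifferentiableAt.fun_sub (by fun_prop) (DifferentiableAt.fun_mul (by fun_prop) ?_)
    refine differentiableAt_div ?_ ?_ ?_
    · refine DifferentiableAt.fun_mul (by fun_prop) (DifferentiableAt.fun_add ?_ (by fun_prop))
      refine differentiableAt_div ?_ ?_ ?_
      · fun_prop
      · fun_prop
      · simp only [add_zero]
        positivity
    · fun_prop
    · simp only [mul_zero, add_zero]
      positivity
  have hp : DifferentiableAt ℝ (fun v : ℝ × ℝ × ℝ => profile n v.1 v.2.1) (z, 0, 0) := by
    unfold profile
    fun_prop
  unfold aimFun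
  refine DifferentiableAt.fun_mul ?_ ?_
  · exact differentiableAt_div (differentiableAt_const _) hg (gainDen_pos hn hz hc).ne'
  · refine differentiableAt_div ?_ ?_ ?_
    · fun_prop
    · fun_prop
    · simp only
      positivity

end Branch

end PriceImpactGame
end

/-! ### Existence of branches and the expansions for small transaction costs -/

noncomputable section

namespace PriceImpactGame

section Branch

variable {N : ℕ} {z₀ y₀ : ℝ} {δ : ℝ → ℝ} {S : ℝ → Coeffs} {β σ γ ρ : ℝ}

theorem theta_eq_thetaS (hN : 2 ≤ N) {lam : ℝ} (hγ : 0 < γ) (hl : 0 < lam) (y : ℝ) :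
    Theta N γ ρ lam y = √γ * √lam * thetaS N (ρ * (√lam / √γ)) y := by
  have := theta_scale (ρ := ρ) hN (Real.sqrt_pos.2 hγ) (Real.sqrt_pos.2 hl) y
  rwa [Real.sq_sqrt hγ.le, Real.sq_sqrt hl.le] at this

theorem branchVar_theta (hN : 2 ≤ N) {lam : ℝ} (hγ : 0 < γ) (hl : 0 < lam) (hy : 0 < δ lam) :
    ((N : ℝ) - 1) * Theta N γ ρ lam (δ lam)
      = √γ * √lam * (δ lam * (((N : ℝ) + 1) * (branchVar N β γ ρ δ lam).1 + 2)) := by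
  have hn : (2 : ℝ) ≤ N := by exact_mod_cast hN
  rw [theta_eq_thetaS hN hγ hl]
  have := ratio_spec (A := thetaS N (ρ * (√lam / √γ)) (δ lam)) hn hy
  simp only [branchVar]
  linear_combination (√γ * √lam) * this

theorem branchVar_h {lam : ℝ} (hγ : 0 < γ) (hy : 0 < δ lam) :
    ((N : ℝ) - 1) * (ρ * √lam) = 2 * (branchVar N β γ ρ δ lam).2.1 * δ lam * √γ := by
  have := Real.sqrt_pos.2 hγ
  simp only [branchVar]
  field_simp

theorem branchVar_e {lam : ℝ} (hγ : 0 < γ) (hy : 0 < δ lam) :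
    (branchVar N β γ ρ δ lam).2.2 * δ lam * √γ = (ρ + β) * √lam := by
  have := Real.sqrt_pos.2 hγ
  simp only [branchVar]
  field_simp

/-- Nondegeneracy of the scaled variables for small transaction costs. -/
theorem eventually_nondegenerate (hN : 2 ≤ N) (h₀ : IsLimitRoot N z₀ y₀) (β γ ρ : ℝ)
    (hδ : Tendsto δ (𝓝[>] 0) (𝓝 y₀)) :
    ∀ᶠ lam in 𝓝[>] (0 : ℝ), 0 < lam ∧ 0 < δ lam ∧ 0 < (branchVar N β γ ρ δ lam).1 ∧
      2 * (branchVar N β γ ρ δ lam).1 + 1 + (branchVar N β γ ρ δ lam).2.1 ≠ 0 ∧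
      2 * (branchVar N β γ ρ δ lam).1 + 1 + ((N : ℝ) - 1) * (branchVar N β γ ρ δ lam).2.2 ≠ 0 ∧
      gainDen N (branchVar N β γ ρ δ lam).1 (branchVar N β γ ρ δ lam).2.1
        (branchVar N β γ ρ δ lam).2.2 ≠ 0 := by
  have hn : (2 : ℝ) ≤ N := by exact_mod_cast hN
  have ht := tendsto_branchVar hN h₀ β γ ρ hδ
  have hz : Tendsto (fun lam => (branchVar N β γ ρ δ lam).1) (𝓝[>] 0) (𝓝 z₀) :=
    (continuous_fst.tendsto _).comp ht
  have hh : Tendsto (fun lam => (branchVar N β γ ρ δ lam).2.1) (𝓝[>] 0) (𝓝 0) :=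
    ((continuous_fst.comp continuous_snd).tendsto _).comp ht
  have he : Tendsto (fun lam => (branchVar N β γ ρ δ lam).2.2) (𝓝[>] 0) (𝓝 0) :=
    ((continuous_snd.comp continuous_snd).tendsto _).comp ht
  have hz0 := h₀.pos_z
  have t1 := ((hz.const_mul 2).add_const 1).add hh
  have t2 := ((hz.const_mul 2).add_const 1).add (he.const_mul ((N : ℝ) - 1))
  have hp : 2 * z₀ + 1 + 0 ≠ 0 := by positivity
  have hp' : 2 * z₀ + 1 + ((N : ℝ) - 1) * 0 ≠ 0 := by rw [mul_zero]; exact hp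
  have t3 : Tendsto (fun lam => gainDen N (branchVar N β γ ρ δ lam).1
      (branchVar N β γ ρ δ lam).2.1 (branchVar N β γ ρ δ lam).2.2) (𝓝[>] 0)
      (𝓝 (gainDen N z₀ 0 0)) := by
    unfold gainDen crossGain
    exact ((((he.const_mul _).add (hz.const_mul _)).add_const _).add_const _).sub
      (hz.mul ((((((hz.pow 2).const_mul _).div t1 hp).add (hz.const_mul 2)).const_mul _).div t2 hp'))
  filter_upwards [self_mem_nhdsWithin, hδ.eventually_const_lt h₀.pos, hz.eventually_const_lt hz0,
    t1.eventually_ne hp, t2.eventually_ne hp',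
    t3.eventually_ne (gainDen_pos hn hz0 h₀.cubic_eq).ne'] with lam h1 h2 h3 h4 h5 h6
  exact ⟨h1, h2, h3, h4, h5, h6⟩

theorem IsLimitRoot.exists_branch (hN : 2 ≤ N) (h₀ : IsLimitRoot N z₀ y₀) (hβ : 0 < β)
    (σ : ℝ) (hγ : 0 < γ) (hρ : 0 < ρ) :
    ∃ (δ : ℝ → ℝ) (S : ℝ → Coeffs), IsEquilibriumBranch N β σ γ ρ y₀ δ S := by
  have hn : (2 : ℝ) ≤ N := by exact_mod_cast hN
  obtain ⟨δ, hδ, hroot⟩ := h₀.exists_branch_root hN hγ hρ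
  refine ⟨δ, fun lam => Coeffs.ofScaled N β σ ρ (√γ) (√lam) (δ lam) (branchVar N β γ ρ δ lam).1
    (branchVar N β γ ρ δ lam).2.1 (branchVar N β γ ρ δ lam).2.2, hδ, ?_⟩
  -- In the limit the radicand is the square of a positive number, so it stays positive nearby. Only
  -- then does `thetaS` satisfy the quadratic `a`-equation.
  have hrad : ∀ᶠ lam in 𝓝[>] (0 : ℝ), 0 < (ρ * (√lam / √γ)) ^ 2
      + (8 * (N : ℝ) ^ 2 - 4 * (ρ * (√lam / √γ)) * (3 * N + 1) * δ lam) / ((N : ℝ) + 1) ^ 2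
        - 4 * (3 * (N : ℝ) + 1) * δ lam ^ 2 / (((N : ℝ) - 1) * ((N : ℝ) + 1) ^ 2) := by
    have hη := tendsto_scale γ ρ
    have ht := ((hη.pow 2).add ((((hη.const_mul 4).mul_const (3 * (N : ℝ) + 1)).mul hδ
      |>.const_sub (8 * (N : ℝ) ^ 2)).div_const (((N : ℝ) + 1) ^ 2))).sub
        (((hδ.pow 2).const_mul (4 * (3 * (N : ℝ) + 1))).div_const
          (((N : ℝ) - 1) * ((N : ℝ) + 1) ^ 2))
    refine ht.eventually_const_lt ?_
    rw [h₀.sqrt_arg_eq hn]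
    have h1 := h₀.pos
    have h2 := h₀.pos_z
    have h3 : 0 < (N : ℝ) - 1 := by linarith
    positivity
  filter_upwards [hroot, hrad, eventually_nondegenerate hN h₀ β γ ρ hδ]
    with lam hr hrad ⟨hl, hy, hz, hp, hp', hg⟩
  have hq := Real.sqrt_pos.2 hγ
  have hs := Real.sqrt_pos.2 hl
  have hA := branchVar_theta (β := β) (ρ := ρ) hN hγ hl hy
  have hh := branchVar_h (N := N) (β := β) (ρ := ρ) hγ hy
  have he := branchVar_e (N := N) (β := β) (ρ := ρ) hγ hy
  have hA' : ((N : ℝ) - 1) * thetaS N (ρ * (√lam / √γ)) (δ lam)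
      = δ lam * (((N : ℝ) + 1) * (branchVar N β γ ρ δ lam).1 + 2) := ratio_spec hn hy
  have hh' : ((N : ℝ) - 1) * (ρ * (√lam / √γ)) = 2 * (branchVar N β γ ρ δ lam).2.1 * δ lam := by
    field_simp
    linarith
  refine ⟨hr, ?_, ?_, ?_⟩
  · simp only [Coeffs.ofScaled]
    rw [Real.sqrt_mul hγ.le]
  · simp only [Coeffs.ofScaled]
    rw [theta_eq_thetaS hN hγ hl, ← hA']
    have : (N : ℝ) - 1 ≠ 0 := by linarith
    field_simp
  · have hpr := thetaS_quadratic hn hrad.le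
    rw [PriceImpactGame.profile_eq hn hh' hA'] at hpr
    rw [phi_eq_phiS hN hγ hl] at hr
    have hphi := (phiS_of_ratio hn hy hp hh' hA').2
    rw [(mul_eq_zero.1 hr).resolve_left hγ.ne', mul_zero] at hphi
    have := Coeffs.ofScaled_solves (σ := σ) hN hβ hρ hq hs hy (by linarith)
      ((mul_eq_zero.1 hphi.symm).resolve_left (by positivity)) hh hp he hp' hg
    rwa [Real.sq_sqrt hγ.le, Real.sq_sqrt hl.le] at this

/-- Along a branch the trading rate, the tracking multiple and the coefficient `c` are functions
of the scaled variables. -/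
theorem IsEquilibriumBranch.eventually_scaled (hN : 2 ≤ N) (h₀ : IsLimitRoot N z₀ y₀)
    (hβ : 0 < β) (hγ : 0 < γ) (hρ : 0 < ρ)
    (hB : IsEquilibriumBranch N β σ γ ρ y₀ δ S) :
    ∀ᶠ lam in 𝓝[>] (0 : ℝ),
      let v := branchVar N β γ ρ δ lam
      0 < lam ∧ (S lam).SolvesSystem N β σ γ ρ lam ∧
      (2 * v.2.1 + 1 - 2 * N * v.1 ^ 2) * (2 * v.1 + 1 + v.2.1) + ((N : ℝ) - 1) * v.1 ^ 3 = 0 ∧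
      0 < rateFun N v.1 v.2.1 ∧
      (S lam).Mrate N = √γ / √lam * rateFun N v.1 v.2.1 ∧
      (S lam).Maim N γ = aimFun N v.1 v.2.1 v.2.2 ∧
      γ * (S lam).c * (ρ + 2 * β) / 2
        = valueFun N ρ β (rateFun N v.1 v.2.1) (aimFun N v.1 v.2.1 v.2.2) (√lam / √γ) := by
  have hn : (2 : ℝ) ≤ N := by exact_mod_cast hN
  filter_upwards [hB.solves, eventually_nondegenerate hN h₀ β γ ρ hB.tendsto_root]
    with lam ⟨_, hd, ha, hS⟩ ⟨hl, hy, hz, hp, hp', hg⟩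
  have hq := Real.sqrt_pos.2 hγ
  have hs := Real.sqrt_pos.2 hl
  have hA := branchVar_theta (β := β) (ρ := ρ) hN hγ hl hy
  have hh := branchVar_h (N := N) (β := β) (ρ := ρ) hγ hy
  have he := branchVar_e (N := N) (β := β) (ρ := ρ) hγ hy
  rw [← ha] at hA
  rw [Real.sqrt_mul hγ.le] at hd
  have hS' : (S lam).SolvesSystem N β σ (√γ ^ 2) ρ (√lam ^ 2) := by
    rwa [Real.sq_sqrt hγ.le, Real.sq_sqrt hl.le]
  have hpr := hS'.profile_eq hN hq hs hd hA hh
  have hm : rateFun N (branchVar N β γ ρ δ lam).1 (branchVar N β γ ρ δ lam).2.1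
      = ((branchVar N β γ ρ δ lam).1 + 1) / ((N : ℝ) - 1) * δ lam := by
    rw [rateFun, ← eq_inv_sqrt_profile hy hpr]
  have hmpos : 0 < rateFun N (branchVar N β γ ρ δ lam).1 (branchVar N β γ ρ δ lam).2.1 := by
    rw [hm]
    have : 0 < (N : ℝ) - 1 := by linarith
    positivity
  have hM := hS'.rate_eq hN hs hd hA
  rw [← hm] at hM
  have hκ := hS'.aim_eq hN hq hs hy hz hd hA hh hp he hp' hg
  have hc := hS'.c_eq hN hβ hρ hq hs hmpos hM hκ
  rw [Real.sq_sqrt hγ.le] at hκ hc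
  exact ⟨hl, hS, hS'.cubic_eq hN hq hs hy hd hA hh hp, hmpos, hM, hκ, hc⟩

/-- At ε = 0 the function equals κ - κ²/2, whatever m is, and this is stationary at κ = 1.
First-order errors in κ therefore enter only squared or multiplied by ε, and errors in m only
multiplied by ε; all of these are of second order. -/
theorem isBigO_valueFun {n ρ β Δ : ℝ} {l : Filter ℝ} {m κ ε g : ℝ → ℝ} (hΔ : 0 < Δ)
    (hm : (fun x => m x - Δ) =O[l] g) (hκ : (fun x => κ x - 1) =O[l] g) (hε : ε =O[l] g)
    (hg : Tendsto g l (𝓝 0)) :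
    (fun x => valueFun n ρ β (m x) (κ x) (ε x) - 1 / 2
      + ε x * ((ρ / 2 + β) * (1 + 2 * n * Δ ^ 2) / (2 * Δ))) =O[l] fun x => g x ^ 2 := by
  have hε0 : Tendsto ε l (𝓝 0) := hε.trans_tendsto hg
  have hm0 : Tendsto m l (𝓝 Δ) := by
    have := (hm.trans_tendsto hg).add_const Δ
    simpa using this
  have tθ : Tendsto (fun x => m x + ρ / 2 * ε x) l (𝓝 (Δ + ρ / 2 * 0)) := hm0.add (hε0.const_mul _)
  have tτ : Tendsto (fun x => m x + (ρ + β) * ε x) l (𝓝 (Δ + (ρ + β) * 0)) :=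
    hm0.add (hε0.const_mul _)
  have hθ : Δ + ρ / 2 * 0 ≠ 0 := by rw [mul_zero, add_zero]; exact hΔ.ne'
  have hτ : Δ + (ρ + β) * 0 ≠ 0 := by rw [mul_zero, add_zero]; exact hΔ.ne'
  have b1 : (fun x => (-((ρ + β) * (ρ / 2) * (n * m x ^ 2 + 1 / 2))
          + (ρ / 2 + β) * ((ρ + β + ρ / 2) * m x + (ρ + β) * (ρ / 2) * ε x) * (1 + 2 * n * m x ^ 2)
            / (2 * m x))
          / ((m x + ρ / 2 * ε x) * (m x + (ρ + β) * ε x))) =O[l] (fun _ => (1 : ℝ)) := by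
    have t1 := (((hm0.pow 2).const_mul n).add_const (1 / 2)).const_mul ((ρ + β) * (ρ / 2)) |>.neg
    have t2 := (((hm0.const_mul (ρ + β + ρ / 2)).add (hε0.const_mul ((ρ + β) * (ρ / 2)))).const_mul
      (ρ / 2 + β)).mul (((hm0.pow 2).const_mul (2 * n)).const_add 1)
    exact ((t1.add (t2.div (hm0.const_mul 2) (by positivity))).div (tθ.mul tτ)
      (mul_ne_zero hθ hτ)).isBigO_one ℝ
  have b2 : (fun x => (-(2 * n * m x ^ 3 * (ρ / 2 + β)) + m x * (ρ / 2)
          - 2 * n * m x ^ 2 * ((ρ + β) * (ρ / 2)) * ε x)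
          / ((m x + ρ / 2 * ε x) * (m x + (ρ + β) * ε x))) =O[l] (fun _ => (1 : ℝ)) := by
    have t1 := ((((hm0.pow 3).const_mul (2 * n)).mul_const (ρ / 2 + β)).neg.add
      (hm0.mul_const (ρ / 2))).sub
      ((((hm0.pow 2).const_mul (2 * n)).mul_const ((ρ + β) * (ρ / 2))).mul hε0)
    exact (t1.div (tθ.mul tτ) (mul_ne_zero hθ hτ)).isBigO_one ℝ
  have b3 : (fun x => (-(m x ^ 2 / 2) - n * m x ^ 3 * ε x * (ρ / 2 + β)
          - n * m x ^ 2 * ((ρ + β) * (ρ / 2)) * ε x ^ 2)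
          / ((m x + ρ / 2 * ε x) * (m x + (ρ + β) * ε x))) =O[l] (fun _ => (1 : ℝ)) := by
    have t1 := (((hm0.pow 2).div_const 2).neg.sub
      ((((hm0.pow 3).const_mul n).mul hε0).mul_const (ρ / 2 + β))).sub
      ((((hm0.pow 2).const_mul n).mul_const ((ρ + β) * (ρ / 2))).mul (hε0.pow 2))
    exact (t1.div (tθ.mul tτ) (mul_ne_zero hθ hτ)).isBigO_one ℝ
  have b4 : (fun x => (ρ / 2 + β) * ((1 + 2 * n * Δ ^ 2) / (2 * Δ) - (1 + 2 * n * m x ^ 2) / (2 * m x)))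
      =O[l] g := by
    have b5 : (fun x => (ρ / 2 + β) * ((1 - 2 * n * Δ * m x) / (2 * Δ * m x))) =O[l]
        (fun _ => (1 : ℝ)) := by
      have t1 := (hm0.const_mul (2 * n * Δ)).const_sub 1
      exact ((t1.div (hm0.const_mul (2 * Δ)) (by positivity)).const_mul _).isBigO_one ℝ
    refine ((hm.mul b5).congr' ?_ (by simp))
    filter_upwards [hm0.eventually_ne hΔ.ne'] with x hx
    field_simp
    ring
  have h1 := ((hε.pow 2).mul b1).add (((hκ.mul hε).mul b2).congr_right fun x => by
    show g x * g x * 1 = g x ^ 2 * 1; ring)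
  have h2 := h1.add ((hκ.pow 2).mul b3)
  have h3 := h2.add ((hε.mul b4).congr_right fun x => by show g x * g x = g x ^ 2 * 1; ring)
  refine (h3.congr' ?_ (by simp))
  filter_upwards [hm0.eventually_ne hΔ.ne', tθ.eventually_ne hθ, tτ.eventually_ne hτ]
    with x hx1 hx2 hx3
  have := valueFun_expansion (n := n) (ρ := ρ) (β := β) (x := κ x - 1) hx1 hx2 hx3
  rw [add_sub_cancel] at this
  linear_combination -this

/-- The asymptotic expansions along a branch, with the value of the game at `μ = 0` given by the
coefficient `g`. -/
theorem IsEquilibriumBranch.asymptotics (hN : 2 ≤ N) (h₀ : IsLimitRoot N z₀ y₀)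
    (hβ : 0 < β) (hγ : 0 < γ) (hρ : 0 < ρ)
    (hB : IsEquilibriumBranch N β σ γ ρ y₀ δ S) :
    ∃ C lam0 : ℝ, 0 < C ∧ 0 < lam0 ∧ ∀ lam : ℝ, 0 < lam → lam < lam0 →
      (S lam).SolvesSystem N β σ γ ρ lam ∧ 0 < (S lam).Mrate N ∧ 0 < (S lam).Maim N γ ∧
      |(S lam).Mrate N - √(γ / lam) * Delta N y₀| ≤ C ∧
      |(S lam).Maim N γ - 1| ≤ C * √lam ∧
      |(S lam).g - (σ ^ 2 / (2 * ρ * γ * (2 * β + ρ))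
        - √lam * σ ^ 2 * (1 + 2 * Delta N y₀ ^ 2 * N)
          / (4 * γ ^ (3 / 2 : ℝ) * ρ * Delta N y₀))| ≤ C * lam := by
  have hn : (2 : ℝ) ≤ N := by exact_mod_cast hN
  have hq := Real.sqrt_pos.2 hγ
  have hsc := hB.eventually_scaled hN h₀ hβ hγ hρ
  have ht := tendsto_branchVar hN h₀ β γ ρ hB.tendsto_root
  have hO := isBigO_branchVar hN h₀ β γ ρ hB.tendsto_root (hsc.mono fun lam h => h.2.2.1)
  have hΔ := h₀.delta_pos hN
  have hΔ' : rateFun N z₀ 0 = Delta N y₀ := by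
    rw [h₀.delta_eq hN, rateFun, ← eq_inv_sqrt_profile h₀.pos h₀.profile_eq]
    ring
  have om := isBigO_comp_sub (differentiableAt_rateFun hn h₀.pos_z) ht hO
  have oκ := isBigO_comp_sub (differentiableAt_aimFun hn h₀.pos_z h₀.cubic_eq) ht hO
  simp only [hΔ'] at om
  simp only [aimFun_limit hn h₀.pos_z h₀.cubic_eq] at oκ
  have hs0 : Tendsto (fun lam => √lam) (𝓝[>] 0) (𝓝 0) := by
    have := Real.continuous_sqrt.tendsto 0
    rw [Real.sqrt_zero] at this
    exact this.mono_left nhdsWithin_le_nhds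
  have oε : (fun lam => √lam / √γ) =O[𝓝[>] 0] (fun lam => √lam) := by
    simp only [div_eq_inv_mul]
    exact (Asymptotics.isBigO_refl _ _).const_mul_left _
  have ov := isBigO_valueFun (n := N) (ρ := ρ) (β := β) hΔ om oκ oε hs0
  obtain ⟨C₁, hC₁, b₁⟩ := om.exists_pos
  obtain ⟨C₂, hC₂, b₂⟩ := oκ.exists_pos
  obtain ⟨C₃, hC₃, b₃⟩ := ov.exists_pos
  have hκ1 : ∀ᶠ lam in 𝓝[>] (0 : ℝ), C₂ * √lam < 1 := by
    have := hs0.const_mul C₂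
    rw [mul_zero] at this
    exact this.eventually_lt_const one_pos
  set K := σ ^ 2 / (ρ * γ * (ρ + 2 * β)) with hK
  have hKn : 0 ≤ K := by positivity
  have hev := (((hsc.and b₁.bound).and b₂.bound).and b₃.bound).and hκ1
  obtain ⟨lam0, hlam0, hsub⟩ := mem_nhdsGT_iff_exists_Ioo_subset.1 hev
  refine ⟨√γ * C₁ + C₂ + K * C₃, lam0, by positivity, hlam0, fun lam hl hlt => ?_⟩
  obtain ⟨⟨⟨⟨hsc, h1⟩, h2⟩, h3⟩, h4⟩ := hsub ⟨hl, hlt⟩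
  simp only at hsc
  obtain ⟨-, hS, -, hmpos, hM, hκ, hc⟩ := hsc
  have hs := Real.sqrt_pos.2 hl
  rw [Real.norm_eq_abs, Real.norm_eq_abs, abs_of_pos hs] at h1 h2
  rw [Real.norm_eq_abs, Real.norm_eq_abs, Real.sq_sqrt hl.le, abs_of_pos hl] at h3
  rw [← hκ] at h2
  refine ⟨hS, by rw [hM]; positivity, ?_, ?_, ?_, ?_⟩
  · have := (abs_le.1 h2).1
    linarith
  · rw [hM, Real.sqrt_div hγ.le, ← mul_sub, abs_mul, abs_of_pos (by positivity)]
    have : √γ / √lam * |rateFun N (branchVar N β γ ρ δ lam).1 (branchVar N β γ ρ δ lam).2.1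
        - Delta N y₀| ≤ √γ / √lam * (C₁ * √lam) := by gcongr
    have e : √γ / √lam * (C₁ * √lam) = √γ * C₁ := by field_simp
    rw [e] at this
    have : 0 ≤ K * C₃ := by positivity
    linarith
  · refine h2.trans ?_
    gcongr
    have : 0 ≤ K * C₃ := by positivity
    have : 0 ≤ √γ * C₁ := by positivity
    linarith
  · have hg := hS.eq_g
    have hpow : γ ^ (3 / 2 : ℝ) = γ * √γ := by
      rw [Real.sqrt_eq_rpow, ← Real.rpow_one_add' hγ.le (by norm_num)]
      norm_num
    -- The `g`-equation makes g equal to K times γc(ρ+2β)/2, so the expansion of g is K times that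
    -- of `valueFun`.
    have e : (S lam).g - (σ ^ 2 / (2 * ρ * γ * (2 * β + ρ))
        - √lam * σ ^ 2 * (1 + 2 * Delta N y₀ ^ 2 * N)
          / (4 * γ ^ (3 / 2 : ℝ) * ρ * Delta N y₀))
        = K * (γ * (S lam).c * (ρ + 2 * β) / 2 - 1 / 2
          + √lam / √γ * ((ρ / 2 + β) * (1 + 2 * N * Delta N y₀ ^ 2) / (2 * Delta N y₀))) := by
      have hg' : (S lam).g = σ ^ 2 / (2 * ρ) * (S lam).c := by linarith
      rw [hpow, hg', hK]
      have h5 : 2 * β + ρ = ρ + 2 * β := by ring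
      have h6 : ρ / 2 + β = (ρ + 2 * β) / 2 := by ring
      rw [h5, h6]
      field_simp
      ring
    rw [e, hc, abs_mul, abs_of_nonneg hKn]
    have : K * |valueFun N ρ β (rateFun N (branchVar N β γ ρ δ lam).1 (branchVar N β γ ρ δ lam).2.1)
        (aimFun N (branchVar N β γ ρ δ lam).1 (branchVar N β γ ρ δ lam).2.1
          (branchVar N β γ ρ δ lam).2.2) (√lam / √γ) - 1 / 2
          + √lam / √γ * ((ρ / 2 + β) * (1 + 2 * N * Delta N y₀ ^ 2) / (2 * Delta N y₀))|
        ≤ K * (C₃ * lam) := by gcongr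
    refine this.trans ?_
    rw [← mul_assoc]
    gcongr
    have : 0 ≤ √γ * C₁ := by positivity
    linarith

end Branch

end PriceImpactGame
end

noncomputable section

namespace PriceImpactGame

/-! ### Discounting -/

/-- The measure `e^{-ρ t} dt` on the positive half-line. -/
def discount (ρ : ℝ) : Measure ℝ :=
  (volume.restrict (Ioi 0)).withDensity fun t => ENNReal.ofReal (Real.exp (-ρ * t))

section Discount

variable {ρ : ℝ}

theorem measurable_density (ρ : ℝ) : Measurable fun t : ℝ => ENNReal.ofReal (Real.exp (-ρ * t)) := by
  fun_prop

theorem integral_discount (ρ : ℝ) (f : ℝ → ℝ) :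
    ∫ t, f t ∂discount ρ = ∫ t in Ioi (0 : ℝ), Real.exp (-ρ * t) * f t := by
  rw [discount, integral_withDensity_eq_integral_toReal_smul (measurable_density ρ) (by simp)]
  congr with t
  rw [ENNReal.toReal_ofReal (Real.exp_pos _).le, smul_eq_mul]

theorem lintegral_discount (ρ : ℝ) (f : ℝ → ℝ≥0∞) :
    ∫⁻ t, f t ∂discount ρ = ∫⁻ t in Ioi (0 : ℝ), ENNReal.ofReal (Real.exp (-ρ * t)) * f t := by
  rw [discount, lintegral_withDensity_eq_lintegral_mul_non_measurable _ (measurable_density ρ)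
    (by simp)]
  rfl

theorem integrable_discount_iff {f : ℝ → ℝ} :
    Integrable f (discount ρ) ↔ IntegrableOn (fun t => Real.exp (-ρ * t) * f t) (Ioi 0) := by
  rw [discount, integrable_withDensity_iff_integrable_smul' (measurable_density ρ) (by simp)]
  simp only [ENNReal.toReal_ofReal (Real.exp_pos _).le, smul_eq_mul]
  rfl

theorem discount_absolutelyContinuous (ρ : ℝ) : discount ρ ≪ volume.restrict (Ioi 0) :=
  withDensity_absolutelyContinuous _ _

theorem absolutelyContinuous_discount (ρ : ℝ) : volume.restrict (Ioi 0) ≪ discount ρ := by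
  refine withDensity_absolutelyContinuous' (measurable_density ρ).aemeasurable ?_
  filter_upwards with t
  simp [Real.exp_pos]

theorem ae_discount_pos (ρ : ℝ) : ∀ᵐ t ∂discount ρ, 0 < t :=
  (discount_absolutelyContinuous ρ).ae_le (ae_restrict_mem measurableSet_Ioi)

theorem discount_Ici (hρ : 0 < ρ) {s : ℝ} (hs : 0 ≤ s) :
    discount ρ (Ici s) = ENNReal.ofReal (Real.exp (-ρ * s) / ρ) := by
  rw [discount, withDensity_apply _ measurableSet_Ici, Measure.restrict_restrict measurableSet_Ici]
  have h1 : (volume.restrict (Ici s ∩ Ioi 0) : Measure ℝ) = volume.restrict (Ioi s) := by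
    apply Measure.restrict_congr_set
    have h2 : Ioi s =ᵐ[volume] Ici s := Ioi_ae_eq_Ici
    have h3 : (Ioi (0 : ℝ) : Set ℝ) =ᵐ[volume] Ici 0 := Ioi_ae_eq_Ici
    have h4 : (Ici s ∩ Ioi 0 : Set ℝ) =ᵐ[volume] (Ici s ∩ Ici 0 : Set ℝ) :=
      (ae_eq_refl _).inter h3
    refine h4.trans ?_
    rw [inter_eq_left.2 (Ici_subset_Ici.2 hs)]
    exact h2.symm
  rw [h1, ← ofReal_integral_eq_lintegral_ofReal (integrableOn_exp_mul_Ioi (by linarith) s)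
    (Eventually.of_forall fun _ => (Real.exp_pos _).le), integral_exp_mul_Ioi (by linarith)]
  congr 1
  rw [neg_div_neg_eq]

theorem discount_univ (hρ : 0 < ρ) : discount ρ univ = ENNReal.ofReal (1 / ρ) := by
  have h := discount_Ici hρ le_rfl
  rw [mul_zero, Real.exp_zero] at h
  rw [← h]
  apply measure_congr
  filter_upwards [ae_discount_pos ρ] with t ht
  exact propext ⟨fun _ => ht.le, fun _ => trivial⟩

theorem isFiniteMeasure_discount (hρ : 0 < ρ) : IsFiniteMeasure (discount ρ) :=
  ⟨by rw [discount_univ hρ]; exact ENNReal.ofReal_lt_top⟩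

instance sFinite_discount : SFinite (discount ρ) := by unfold discount; infer_instance

theorem integral_const_discount (hρ : 0 < ρ) (c : ℝ) : ρ * ∫ _, c ∂discount ρ = c := by
  rw [integral_const, measureReal_def, discount_univ hρ, ENNReal.toReal_ofReal (by positivity),
    smul_eq_mul]
  field_simp

/-- The Laplace transform of a primitive. -/
theorem laplace_primitive (hρ : 0 < ρ) {g : ℝ → ℝ} (hg : Integrable g (discount ρ)) :
    Integrable (fun t => ∫ s in (0 : ℝ)..t, g s) (discount ρ) ∧
      ρ * ∫ t, (∫ s in (0 : ℝ)..t, g s) ∂discount ρ = ∫ t, g t ∂discount ρ := by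
  have := isFiniteMeasure_discount hρ
  -- Fubini on {0 < s ≤ t}: integrating out t first leaves ∫ₛ^∞ e^{-ρt} dt = e^{-ρs}/ρ.
  set F : ℝ × ℝ → ℝ := {p : ℝ × ℝ | p.2 ≤ p.1}.indicator (fun p => (Ioi 0).indicator g p.2) with hF
  have hmeas : AEStronglyMeasurable F ((discount ρ).prod volume) := by
    refine AEStronglyMeasurable.indicator ?_ (measurableSet_le measurable_snd measurable_fst)
    refine AEStronglyMeasurable.comp_snd (f := (Ioi (0 : ℝ)).indicator g) ?_
    rw [aestronglyMeasurable_indicator_iff measurableSet_Ioi]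
    exact hg.aestronglyMeasurable.mono_ac (absolutelyContinuous_discount ρ)
  have hsec : ∀ s : ℝ, (fun t => F (t, s)) = (Ici s).indicator fun _ => (Ioi 0).indicator g s := by
    intro s
    ext t
    by_cases h1 : s ≤ t <;> simp [hF, h1]
  have hsecint : ∀ s : ℝ, ∀ c : ℝ, ∫ t, (Ici s).indicator (fun _ => (Ioi (0 : ℝ)).indicator
      (fun _ => c) s) t ∂discount ρ = (Ioi (0 : ℝ)).indicator
        (fun _ => Real.exp (-ρ * s) / ρ * c) s := by
    intro s c
    rw [integral_indicator measurableSet_Ici, setIntegral_const, measureReal_def]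
    by_cases hs : s ∈ Ioi (0 : ℝ)
    · rw [discount_Ici hρ (mem_Ioi.1 hs).le, indicator_of_mem hs, indicator_of_mem hs,
        ENNReal.toReal_ofReal (by positivity), smul_eq_mul]
    · rw [indicator_of_notMem hs, indicator_of_notMem hs, smul_zero]
  have hint : Integrable F ((discount ρ).prod volume) := by
    rw [integrable_prod_iff' hmeas]
    constructor
    · filter_upwards with s
      rw [hsec]
      exact (integrable_const _).indicator measurableSet_Ici
    · have : (fun s => ∫ t, ‖F (t, s)‖ ∂discount ρ)
          = (Ioi (0 : ℝ)).indicator fun s => ρ⁻¹ * ‖Real.exp (-ρ * s) * g s‖ := by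
        ext s
        have h1 : (fun t => ‖F (t, s)‖)
            = (Ici s).indicator fun _ => (Ioi (0 : ℝ)).indicator (fun _ => ‖g s‖) s := by
          ext t
          simp only [hF, indicator, mem_ofPred_eq, mem_Ici]
          split_ifs <;> simp
        rw [h1, hsecint]
        simp only [indicator]
        split_ifs
        · rw [norm_mul, Real.norm_of_nonneg (Real.exp_pos _).le]
          ring
        · rfl
      rw [this, integrable_indicator_iff measurableSet_Ioi]
      exact (integrable_discount_iff.1 hg).norm.const_mul _
  have hsec2 : ∀ᵐ t ∂discount ρ, ∫ s, F (t, s) = ∫ s in (0 : ℝ)..t, g s := by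
    filter_upwards [ae_discount_pos ρ] with t ht
    rw [intervalIntegral.integral_of_le ht.le, ← integral_indicator measurableSet_Ioc]
    congr with s
    simp only [hF, indicator, mem_ofPred_eq, mem_Ioc, mem_Ioi]
    by_cases h1 : 0 < s <;> by_cases h2 : s ≤ t <;> simp [h1, h2]
  refine ⟨(hint.integral_prod_left).congr hsec2, ?_⟩
  rw [← integral_congr_ae hsec2, ← integral_prod _ hint, integral_prod_symm _ hint,
    integral_discount, ← integral_const_mul]
  have : ∀ s, ∫ t, F (t, s) ∂discount ρ
      = (Ioi (0 : ℝ)).indicator (fun s => Real.exp (-ρ * s) / ρ * g s) s := by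
    intro s
    have h1 : (fun t => F (t, s))
        = (Ici s).indicator fun _ => (Ioi (0 : ℝ)).indicator (fun _ => g s) s := by
      rw [hsec]
      by_cases h1 : 0 < s <;> simp [h1]
    rw [h1, hsecint]
    simp only [indicator]
  simp only [this]
  rw [integral_const_mul, integral_indicator measurableSet_Ioi, ← integral_const_mul]
  congr with s
  field_simp

end Discount

/-! ### Primitives -/

/-- `x` is a primitive of `x'` on the half-line with initial value `x₀`. -/
def IsPrimitive (x₀ : ℝ) (x x' : ℝ → ℝ) : Prop :=
  ∀ t : ℝ, 0 ≤ t → IntervalIntegrable x' volume 0 t ∧ x t = x₀ + ∫ s in (0 : ℝ)..t, x' s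

/-- Trading rates are merely integrable along paths, so the product rule is that of absolutely
continuous functions, with derivatives almost everywhere. -/
theorem IsPrimitive.mul {x₀ y₀ : ℝ} {x x' y y' : ℝ → ℝ} (hx : IsPrimitive x₀ x x')
    (hy : IsPrimitive y₀ y y') :
    IsPrimitive (x₀ * y₀) (fun t => x t * y t) (fun t => x' t * y t + x t * y' t) := by
  intro t ht
  obtain ⟨hx1, hx2⟩ := hx t ht
  obtain ⟨hy1, hy2⟩ := hy t ht
  have ax : AbsolutelyContinuousOnInterval (fun r => x₀ + ∫ s in (0 : ℝ)..r, x' s) 0 t :=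
    (LipschitzWith.const x₀).lipschitzOnWith.absolutelyContinuousOnInterval.add
      (hx1.absolutelyContinuousOnInterval_intervalIntegral (by simp))
  have ay : AbsolutelyContinuousOnInterval (fun r => y₀ + ∫ s in (0 : ℝ)..r, y' s) 0 t :=
    (LipschitzWith.const y₀).lipschitzOnWith.absolutelyContinuousOnInterval.add
      (hy1.absolutelyContinuousOnInterval_intervalIntegral (by simp))
  have hmem : ∀ r ∈ uIcc 0 t, 0 ≤ r := fun r hr => by
    rw [uIcc_of_le ht] at hr; exact hr.1
  have ex : ∀ r ∈ uIcc 0 t, x r = x₀ + ∫ s in (0 : ℝ)..r, x' s := fun r hr => (hx r (hmem r hr)).2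
  have ey : ∀ r ∈ uIcc 0 t, y r = y₀ + ∫ s in (0 : ℝ)..r, y' s := fun r hr => (hy r (hmem r hr)).2
  have cx : ContinuousOn x (uIcc 0 t) := ax.continuousOn.congr ex
  have cy : ContinuousOn y (uIcc 0 t) := ay.continuousOn.congr ey
  refine ⟨(hx1.mul_continuousOn cy).add (hy1.continuousOn_mul cx), ?_⟩
  have key := ax.integral_deriv_mul_eq_sub ay
  simp only [intervalIntegral.integral_same, add_zero] at key
  rw [← hx2, ← hy2] at key
  rw [← sub_eq_iff_eq_add', ← key]
  apply intervalIntegral.integral_congr_ae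
  filter_upwards [hx1.ae_hasDerivAt_integral, hy1.ae_hasDerivAt_integral] with r h1 h2 hr
  have hr' : r ∈ uIcc 0 t := uIoc_subset_uIcc hr
  have d1 := ((h1 hr' 0 (by simp)).const_add x₀).deriv
  have d2 := ((h2 hr' 0 (by simp)).const_add y₀).deriv
  rw [d1, d2, ex r hr', ey r hr']

theorem isPrimitive_exp (κ : ℝ) :
    IsPrimitive 1 (fun s => Real.exp (κ * s)) (fun s => κ * Real.exp (κ * s)) := by
  intro r _
  refine ⟨(Continuous.intervalIntegrable (by fun_prop) _ _), ?_⟩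
  have := intervalIntegral.integral_eq_sub_of_hasDerivAt (a := 0) (b := r)
    (f := fun s => Real.exp (κ * s)) (f' := fun s => κ * Real.exp (κ * s)) (fun s _ => by
      have := ((hasDerivAt_id s).const_mul κ).exp
      simpa [mul_comm] using this) (Continuous.intervalIntegrable (by fun_prop) _ _)
  rw [this]
  simp

/-- Multiplication by the integrating factor e^{-κt} makes the derivative vanish. The sign of κ is
arbitrary. -/
theorem IsPrimitive.eq_zero {κ : ℝ} {x : ℝ → ℝ} (hx : IsPrimitive 0 x (fun s => κ * x s))
    {t : ℝ} (ht : 0 ≤ t) : x t = 0 := by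
  have he := isPrimitive_exp (-κ)
  have h := ((hx.mul he) t ht).2
  have h0 : ∀ s, κ * x s * Real.exp (-κ * s) + x s * (-κ * Real.exp (-κ * s)) = 0 := by
    intro s; ring
  simp only [h0, intervalIntegral.integral_zero, zero_mul, add_zero] at h
  exact (mul_eq_zero.1 h).resolve_right (Real.exp_pos _).ne'

/-- The energy estimate for a damped linear equation. -/
theorem IsPrimitive.sq_le {k : ℝ} (hk : 0 < k) {x f : ℝ → ℝ} (hf : Continuous f)
    (hx : IsPrimitive 0 x (fun s => f s - k * x s)) {t : ℝ} (ht : 0 ≤ t) :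
    x t ^ 2 ≤ ∫ s in (0 : ℝ)..t, f s ^ 2 / k := by
  obtain ⟨hi, h⟩ := (hx.mul hx) t ht
  simp only [mul_zero, zero_add] at h
  rw [sq, h]
  refine intervalIntegral.integral_mono_on ht hi (Continuous.intervalIntegrable (by fun_prop) _ _) ?_
  intro s _
  rw [le_div_iff₀ hk]
  -- This is 2kx(f - kx) ≤ f², since the difference of the two sides is (f - kx)² + (kx)².
  nlinarith [sq_nonneg (f s - k * x s), sq_nonneg (k * x s)]

end PriceImpactGame
end

noncomputable section

namespace PriceImpactGame

/-! ### Discounted pairings of processes -/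

section Pairing

variable {Ω : Type*} [mΩ : MeasurableSpace Ω] {P : Measure Ω} [IsProbabilityMeasure P]
  {𝓕 : Filtration ℝ≥0 mΩ} {ρ : ℝ}

theorem MemLp.ae_section {κ : Measure ℝ} [SFinite κ] {x : Ω × ℝ → ℝ} (hx : MemLp x 2 (P.prod κ)) :
    ∀ᵐ t ∂κ, MemLp (fun ω => x (ω, t)) 2 P := by
  filter_upwards [hx.integrable_sq.prod_left_ae, hx.aestronglyMeasurable.prodMk_right] with t h1 h2
  exact (memLp_two_iff_integrable_sq h2).2 h1

/-- On (0, t] the density e^{-ρs} is at least e^{-ρt}. Discounted square-integrability thus gives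
square-integrability on bounded time intervals. -/
theorem restrict_Ioc_le_discount (hρ : 0 < ρ) (t : ℝ) :
    volume.restrict (Ioc 0 t) ≤ ENNReal.ofReal (Real.exp (ρ * t)) • discount ρ := by
  have h1 : volume.restrict (Ioc 0 t)
      = (volume.restrict (Ioi 0)).withDensity ((Ioc 0 t).indicator 1) := by
    rw [withDensity_indicator_one measurableSet_Ioc, Measure.restrict_restrict measurableSet_Ioc,
      inter_eq_left.2 Ioc_subset_Ioi_self]
  rw [h1, discount, ← withDensity_smul _ (measurable_density ρ)]
  refine withDensity_mono (Eventually.of_forall fun s => ?_)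
  by_cases hs : s ∈ Ioc 0 t
  · rw [indicator_of_mem hs, Pi.one_apply, Pi.smul_apply, smul_eq_mul,
      ← ENNReal.ofReal_mul (Real.exp_pos _).le, ← Real.exp_add, ENNReal.one_le_ofReal,
      Real.one_le_exp_iff]
    nlinarith [hs.2]
  · rw [indicator_of_notMem hs]
    exact zero_le

omit [IsProbabilityMeasure P] in
theorem MemLp.restrict_Ioc (hρ : 0 < ρ) {x : Ω × ℝ → ℝ}
    (hx : MemLp x 2 (P.prod (discount ρ))) (t : ℝ) :
    MemLp x 2 (P.prod (volume.restrict (Ioc 0 t))) := by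
  have := isFiniteMeasure_discount hρ
  refine hx.of_measure_le_smul (c := ENNReal.ofReal (Real.exp (ρ * t))) ENNReal.ofReal_ne_top ?_
  rw [← Measure.prod_smul_right]
  exact Measure.prod_mono le_rfl (restrict_Ioc_le_discount hρ t)

/-- Integration by parts for the discounted pairing of two absolutely continuous processes. -/
theorem pairing_primitive (hρ : 0 < ρ) {x x' y y' : Ω × ℝ → ℝ} {x₀ y₀ : ℝ}
    (hx : MemLp x 2 (P.prod (discount ρ))) (hx' : MemLp x' 2 (P.prod (discount ρ)))
    (hy : MemLp y 2 (P.prod (discount ρ))) (hy' : MemLp y' 2 (P.prod (discount ρ)))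
    (px : ∀ᵐ ω ∂P, IsPrimitive x₀ (fun t => x (ω, t)) (fun t => x' (ω, t)))
    (py : ∀ᵐ ω ∂P, IsPrimitive y₀ (fun t => y (ω, t)) (fun t => y' (ω, t))) :
    ρ * ∫ p, x p * y p ∂P.prod (discount ρ)
      = x₀ * y₀ + ((∫ p, x' p * y p ∂P.prod (discount ρ))
        + ∫ p, x p * y' p ∂P.prod (discount ρ)) := by
  have := isFiniteMeasure_discount hρ
  have i1 : Integrable (fun p => x' p * y p) (P.prod (discount ρ)) := hx'.integrable_mul hy
  have i2 : Integrable (fun p => x p * y' p) (P.prod (discount ρ)) := hx.integrable_mul hy'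
  have i3 : Integrable (fun p => x p * y p) (P.prod (discount ρ)) := hx.integrable_mul hy
  have i12 : Integrable (fun p => x' p * y p + x p * y' p) (P.prod (discount ρ)) := i1.add i2
  rw [← integral_add i1 i2, integral_prod _ i3, ← integral_const_mul]
  rw [integral_prod _ i12]
  have key : ∀ᵐ ω ∂P, ρ * ∫ t, x (ω, t) * y (ω, t) ∂discount ρ
      = x₀ * y₀ + ∫ t, (x' (ω, t) * y (ω, t) + x (ω, t) * y' (ω, t)) ∂discount ρ := by
    filter_upwards [px, py, i12.prod_right_ae] with ω h1 h2 h3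
    have h4 := laplace_primitive hρ h3
    have h5 : ∀ᵐ t ∂discount ρ, x (ω, t) * y (ω, t)
        = x₀ * y₀ + ∫ s in (0 : ℝ)..t, (x' (ω, s) * y (ω, s) + x (ω, s) * y' (ω, s)) := by
      filter_upwards [ae_discount_pos ρ] with t ht
      exact ((h1.mul h2) t ht.le).2
    rw [integral_congr_ae h5, integral_add (integrable_const _) h4.1, mul_add,
      integral_const_discount hρ]
    congr 1
    exact h4.2
  rw [integral_congr_ae key, integral_add (integrable_const _) i12.integral_prod_left]
  simp

/-- A process with the covariance properties of a Brownian motion. -/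
structure IsNoise (P : Measure Ω) (𝓕 : Filtration ℝ≥0 mΩ) (ρ : ℝ) (w : Ω × ℝ → ℝ) : Prop where
  memLp : MemLp w 2 (P.prod (discount ρ))
  memLp_section : ∀ t, 0 ≤ t → MemLp (fun ω => w (ω, t)) 2 P
  mean : ∀ t, 0 ≤ t → ∫ ω, w (ω, t) ∂P = 0
  orthogonal : ∀ s t, 0 ≤ s → s ≤ t → ∀ ξ : Ω → ℝ, StronglyMeasurable[𝓕 s.toNNReal] ξ →
    MemLp ξ 2 P → ∫ ω, ξ ω * w (ω, t) ∂P = ∫ ω, ξ ω * w (ω, s) ∂P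
  sq : ρ * ∫ p, w p * w p ∂P.prod (discount ρ) = 1 / ρ

/-- The discounted pairing of an absolutely continuous adapted process with the noise. -/
theorem IsNoise.pairing (hρ : 0 < ρ) {w x x' : Ω × ℝ → ℝ} (hw : IsNoise P 𝓕 ρ w) {x₀ : ℝ}
    (hx : MemLp x 2 (P.prod (discount ρ))) (hx' : MemLp x' 2 (P.prod (discount ρ)))
    (hadapt : ∀ s, 0 ≤ s → StronglyMeasurable[𝓕 s.toNNReal] fun ω => x' (ω, s))
    (px : ∀ᵐ ω ∂P, IsPrimitive x₀ (fun t => x (ω, t)) (fun t => x' (ω, t))) :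
    ρ * ∫ p, x p * w p ∂P.prod (discount ρ) = ∫ p, x' p * w p ∂P.prod (discount ρ) := by
  have := isFiniteMeasure_discount hρ
  have i1 : Integrable (fun p => x' p * w p) (P.prod (discount ρ)) := hx'.integrable_mul hw.memLp
  have i2 : Integrable (fun p => x p * w p) (P.prod (discount ρ)) := hx.integrable_mul hw.memLp
  rw [integral_prod_symm _ i2, integral_prod_symm _ i1]
  have i3 : Integrable (fun s => ∫ ω, x' (ω, s) * w (ω, s) ∂P) (discount ρ) := i1.integral_prod_right
  rw [← (laplace_primitive hρ i3).2]
  congr 1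
  apply integral_congr_ae
  filter_upwards [ae_discount_pos ρ] with t ht
  have m1 := MemLp.restrict_Ioc hρ hx' t
  have i4 : Integrable (fun p : Ω × ℝ => x' p * w (p.1, t)) (P.prod (volume.restrict (Ioc 0 t))) :=
    m1.integrable_mul ((hw.memLp_section t ht.le).comp_fst _)
  -- Here x_t w_t = x₀ w_t + ∫₀ᵗ x'_s w_t ds; the first term has mean zero, and E[x'_s w_t] = E[x'_s
  -- w_s] since x'_s is known at time s. So E[x_t w_t] is the primitive of E[x'_s w_s], with no term
  -- from the noise's own increments.
  have h1 : ∫ ω, x (ω, t) * w (ω, t) ∂P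
      = ∫ ω, (x₀ * w (ω, t) + ∫ s in Ioc 0 t, x' (ω, s) * w (ω, t)) ∂P := by
    apply integral_congr_ae
    filter_upwards [px] with ω hω
    have h2 := (hω t ht.le).2
    simp only at h2
    rw [h2, add_mul, intervalIntegral.integral_of_le ht.le, integral_mul_const]
  rw [h1, integral_add (((hw.memLp_section t ht.le).integrable (by norm_num)).const_mul _)
    i4.integral_prod_left, integral_const_mul, hw.mean t ht.le, mul_zero, zero_add,
    integral_integral_swap i4, intervalIntegral.integral_of_le ht.le]
  apply integral_congr_ae
  filter_upwards [MemLp.ae_section m1, ae_restrict_mem measurableSet_Ioc] with s hs hst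
  exact hw.orthogonal s t hst.1.le hst.2 _ (hadapt s hst.1.le) hs

/-- The discounted moments of the signal. -/
theorem IsNoise.signal_moments (hρ : 0 < ρ) {w m : Ω × ℝ → ℝ} {m₀ β σ : ℝ}
    (hw : IsNoise P 𝓕 ρ w)
    (hm : MemLp m 2 (P.prod (discount ρ)))
    (hadapt : ∀ s, 0 ≤ s → StronglyMeasurable[𝓕 s.toNNReal] fun ω => m (ω, s))
    (hp : ∀ᵐ ω ∂P, IsPrimitive m₀ (fun t => m (ω, t) - σ * w (ω, t)) (fun t => -β * m (ω, t))) :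
    (ρ + 2 * β) * ∫ p, m p * m p ∂P.prod (discount ρ) = m₀ ^ 2 + σ ^ 2 / ρ ∧
    ∀ x x' : Ω × ℝ → ℝ, MemLp x 2 (P.prod (discount ρ)) → MemLp x' 2 (P.prod (discount ρ)) →
      (∀ s, 0 ≤ s → StronglyMeasurable[𝓕 s.toNNReal] fun ω => x' (ω, s)) →
      (∀ᵐ ω ∂P, IsPrimitive 0 (fun t => x (ω, t)) (fun t => x' (ω, t))) →
      (ρ + β) * ∫ p, x p * m p ∂P.prod (discount ρ) = ∫ p, x' p * m p ∂P.prod (discount ρ) := by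
  -- The signal minus its noise is absolutely continuous, so the ordinary product rule applies to
  -- it. The quadratic variation enters only through the second moment of the noise and becomes
  -- σ²/ρ.
  have hz : MemLp (fun p => m p - σ * w p) 2 (P.prod (discount ρ)) := hm.sub (hw.memLp.const_mul σ)
  have hz' : MemLp (fun p => -β * m p) 2 (P.prod (discount ρ)) := hm.const_mul _
  have hadapt' : ∀ s, 0 ≤ s → StronglyMeasurable[𝓕 s.toNNReal] fun ω => -β * m (ω, s) :=
    fun s hs => (hadapt s hs).const_mul _
  have split : ∀ y : Ω × ℝ → ℝ, MemLp y 2 (P.prod (discount ρ)) →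
      ∫ p, y p * m p ∂P.prod (discount ρ)
        = (∫ p, y p * (m p - σ * w p) ∂P.prod (discount ρ))
          + σ * ∫ p, y p * w p ∂P.prod (discount ρ) := by
    intro y hy
    have i1 : Integrable (fun p => y p * (m p - σ * w p)) (P.prod (discount ρ)) :=
      hy.integrable_mul hz
    have i2 : Integrable (fun p => σ * (y p * w p)) (P.prod (discount ρ)) :=
      (hy.integrable_mul hw.memLp).const_mul σ
    rw [← integral_const_mul, ← integral_add i1 i2]
    congr with p
    ring
  constructor
  · have e1 := pairing_primitive hρ hz hz' hz hz' hp hp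
    have e2 := hw.pairing hρ hz hz' hadapt' hp
    have s1 := split m hm
    have s2 := split (fun p => m p - σ * w p) hz
    have s3 := split w hw.memLp
    have e3 := hw.sq
    have c1 : ∫ p, -β * m p * (m p - σ * w p) ∂P.prod (discount ρ)
        = -β * ∫ p, m p * (m p - σ * w p) ∂P.prod (discount ρ) := by
      rw [← integral_const_mul]; congr with p; ring
    have c2 : ∫ p, (m p - σ * w p) * (-β * m p) ∂P.prod (discount ρ)
        = -β * ∫ p, m p * (m p - σ * w p) ∂P.prod (discount ρ) := by
      rw [← integral_const_mul]; congr with p; ring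
    have c3 : ∫ p, -β * m p * w p ∂P.prod (discount ρ)
        = -β * ∫ p, m p * w p ∂P.prod (discount ρ) := by
      rw [← integral_const_mul]; congr with p; ring
    have c4 : ∫ p, (m p - σ * w p) * m p ∂P.prod (discount ρ)
        = ∫ p, m p * (m p - σ * w p) ∂P.prod (discount ρ) := by
      congr with p; ring
    have c5 : ∫ p, w p * m p ∂P.prod (discount ρ) = ∫ p, m p * w p ∂P.prod (discount ρ) := by
      congr with p; ring
    have c6 : ∫ p, w p * (m p - σ * w p) ∂P.prod (discount ρ)
        = ∫ p, (m p - σ * w p) * w p ∂P.prod (discount ρ) := by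
      congr with p; ring
    rw [c1, c2] at e1
    rw [c3] at e2
    rw [c4] at s2
    rw [c5, c6] at s3
    generalize (∫ p, m p * m p ∂P.prod (discount ρ)) = mm at *
    generalize (∫ p, m p * (m p - σ * w p) ∂P.prod (discount ρ)) = mz at *
    generalize (∫ p, m p * w p ∂P.prod (discount ρ)) = mw at *
    generalize (∫ p, (m p - σ * w p) * w p ∂P.prod (discount ρ)) = zw at *
    generalize (∫ p, (m p - σ * w p) * (m p - σ * w p) ∂P.prod (discount ρ)) = zz at *
    generalize (∫ p, w p * w p ∂P.prod (discount ρ)) = ww at *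
    linear_combination e1 + 2 * σ * e2 + (ρ + 2 * β) * s1 + ρ * s2 + σ * ρ * s3 + σ ^ 2 * e3
  · intro x x' hx hx' hxa px
    have e1 := pairing_primitive hρ hx hx' hz hz' px hp
    have e2 := hw.pairing hρ hx hx' hxa px
    have s1 := split x hx
    have s2 := split x' hx'
    have c1 : ∫ p, x p * (-β * m p) ∂P.prod (discount ρ)
        = -β * ∫ p, x p * m p ∂P.prod (discount ρ) := by
      rw [← integral_const_mul]; congr with p; ring
    rw [c1, zero_mul, zero_add] at e1
    linear_combination e1 + σ * e2 + ρ * s1 - s2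

end Pairing

end PriceImpactGame
end

noncomputable section

namespace PriceImpactGame

/-! ### Paths of progressive processes -/

section Path

variable {Ω : Type*} [mΩ : MeasurableSpace Ω] {P : Measure Ω} {𝓕 : Filtration ℝ≥0 mΩ} {ρ : ℝ}

/-- A process as a function on the product of the sample space and the real line. -/
def path (X : ℝ≥0 → Ω → ℝ) : Ω × ℝ → ℝ := fun p => X p.2.toNNReal p.1

/-- Progressive measurability gives joint measurability up to each fixed time n. Time is frozen at
n, and n tends to infinity. -/
theorem stronglyMeasurable_path {X : ℝ≥0 → Ω → ℝ} (hX : IsStronglyProgressive 𝓕 X) :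
    StronglyMeasurable (path X) := by
  have h1 : ∀ n : ℕ, StronglyMeasurable fun p : Ω × ℝ => X (min p.2.toNNReal n) p.1 := by
    intro n
    have hm : Measurable[_, Subtype.instMeasurableSpace.prod (𝓕 (n : ℝ≥0))] fun p : Ω × ℝ =>
        ((⟨min p.2.toNNReal n, mem_Iic.2 (min_le_right _ _)⟩, p.1) : Iic (n : ℝ≥0) × Ω) := by
      have h1 : Measurable fun p : Ω × ℝ =>
          (⟨min p.2.toNNReal n, mem_Iic.2 (min_le_right _ _)⟩ : Iic (n : ℝ≥0)) :=
        Measurable.subtype_mk (by fun_prop)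
      have h2 : Measurable[_, 𝓕 (n : ℝ≥0)] fun p : Ω × ℝ => p.1 :=
        measurable_fst.mono le_rfl (𝓕.le _)
      exact @Measurable.prodMk (Ω × ℝ) _ (Iic (n : ℝ≥0)) Ω _ (𝓕 (n : ℝ≥0)) _ _ h1 h2
    exact (hX n).comp_measurable hm
  refine stronglyMeasurable_of_tendsto atTop h1 ?_
  rw [tendsto_pi_nhds]
  intro p
  obtain ⟨n, hn⟩ := exists_nat_ge p.2.toNNReal
  refine tendsto_const_nhds.congr' ?_
  filter_upwards [eventually_ge_atTop n] with k hk
  rw [path, min_eq_left (hn.trans (by exact_mod_cast hk))]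

theorem isAdmissibleProcess_iff [SFinite P] {X : ℝ≥0 → Ω → ℝ} :
    IsAdmissibleProcess P 𝓕 ρ X ↔
      IsStronglyProgressive 𝓕 X ∧ MemLp (path X) 2 (P.prod (discount ρ)) := by
  refine and_congr_right fun hX => ?_
  have hm := stronglyMeasurable_path hX
  have hm2 : StronglyMeasurable fun p => path X p ^ 2 := hm.pow 2
  rw [memLp_two_iff_integrable_sq hm.aestronglyMeasurable, Integrable,
    and_iff_right hm2.aestronglyMeasurable,
    hasFiniteIntegral_iff_ofReal (Eventually.of_forall fun p => sq_nonneg _),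
    lintegral_prod _ hm2.measurable.ennreal_ofReal.aemeasurable]
  simp only [lintegral_discount, path, ENNReal.ofReal_mul (Real.exp_pos _).le]

theorem stronglyMeasurable_intervalIntegral {Ω : Type*} [MeasurableSpace Ω] {u : ℝ → Ω → ℝ}
    (hc : ∀ ω, Continuous fun s => u s ω) (hm : ∀ s, StronglyMeasurable (u s)) (t : ℝ) :
    StronglyMeasurable fun ω => ∫ s in (0 : ℝ)..t, u s ω := by
  have h := stronglyMeasurable_uncurry_of_continuous_of_stronglyMeasurable hc hm
  have h' : StronglyMeasurable fun p : Ω × ℝ => u p.2 p.1 := h.comp_measurable measurable_swap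
  exact (h'.integral_prod_right' (ν := volume.restrict (Ioc 0 t))).sub
    (h'.integral_prod_right' (ν := volume.restrict (Ioc t 0)))

theorem stronglyAdapted_integral {X : ℝ≥0 → Ω → ℝ} (hX : StronglyAdapted 𝓕 X)
    (hc : ∀ ω, Continuous fun t => X t ω) {c : ℝ → ℝ} (hcc : Continuous c) :
    StronglyAdapted 𝓕 fun t ω => ∫ s in (0 : ℝ)..t, c s * X s.toNNReal ω := by
  intro t
  -- Freezing the time argument at t makes every section of the integrand measurable with respect to
  -- `𝓕 t` without changing the integral over [0, t].
  have h := @stronglyMeasurable_intervalIntegral Ω (𝓕 t)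
    (fun s ω => c s * X (min s.toNNReal t) ω)
    (fun ω => hcc.mul ((hc ω).comp (by fun_prop)))
    (fun s => ((hX (min s.toNNReal t)).mono (𝓕.mono (min_le_right _ _))).const_mul _) t
  convert h using 1
  ext ω
  refine intervalIntegral.integral_congr fun s hs => ?_
  rw [uIcc_of_le t.coe_nonneg] at hs
  rw [min_eq_left (Real.toNNReal_le_iff_le_coe.2 hs.2)]

omit mΩ in
theorem continuous_integral {X : ℝ≥0 → Ω → ℝ}
    (hc : ∀ ω, Continuous fun t => X t ω) {c : ℝ → ℝ} (hcc : Continuous c) (ω : Ω) :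
    Continuous fun t : ℝ≥0 => ∫ s in (0 : ℝ)..t, c s * X s.toNNReal ω := by
  have h1 : Continuous fun s => c s * X s.toNNReal ω := hcc.mul ((hc ω).comp (by fun_prop))
  exact (intervalIntegral.continuous_primitive (fun a b => h1.intervalIntegrable a b) 0).comp
    NNReal.continuous_coe

/-- The noise recovered from the signal. -/
def signalNoise (β σ m0 : ℝ) (μ : ℝ≥0 → Ω → ℝ) : ℝ≥0 → Ω → ℝ :=
  fun t ω => (μ t ω - m0 + β * ∫ s in (0 : ℝ)..t, μ s.toNNReal ω) / σ

variable {β σ m0 : ℝ} {W μ : ℝ≥0 → Ω → ℝ}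

theorem IsSignal.isStronglyProgressive_noise (h : IsSignal P 𝓕 β σ m0 W μ) :
    IsStronglyProgressive 𝓕 (signalNoise β σ m0 μ) := by
  have h1 := stronglyAdapted_integral h.adapted h.continuous_path (continuous_const (y := (1 : ℝ)))
  have h2 := continuous_integral h.continuous_path (continuous_const (y := (1 : ℝ)))
  simp only [one_mul] at h1 h2
  refine StronglyAdapted.isStronglyProgressive_of_continuous (fun t => ?_) fun ω => ?_
  · exact StronglyMeasurable.mul_const (f := fun ω => μ t ω - m0 + β * ∫ s in (0 : ℝ)..t, μ s.toNNReal ω)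
      (((h.adapted t).sub stronglyMeasurable_const).add ((h1 t).const_mul β)) σ⁻¹
  · exact (((h.continuous_path ω).sub continuous_const).add ((h2 ω).const_mul β)).div_const σ

/-- The signal equation holds only almost surely for W, but by definition for every ω when W is
replaced by `signalNoise`, which is continuous as well. -/
theorem IsSignal.noise_eq (hσ : 0 < σ) (h : IsSignal P 𝓕 β σ m0 W μ) :
    ∀ᵐ ω ∂P, ∀ t, signalNoise β σ m0 μ t ω = W t ω := by
  filter_upwards [h.dynamics] with ω hω t
  rw [signalNoise, hω t]
  field_simp
  ring

theorem IsSignal.isNoise [IsProbabilityMeasure P] (hρ : 0 < ρ) (hσ : 0 < σ)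
    (h : IsSignal P 𝓕 β σ m0 W μ) : IsNoise P 𝓕 ρ (path (signalNoise β σ m0 μ)) := by
  have := isFiniteMeasure_discount hρ
  set w := path (signalNoise β σ m0 μ) with hw
  have hp := h.isStronglyProgressive_noise
  have hm := stronglyMeasurable_path hp
  have hB : IsPreBrownianReal W P := h.brownian.toIsPreBrownianReal
  have hae : ∀ t : ℝ, (fun ω => w (ω, t)) =ᵐ[P] W t.toNNReal := by
    intro t
    filter_upwards [h.noise_eq hσ] with ω hω
    exact hω t.toNNReal
  have hsec : ∀ t : ℝ, MemLp (fun ω => w (ω, t)) 2 P := fun t =>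
    (memLp_congr_ae (hae t)).2 (hB.isGaussianProcess.hasGaussianLaw_eval t.toNNReal).memLp_two
  have hmean : ∀ t : ℝ, ∫ ω, w (ω, t) ∂P = 0 := fun t => by
    rw [integral_congr_ae (hae t), hB.integral_eval]
  have hsq : ∀ t : ℝ, 0 ≤ t → ∫ ω, w (ω, t) ^ 2 ∂P = t := by
    intro t ht
    have h1 := hB.covariance_eval t.toNNReal t.toNNReal
    rw [covariance_eq_sub
      (hB.isGaussianProcess.hasGaussianLaw_eval t.toNNReal).memLp_two
      (hB.isGaussianProcess.hasGaussianLaw_eval t.toNNReal).memLp_two, hB.integral_eval,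
      min_self, Real.coe_toNNReal t ht, mul_zero, sub_zero] at h1
    refine Eq.trans (integral_congr_ae ?_) h1
    filter_upwards [hae t] with ω hω
    rw [hω, Pi.mul_apply, sq]
  have hlap := laplace_primitive hρ (g := fun _ => 1) (integrable_const 1)
  simp only [intervalIntegral.integral_const, sub_zero, smul_eq_mul, mul_one] at hlap
  have hint : Integrable (fun p => w p ^ 2) (P.prod (discount ρ)) := by
    have hm2 : StronglyMeasurable fun p => w p ^ 2 := hm.pow 2
    rw [integrable_prod_iff' hm2.aestronglyMeasurable]
    refine ⟨Eventually.of_forall fun t => (hsec t).integrable_sq, ?_⟩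
    refine hlap.1.congr ?_
    filter_upwards [ae_discount_pos ρ] with t ht
    simp only [norm_pow, Real.norm_eq_abs, sq_abs]
    exact (hsq t ht.le).symm
  refine ⟨(memLp_two_iff_integrable_sq hm.aestronglyMeasurable).2 hint, fun t _ => hsec t,
    fun t _ => hmean t, ?_, ?_⟩
  · intro s t hs hst ξ hξ hξ2
    have hind : IndepFun ξ (fun ω => W t.toNNReal ω - W s.toNNReal ω) P := by
      rw [IndepFun_iff_Indep]
      exact indep_of_indep_of_le_left
        (h.indep_increments s.toNNReal t.toNNReal (Real.toNNReal_le_toNNReal hst)).symm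
        hξ.measurable.comap_le
    have hind' : IndepFun ξ (fun ω => w (ω, t) - w (ω, s)) P := by
      refine hind.congr (ae_eq_refl _) ?_
      filter_upwards [hae s, hae t] with ω h1 h2
      rw [h1, h2]
    have h3 := hind'.integral_fun_mul_eq_mul_integral hξ2.aestronglyMeasurable
      ((hsec t).sub (hsec s)).aestronglyMeasurable
    rw [integral_sub ((hsec t).integrable (by norm_num)) ((hsec s).integrable (by norm_num)),
      hmean, hmean, sub_zero, mul_zero] at h3
    have i1 : Integrable (fun ω => ξ ω * w (ω, t)) P := hξ2.integrable_mul (hsec t)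
    have i2 : Integrable (fun ω => ξ ω * w (ω, s)) P := hξ2.integrable_mul (hsec s)
    rw [← sub_eq_zero, ← integral_sub i1 i2, ← h3]
    congr with ω
    ring
  · have h1 : ∫ p, w p * w p ∂P.prod (discount ρ) = ∫ t, t ∂discount ρ := by
      simp only [← sq]
      rw [integral_prod_symm _ hint]
      apply integral_congr_ae
      filter_upwards [ae_discount_pos ρ] with t ht
      exact hsq t ht.le
    rw [h1, hlap.2, eq_div_iff hρ.ne', mul_comm, integral_const_discount hρ]

end Path

end PriceImpactGame
end

/-! ### Square-integrability of the signal and of the tracking position, and linear feedback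
dynamics -/

noncomputable section

namespace PriceImpactGame

theorem IsPrimitive.congr {x₀ y₀ : ℝ} {x x' y y' : ℝ → ℝ} (hx : IsPrimitive x₀ x x')
    (h₀ : x₀ = y₀) (h : ∀ t, 0 ≤ t → x t = y t) (h' : ∀ t, 0 ≤ t → x' t = y' t) :
    IsPrimitive y₀ y y' := by
  intro t ht
  obtain ⟨h1, h2⟩ := hx t ht
  have hmem : ∀ r ∈ uIcc 0 t, 0 ≤ r := fun r hr => by
    rw [uIcc_of_le ht] at hr; exact hr.1
  refine ⟨h1.congr fun r hr => h' r (hmem r (uIoc_subset_uIcc hr)), ?_⟩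
  rw [← h t ht, h2, h₀, intervalIntegral.integral_congr fun r hr => h' r (hmem r hr)]

theorem IsPrimitive.sub {x₀ y₀ : ℝ} {x x' y y' : ℝ → ℝ} (hx : IsPrimitive x₀ x x')
    (hy : IsPrimitive y₀ y y') :
    IsPrimitive (x₀ - y₀) (fun t => x t - y t) (fun t => x' t - y' t) := by
  intro t ht
  obtain ⟨hx1, hx2⟩ := hx t ht
  obtain ⟨hy1, hy2⟩ := hy t ht
  refine ⟨hx1.sub hy1, ?_⟩
  rw [intervalIntegral.integral_sub hx1 hy1]
  linear_combination hx2 - hy2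

theorem isPrimitive_integral {f : ℝ → ℝ} (hf : Continuous f) :
    IsPrimitive 0 (fun t => ∫ s in (0 : ℝ)..t, f s) f :=
  fun _ _ => ⟨hf.intervalIntegrable _ _, (zero_add _).symm⟩

section Positions

variable {Ω : Type*} [mΩ : MeasurableSpace Ω] {P : Measure Ω} {𝓕 : Filtration ℝ≥0 mΩ}
  {ρ β σ m0 : ℝ} {W μ : ℝ≥0 → Ω → ℝ}

/-- A damped linear response to a square-integrable input is square-integrable. -/
theorem memLp_of_damped [IsProbabilityMeasure P] (hρ : 0 < ρ) {k : ℝ} (hk : 0 < k)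
    {F x : Ω × ℝ → ℝ} (hF : MemLp F 2 (P.prod (discount ρ)))
    (hFc : ∀ ω, Continuous fun t => F (ω, t)) (hxm : StronglyMeasurable x)
    (hx : ∀ ω, IsPrimitive 0 (fun t => x (ω, t)) (fun t => F (ω, t) - k * x (ω, t))) :
    MemLp x 2 (P.prod (discount ρ)) := by
  have := isFiniteMeasure_discount hρ
  rw [memLp_two_iff_integrable_sq hxm.aestronglyMeasurable]
  have hm2 : StronglyMeasurable fun p => x p ^ 2 := hxm.pow 2
  have hF2 : Integrable (fun p => F p ^ 2 / k) (P.prod (discount ρ)) := hF.integrable_sq.div_const k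
  rw [integrable_prod_iff hm2.aestronglyMeasurable]
  have key : ∀ᵐ ω ∂P, Integrable (fun t => x (ω, t) ^ 2) (discount ρ) ∧
      ∫ t, ‖x (ω, t) ^ 2‖ ∂discount ρ ≤ ρ⁻¹ * ∫ t, F (ω, t) ^ 2 / k ∂discount ρ := by
    filter_upwards [hF2.prod_right_ae] with ω hω
    obtain ⟨h1, h2⟩ := laplace_primitive hρ hω
    have hle : ∀ᵐ t ∂discount ρ, ‖x (ω, t) ^ 2‖ ≤ ∫ s in (0 : ℝ)..t, F (ω, s) ^ 2 / k := by
      filter_upwards [ae_discount_pos ρ] with t ht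
      rw [Real.norm_of_nonneg (sq_nonneg _)]
      exact IsPrimitive.sq_le hk (hFc ω) (hx ω) ht.le
    have hi : Integrable (fun t => x (ω, t) ^ 2) (discount ρ) :=
      h1.mono' (hm2.comp_measurable measurable_prodMk_left).aestronglyMeasurable hle
    refine ⟨hi, (integral_mono_ae hi.norm h1 hle).trans (le_of_eq ?_)⟩
    rw [← h2]
    field_simp
  refine ⟨key.mono fun ω h => h.1, ?_⟩
  refine (hF2.integral_prod_left.const_mul ρ⁻¹).mono'
    hm2.norm.integral_prod_right'.aestronglyMeasurable ?_
  filter_upwards [key] with ω hω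
  rw [Real.norm_of_nonneg (integral_nonneg fun t => norm_nonneg _)]
  exact hω.2

theorem IsSignal.continuous_section (h : IsSignal P 𝓕 β σ m0 W μ) (ω : Ω) :
    Continuous fun t : ℝ => path μ (ω, t) :=
  (h.continuous_path ω).comp continuous_real_toNNReal

theorem IsSignal.isPrimitive_sub_noise (hσ : 0 < σ) (h : IsSignal P 𝓕 β σ m0 W μ) (ω : Ω) :
    IsPrimitive m0 (fun t => path μ (ω, t) - σ * path (signalNoise β σ m0 μ) (ω, t))
      (fun t => -β * path μ (ω, t)) := by
  intro t ht
  refine ⟨((h.continuous_section ω).const_mul _).intervalIntegrable _ _, ?_⟩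
  rw [intervalIntegral.integral_const_mul]
  simp only [path, signalNoise, Real.coe_toNNReal t ht]
  field_simp
  ring

theorem IsSignal.memLp [IsProbabilityMeasure P] (hρ : 0 < ρ) (hσ : 0 < σ) (hβ : 0 < β)
    (h : IsSignal P 𝓕 β σ m0 W μ) : MemLp (path μ) 2 (P.prod (discount ρ)) := by
  have := isFiniteMeasure_discount hρ
  have h1 := stronglyAdapted_integral h.adapted h.continuous_path (continuous_const (y := (1 : ℝ)))
  have h2 := continuous_integral h.continuous_path (continuous_const (y := (1 : ℝ)))
  simp only [one_mul] at h1 h2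
  set J : ℝ≥0 → Ω → ℝ := fun t ω => ∫ s in (0 : ℝ)..t, μ s.toNNReal ω with hJ
  have hJp : IsStronglyProgressive 𝓕 J := h1.isStronglyProgressive_of_continuous h2
  -- The integral J of the signal solves J' = (m0 + σw) - βJ. The damped energy estimate bounds J,
  -- and this identity then bounds the signal itself.
  have heq : ∀ p, path μ p = (m0 + σ * path (signalNoise β σ m0 μ) p) - β * path J p := by
    intro p
    simp only [path, signalNoise, hJ]
    field_simp
    ring
  have hF : MemLp (fun p => m0 + σ * path (signalNoise β σ m0 μ) p) 2 (P.prod (discount ρ)) :=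
    (memLp_const m0).add ((h.isNoise hρ hσ).memLp.const_mul σ)
  have hJL : MemLp (path J) 2 (P.prod (discount ρ)) := by
    refine memLp_of_damped hρ hβ hF (fun ω => ?_) (stronglyMeasurable_path hJp) fun ω => ?_
    · have : Continuous fun t => signalNoise β σ m0 μ t ω :=
        (((h.continuous_path ω).sub continuous_const).add ((h2 ω).const_mul β)).div_const σ
      exact continuous_const.add ((this.comp continuous_real_toNNReal).const_mul σ)
    · refine (isPrimitive_integral (h.continuous_section ω)).congr rfl ?_ fun t _ => heq (ω, t)
      intro t ht
      simp only [path, hJ, Real.coe_toNNReal t ht]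
  exact (memLp_congr_ae (Eventually.of_forall heq)).2 (hF.sub (hJL.const_mul β))

/-- The position that tracks the signal at the relative rate `M`. -/
def tracking (M α : ℝ) (μ : ℝ≥0 → Ω → ℝ) : ℝ≥0 → Ω → ℝ :=
  fun t ω => Real.exp (-M * t) * ∫ s in (0 : ℝ)..t, (Real.exp (M * s) * α) * μ s.toNNReal ω

theorem IsSignal.isStronglyProgressive_tracking (h : IsSignal P 𝓕 β σ m0 W μ) (M α : ℝ) :
    IsStronglyProgressive 𝓕 (tracking M α μ) := by
  have hc : Continuous fun s : ℝ => Real.exp (M * s) * α := by fun_prop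
  have h1 := stronglyAdapted_integral h.adapted h.continuous_path hc
  have h2 := continuous_integral h.continuous_path hc
  refine StronglyAdapted.isStronglyProgressive_of_continuous
    (fun t => (h1 t).const_mul (Real.exp (-M * t))) fun ω => ?_
  exact Continuous.mul (by fun_prop) (h2 ω)

theorem IsSignal.isPrimitive_tracking (h : IsSignal P 𝓕 β σ m0 W μ) (M α : ℝ) (ω : Ω) :
    IsPrimitive 0 (fun t => path (tracking M α μ) (ω, t))
      (fun t => α * path μ (ω, t) - M * path (tracking M α μ) (ω, t)) := by
  have hc : Continuous fun s : ℝ => Real.exp (M * s) * α := by fun_prop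
  refine ((isPrimitive_exp (-M)).mul
    (isPrimitive_integral (hc.mul (h.continuous_section ω)))).congr (mul_zero _) ?_ ?_
  · intro t ht
    simp only [path, tracking, Real.coe_toNNReal t ht, Pi.mul_apply]
  · intro t ht
    have : Real.exp (-M * t) * Real.exp (M * t) = 1 := by rw [← Real.exp_add]; simp
    simp only [path, tracking, Real.coe_toNNReal t ht, Pi.mul_apply]
    linear_combination α * μ t.toNNReal ω * this

theorem IsSignal.memLp_tracking [IsProbabilityMeasure P] (hρ : 0 < ρ) (hσ : 0 < σ) (hβ : 0 < β)
    (h : IsSignal P 𝓕 β σ m0 W μ) {M : ℝ} (hM : 0 < M) (α : ℝ) :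
    MemLp (path (tracking M α μ)) 2 (P.prod (discount ρ)) :=
  memLp_of_damped hρ hM ((h.memLp hρ hσ hβ).const_mul α)
    (fun ω => (h.continuous_section ω).const_mul α)
    (stronglyMeasurable_path (h.isStronglyProgressive_tracking M α))
    (h.isPrimitive_tracking M α)

/-! ### Positions under the symmetric linear feedback -/

variable {N : ℕ} {u : Feedback N} {φ ψ : Fin N → ℝ≥0 → Ω → ℝ} {S : Coeffs}

theorem IsPosition.isPrimitive (hφ : IsPosition P 𝓕 μ u φ) :
    ∀ᵐ ω ∂P, ∀ n, IsPrimitive 0 (fun t => path (φ n) (ω, t))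
      (fun t => path (rate u μ φ n) (ω, t)) := by
  filter_upwards [hφ.dynamics] with ω hω n t ht
  have h := hω n t.toNNReal
  rw [Real.coe_toNNReal t ht] at h
  exact ⟨h.1, by rw [zero_add]; exact h.2⟩

theorem Coeffs.feedback_apply (S : Coeffs) (m : ℝ) (x : Fin N → ℝ) (n : Fin N) :
    S.feedback N m x n = S.abar * m + S.bbar * ∑ i, x i - (S.bbar + S.cbar) * x n := by
  have h := Finset.add_sum_erase Finset.univ x (Finset.mem_univ n)
  rw [Coeffs.feedback, ← h]
  ring

/-- Agents who follow the symmetric feedback hold the same positions. -/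
theorem IsPosition.eq_of_feedback (hφ : IsPosition P 𝓕 μ u φ) {i j : Fin N}
    (hi : ∀ m x, u m x i = S.feedback N m x i) (hj : ∀ m x, u m x j = S.feedback N m x j) :
    ∀ᵐ ω ∂P, ∀ t, φ i t ω = φ j t ω := by
  filter_upwards [hφ.isPrimitive] with ω hω t
  -- The terms in the signal and in the total position are common to both agents and cancel. The
  -- difference solves a homogeneous linear equation from zero.
  have h := (((hω i).sub (hω j)).congr (sub_zero 0) (fun _ _ => rfl)
    (y' := fun t => -(S.bbar + S.cbar) * (path (φ i) (ω, t) - path (φ j) (ω, t))) fun t _ => ?_).eq_zero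
      t.coe_nonneg
  · simp only [path, Real.toNNReal_coe] at h
    linarith
  · simp only [path, rate, hi, hj, Coeffs.feedback_apply]
    ring

theorem IsPosition.rate_eq (hφ : IsPosition P 𝓕 μ (S.feedback N) φ) :
    ∀ᵐ ω ∂P, ∀ n t, rate (S.feedback N) μ φ n t ω = S.abar * μ t ω - S.Mrate N * φ n t ω := by
  have h : ∀ i j, ∀ᵐ ω ∂P, ∀ t, φ i t ω = φ j t ω := fun i j =>
    hφ.eq_of_feedback (fun _ _ => rfl) fun _ _ => rfl
  filter_upwards [ae_all_iff.2 fun i => ae_all_iff.2 fun j => h i j] with ω hω n t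
  rw [rate, Coeffs.feedback_apply, Finset.sum_congr rfl fun i _ => hω i n t, Finset.sum_const,
    Finset.card_univ, Fintype.card_fin, nsmul_eq_mul, Coeffs.Mrate]
  ring

theorem IsPosition.unique (hφ : IsPosition P 𝓕 μ (S.feedback N) φ)
    (hψ : IsPosition P 𝓕 μ (S.feedback N) ψ) :
    ∀ᵐ ω ∂P, ∀ (n : Fin N) (t : ℝ≥0), ψ n t ω = φ n t ω := by
  filter_upwards [hφ.isPrimitive, hψ.isPrimitive, hφ.rate_eq, hψ.rate_eq] with ω h1 h2 h3 h4 n t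
  have h := (((h2 n).sub (h1 n)).congr (sub_zero 0) (fun _ _ => rfl)
    (y' := fun t => -(S.Mrate N) * (path (ψ n) (ω, t) - path (φ n) (ω, t))) fun t _ => ?_).eq_zero
      t.coe_nonneg
  · simp only [path, Real.toNNReal_coe] at h
    linarith
  · simp only [path, h3, h4]
    ring

theorem IsSignal.isPosition_tracking (h : IsSignal P 𝓕 β σ m0 W μ) (S : Coeffs) (N : ℕ) :
    IsPosition P 𝓕 μ (S.feedback N) (fun _ => tracking (S.Mrate N) S.abar μ) := by
  refine ⟨fun _ => h.isStronglyProgressive_tracking _ _, Eventually.of_forall fun ω n t => ?_⟩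
  have h1 := h.isPrimitive_tracking (S.Mrate N) S.abar ω t t.coe_nonneg
  have h2 : (fun s : ℝ => rate (S.feedback N) μ (fun _ => tracking (S.Mrate N) S.abar μ) n
      s.toNNReal ω) = fun s => S.abar * path μ (ω, s)
        - S.Mrate N * path (tracking (S.Mrate N) S.abar μ) (ω, s) := by
    ext s
    rw [rate, Coeffs.feedback_apply, Finset.sum_const,
      Finset.card_univ, Fintype.card_fin, nsmul_eq_mul, Coeffs.Mrate, path, path]
    ring
  rw [h2]
  refine ⟨h1.1, ?_⟩
  have h3 := h1.2
  simp only [zero_add, path, Real.toNNReal_coe] at h3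
  exact h3

theorem IsSignal.isAdmissibleFeedback [IsProbabilityMeasure P] (hρ : 0 < ρ) (hσ : 0 < σ)
    (hβ : 0 < β) (h : IsSignal P 𝓕 β σ m0 W μ) (hM : 0 < S.Mrate N) :
    IsAdmissibleFeedback P 𝓕 ρ μ (S.feedback N) := by
  have hpos := h.isPosition_tracking S N
  have hμ : IsStronglyProgressive 𝓕 μ :=
    h.adapted.isStronglyProgressive_of_continuous h.continuous_path
  have hφ := h.memLp_tracking hρ hσ hβ hM S.abar
  refine ⟨_, hpos, fun ψ hψ => hpos.unique hψ, fun n => isAdmissibleProcess_iff.2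
    ⟨hpos.progressive n, hφ⟩, fun n => isAdmissibleProcess_iff.2 ?_⟩
  have h2 : rate (S.feedback N) μ (fun _ => tracking (S.Mrate N) S.abar μ) n = fun t ω =>
      S.abar * μ t ω - S.Mrate N * tracking (S.Mrate N) S.abar μ t ω := by
    ext t ω
    rw [rate, Coeffs.feedback_apply, Finset.sum_const,
      Finset.card_univ, Fintype.card_fin, nsmul_eq_mul, Coeffs.Mrate]
    ring
  rw [h2]
  refine ⟨fun t => ?_, ((h.memLp hρ hσ hβ).const_mul _).sub (hφ.const_mul _)⟩
  exact ((hμ t).const_mul _).sub ((hpos.progressive n t).const_mul _)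

end Positions

end PriceImpactGame
end

/-! ### Completion of the square and the verification identity -/

noncomputable section

namespace PriceImpactGame

/-- The quadratic value function, integrated along a position: profits and the drift of the value
function combine to a negative square. The variables `xx`, `xy`, … are the discounted second
moments of own position `x`, common position `y` of the others, signal `m` and own rate `u`. -/
theorem Coeffs.SolvesSystem.completion {S : Coeffs} {N : ℕ} {β σ γ ρ lam : ℝ}
    (hS : S.SolvesSystem N β σ γ ρ lam) (hN : 2 ≤ N) (hρ : 0 < ρ) (hlam : 0 < lam)
    {xx xy yy xm ym mm ux uy um uu v k : ℝ} (hk : k = ((N : ℝ) - 2) * S.bbar - S.cbar)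
    (h1 : ρ * xx = 2 * ux) (h2 : ρ * xy = uy + (S.abar * xm + S.bbar * xx + k * xy))
    (h3 : ρ * yy = 2 * (S.abar * ym + S.bbar * xy + k * yy))
    (h4 : (ρ + β) * xm = um) (h5 : (ρ + β) * ym = S.abar * mm + S.bbar * xm + k * ym)
    (h6 : (ρ + 2 * β) * mm = v + σ ^ 2 / ρ) :
    xm - γ / 2 * xx - lam * (uu + ((N : ℝ) - 1) * (S.abar * um + S.bbar * ux + k * uy))
      = S.c * v / 2 + S.g - lam * (uu
        - 2 * (S.abar * um + ((N : ℝ) - 1) * S.bbar * uy - S.cbar * ux)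
        + (S.abar ^ 2 * mm + (((N : ℝ) - 1) * S.bbar) ^ 2 * yy + S.cbar ^ 2 * xx
          + 2 * S.abar * ((N : ℝ) - 1) * S.bbar * ym - 2 * S.abar * S.cbar * xm
          - 2 * ((N : ℝ) - 1) * S.bbar * S.cbar * xy)) := by
  obtain ⟨ha, hb, hd, hg, hc, he, hf, e1, e2, e3⟩ := hS
  have hN' : (2 : ℝ) ≤ N := by exact_mod_cast hN
  obtain ⟨a, b, c, d, e, f, g, α, B, K⟩ := S
  simp only at *
  generalize (N : ℝ) = n at *
  have hn1 : n + 1 ≠ 0 := by linarith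
  have hn2 : 1 - n ≠ 0 := by linarith
  have q1 : lam - lam * n ^ 2 ≠ 0 := by
    have : lam - lam * n ^ 2 = lam * (n + 1) * (1 - n) := by ring
    rw [this]
    positivity
  have q2 : lam + lam * n ≠ 0 := by positivity
  have E1 : e = lam * (n + 1) * α := by
    rw [e1]; field_simp
  have e2' : B * (lam - lam * n ^ 2) = -a * n + a + 2 * d := by rw [e2, div_mul_cancel₀ _ q1]
  have e3' : K * (lam + lam * n) = -(d - a * n) := by
    rw [e3, neg_mul, div_mul_cancel₀ _ q2]
  have E3 : a = 2 * lam * K - lam * (n - 1) * B := by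
    apply mul_left_cancel₀ hn1
    linear_combination -e2' - 2 * e3'
  have E2 : d = -2 * lam * B * (n - 1) - lam * (n - 1) * k := by
    rw [hk]
    linear_combination e3' + n * E3
  -- Together `r1`, `r2`, `r3` are the first-order condition of the HJB equation: V_x - lam(N-1)Y
  -- equals 2 lam times the linear feedback, with Y the common rate of the others. With them the
  -- quadratic terms of the HJB equations become lam times products of feedback coefficients.
  have r1 : e - lam * (n - 1) * α = 2 * lam * α := by rw [E1]; ring
  have r2 : d + lam * (n - 1) * k = -(2 * lam * ((n - 1) * B)) := by rw [E2]; ring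
  have r3 : a + lam * (n - 1) * B = 2 * lam * K := by rw [E3]; ring
  rw [← hk] at hb hd hf
  rw [r3] at ha
  rw [r2] at hb
  rw [r3, r2] at hd
  rw [r1] at hc
  rw [r1, r3] at he
  rw [r1, r2] at hf
  have s1 : (2 * lam * K) ^ 2 / (4 * lam) = lam * K ^ 2 := by field_simp; ring
  have s2 : (-(2 * lam * ((n - 1) * B))) ^ 2 / (4 * lam) = lam * ((n - 1) * B) ^ 2 := by
    field_simp; ring
  have s3 : 2 * lam * K * -(2 * lam * ((n - 1) * B)) / (2 * lam) = -2 * lam * K * ((n - 1) * B) := by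
    field_simp
  have s4 : (2 * lam * α) ^ 2 / (4 * lam) = lam * α ^ 2 := by field_simp; ring
  have s5 : 2 * lam * α * (2 * lam * K) / (2 * lam) = 2 * lam * α * K := by field_simp
  have s6 : 2 * lam * α * -(2 * lam * ((n - 1) * B)) / (2 * lam)
      = -2 * lam * α * ((n - 1) * B) := by field_simp
  have s7 : σ ^ 2 / (2 * ρ) * c = c / 2 * (σ ^ 2 / ρ) := by field_simp
  rw [s1] at ha
  rw [s2] at hb
  rw [s3] at hd
  rw [s4] at hc
  rw [s5] at he
  rw [s6] at hf
  rw [s7] at hg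
  generalize σ ^ 2 / ρ = τ at *
  -- The moment relations carry the coefficients of the value function as weights, the HJB equations
  -- carry the discounted moments, and the first-order conditions carry the cross moments with the
  -- own rate u.
  linear_combination -(a / 2) * h1 - d * h2 + (b / 2) * h3 + e * h4 + f * h5 + (c / 2) * h6
    - xx * ha - yy * hb - xy * hd - mm * hc - xm * he + ym * hf - hg
    - ux * r3 - uy * r2 + um * r1

end PriceImpactGame
end

noncomputable section

namespace PriceImpactGame

theorem integral_linear_combination_mul {X : Type*} [MeasurableSpace X] {ν : Measure X}
    {f₁ f₂ f₃ f₄ h : X → ℝ} (h₁ : MemLp f₁ 2 ν) (h₂ : MemLp f₂ 2 ν) (h₃ : MemLp f₃ 2 ν)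
    (h₄ : MemLp f₄ 2 ν) (hh : MemLp h 2 ν) (c₁ c₂ c₃ c₄ : ℝ) :
    ∫ p, (c₁ * f₁ p + c₂ * f₂ p + c₃ * f₃ p + c₄ * f₄ p) * h p ∂ν
      = c₁ * ∫ p, f₁ p * h p ∂ν + c₂ * ∫ p, f₂ p * h p ∂ν + c₃ * ∫ p, f₃ p * h p ∂ν
        + c₄ * ∫ p, f₄ p * h p ∂ν := by
  have i : ∀ {f : X → ℝ} (c : ℝ), MemLp f 2 ν → Integrable (fun p => c * (f p * h p)) ν :=
    fun c hf => (hf.integrable_mul hh).const_mul c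
  have i12 : Integrable (fun p => c₁ * (f₁ p * h p) + c₂ * (f₂ p * h p)) ν :=
    (i c₁ h₁).add (i c₂ h₂)
  have i123 : Integrable (fun p => c₁ * (f₁ p * h p) + c₂ * (f₂ p * h p) + c₃ * (f₃ p * h p)) ν :=
    i12.add (i c₃ h₃)
  simp only [← integral_const_mul]
  rw [← integral_add (i c₁ h₁) (i c₂ h₂), ← integral_add i12 (i c₃ h₃),
    ← integral_add i123 (i c₄ h₄)]
  congr with p
  ring

section Value

variable {Ω : Type*} [mΩ : MeasurableSpace Ω] {P : Measure Ω} [IsProbabilityMeasure P]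
  {𝓕 : Filtration ℝ≥0 mΩ} {β σ γ ρ lam m0 : ℝ} {W μ : ℝ≥0 → Ω → ℝ} {N : ℕ} {S : Coeffs}

/-- The verification identity, for own position `x` traded at the rate `u` and common position `y`
of the others. -/
theorem IsSignal.verification (hρ : 0 < ρ) (hσ : 0 < σ) (hβ : 0 < β) (hlam : 0 < lam) (hN : 2 ≤ N)
    (h : IsSignal P 𝓕 β σ m0 W μ) (hS : S.SolvesSystem N β σ γ ρ lam) {k : ℝ}
    (hk : k = ((N : ℝ) - 2) * S.bbar - S.cbar) {x y u Y : Ω × ℝ → ℝ}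
    (hY : ∀ p, Y p = S.abar * path μ p + S.bbar * x p + k * y p)
    (hx : MemLp x 2 (P.prod (discount ρ))) (hy : MemLp y 2 (P.prod (discount ρ)))
    (hu : MemLp u 2 (P.prod (discount ρ)))
    (hua : ∀ s, 0 ≤ s → StronglyMeasurable[𝓕 s.toNNReal] fun ω => u (ω, s))
    (hYa : ∀ s, 0 ≤ s → StronglyMeasurable[𝓕 s.toNNReal] fun ω => Y (ω, s))
    (px : ∀ᵐ ω ∂P, IsPrimitive 0 (fun t => x (ω, t)) fun t => u (ω, t))
    (py : ∀ᵐ ω ∂P, IsPrimitive 0 (fun t => y (ω, t)) fun t => Y (ω, t)) :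
    Integrable (fun p => path μ p * x p - γ / 2 * x p ^ 2
        - lam * u p * (u p + ((N : ℝ) - 1) * Y p)) (P.prod (discount ρ)) ∧
      ∫ p, (path μ p * x p - γ / 2 * x p ^ 2 - lam * u p * (u p + ((N : ℝ) - 1) * Y p))
          ∂P.prod (discount ρ)
        = S.c * m0 ^ 2 / 2 + S.g - lam * ∫ p, (u p - (S.abar * path μ p
            + ((N : ℝ) - 1) * S.bbar * y p - S.cbar * x p)) ^ 2 ∂P.prod (discount ρ) := by
  set m := path μ with hmdef
  set ν := P.prod (discount ρ) with hν
  have hm : MemLp m 2 ν := h.memLp hρ hσ hβ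
  have hYe : Y = fun p => S.abar * m p + S.bbar * x p + k * y p := funext hY
  have hYL : MemLp Y 2 ν := by
    rw [hYe]
    exact ((hm.const_mul _).add (hx.const_mul _)).add (hy.const_mul _)
  have hma : ∀ s, 0 ≤ s → StronglyMeasurable[𝓕 s.toNNReal] fun ω => m (ω, s) :=
    fun s _ => h.adapted s.toNNReal
  obtain ⟨hmm, hmx⟩ := (h.isNoise hρ hσ).signal_moments hρ hm hma
    (Eventually.of_forall (h.isPrimitive_sub_noise hσ))
  have r1 := pairing_primitive hρ hx hu hx hu px px
  have r2 := pairing_primitive hρ hx hu hy hYL px py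
  have r3 := pairing_primitive hρ hy hYL hy hYL py py
  have r4 := hmx x u hx hu hua px
  have r5 := hmx y Y hy hYL hYa py
  have lin : ∀ (c₁ c₂ c₃ c₄ : ℝ) {f : Ω × ℝ → ℝ}, MemLp f 2 ν →
      ∫ p, (c₁ * m p + c₂ * x p + c₃ * y p + c₄ * u p) * f p ∂ν
        = c₁ * ∫ p, m p * f p ∂ν + c₂ * ∫ p, x p * f p ∂ν + c₃ * ∫ p, y p * f p ∂ν
          + c₄ * ∫ p, u p * f p ∂ν :=
    fun c₁ c₂ c₃ c₄ _ hf => integral_linear_combination_mul hm hx hy hu hf c₁ c₂ c₃ c₄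
  have comm : ∀ f g : Ω × ℝ → ℝ, ∫ p, f p * g p ∂ν = ∫ p, g p * f p ∂ν :=
    fun f g => by simp only [mul_comm]
  have linY : ∀ {f : Ω × ℝ → ℝ}, MemLp f 2 ν → ∫ p, Y p * f p ∂ν
      = S.abar * ∫ p, m p * f p ∂ν + S.bbar * ∫ p, x p * f p ∂ν + k * ∫ p, y p * f p ∂ν := by
    intro f hf
    have := lin S.abar S.bbar k 0 hf
    simp only [zero_mul, add_zero] at this
    rw [← this, hYe]
  -- The deviation of the own rate from the linear feedback. As a linear combination of m, x, y and
  -- u, it has a mean square that expands into the same moments.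
  set q : Ω × ℝ → ℝ := fun p =>
    (-S.abar) * m p + S.cbar * x p + (-(((N : ℝ) - 1) * S.bbar)) * y p + 1 * u p with hq
  have hqL : MemLp q 2 ν :=
    (((hm.const_mul _).add (hx.const_mul _)).add (hy.const_mul _)).add (hu.const_mul _)
  have hqq : ∫ p, (u p - (S.abar * m p + ((N : ℝ) - 1) * S.bbar * y p - S.cbar * x p)) ^ 2 ∂ν
      = ∫ p, q p * q p ∂ν := by
    congr with p
    simp only [hq]
    ring
  have linq : ∀ {f : Ω × ℝ → ℝ}, MemLp f 2 ν → ∫ p, f p * q p ∂ν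
      = -S.abar * ∫ p, m p * f p ∂ν + S.cbar * ∫ p, x p * f p ∂ν
        + -(((N : ℝ) - 1) * S.bbar) * ∫ p, y p * f p ∂ν + 1 * ∫ p, u p * f p ∂ν := by
    intro f hf
    rw [comm f q, ← lin _ _ _ _ hf]
  have i1 : Integrable (fun p => (1 * m p + (-(γ / 2)) * x p + 0 * y p + 0 * u p) * x p) ν :=
    ((((hm.const_mul _).add (hx.const_mul _)).add (hy.const_mul _)).add
      (hu.const_mul _)).integrable_mul hx
  have i2 : Integrable (fun p => ((-(lam * ((N : ℝ) - 1) * S.abar)) * m p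
      + (-(lam * ((N : ℝ) - 1) * S.bbar)) * x p + (-(lam * ((N : ℝ) - 1) * k)) * y p
      + (-lam) * u p) * u p) ν :=
    ((((hm.const_mul _).add (hx.const_mul _)).add (hy.const_mul _)).add
      (hu.const_mul _)).integrable_mul hu
  have hsplit : (fun p => m p * x p - γ / 2 * x p ^ 2 - lam * u p * (u p + ((N : ℝ) - 1) * Y p))
      = fun p => (1 * m p + (-(γ / 2)) * x p + 0 * y p + 0 * u p) * x p
        + ((-(lam * ((N : ℝ) - 1) * S.abar)) * m p
      + (-(lam * ((N : ℝ) - 1) * S.bbar)) * x p + (-(lam * ((N : ℝ) - 1) * k)) * y p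
      + (-lam) * u p) * u p := by
    ext p
    rw [hY p]
    ring
  rw [hsplit]
  refine ⟨i1.add i2, ?_⟩
  rw [integral_add i1 i2, lin _ _ _ _ hx, lin _ _ _ _ hu, hqq, hq, lin _ _ _ _ hqL, linq hm,
    linq hx, linq hy, linq hu]
  rw [← hν] at r1 r2 r3 r4 r5 hmm
  rw [comm x Y, linY hx] at r2
  rw [comm y Y, linY hy] at r3
  rw [linY hm] at r5
  rw [comm x u] at r1
  have key := hS.completion hN hρ hlam (uu := ∫ p, u p * u p ∂ν) hk
    (xx := ∫ p, x p * x p ∂ν) (xy := ∫ p, x p * y p ∂ν) (yy := ∫ p, y p * y p ∂ν)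
    (xm := ∫ p, x p * m p ∂ν) (ym := ∫ p, y p * m p ∂ν) (mm := ∫ p, m p * m p ∂ν)
    (ux := ∫ p, u p * x p ∂ν) (uy := ∫ p, u p * y p ∂ν) (um := ∫ p, u p * m p ∂ν)
    (v := m0 ^ 2) (by linear_combination r1)
    (by linear_combination r2 + S.abar * comm m x + k * comm y x)
    (by linear_combination r3 + 2 * S.abar * comm m y) r4 r5 hmm
  rw [comm m x, comm m y, comm m u, comm x u, comm y u, comm y x]
  linear_combination key

end Value

end PriceImpactGame
end

/-! ### The Nash property and the equilibrium value -/

noncomputable section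

namespace PriceImpactGame

section Equilibrium

variable {Ω : Type*} [mΩ : MeasurableSpace Ω] {P : Measure Ω}
  {𝓕 : Filtration ℝ≥0 mΩ} {β σ γ ρ lam m0 : ℝ} {W μ : ℝ≥0 → Ω → ℝ} {N : ℕ} {S : Coeffs}

theorem goal_congr {u u' : Feedback N} {φ ψ : Fin N → ℝ≥0 → Ω → ℝ}
    (hu : ∀ m x, u m x = u' m x) (h : ∀ᵐ ω ∂P, ∀ (n : Fin N) (t : ℝ≥0), φ n t ω = ψ n t ω)
    (n : Fin N) :
    goal P γ ρ lam μ φ (rate u μ φ) n = goal P γ ρ lam μ ψ (rate u' μ ψ) n := by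
  apply integral_congr_ae
  filter_upwards [h] with ω hω
  simp only [rate, hu, hω]

/-- The goal functional of a deviating agent falls short of the quadratic value function by the
expected discounted square of the deviation. -/
theorem IsSignal.goal_deviate [IsProbabilityMeasure P] (hρ : 0 < ρ) (hσ : 0 < σ) (hβ : 0 < β)
    (hlam : 0 < lam) (hN : 2 ≤ N) (h : IsSignal P 𝓕 β σ m0 W μ)
    (hS : S.SolvesSystem N β σ γ ρ lam) {n : Fin N} {v : ℝ → (Fin N → ℝ) → ℝ}
    {ψ : Fin N → ℝ≥0 → Ω → ℝ} (hψ : IsPosition P 𝓕 μ (deviate (S.feedback N) n v) ψ)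
    (hψL : ∀ i, IsAdmissibleProcess P 𝓕 ρ (ψ i))
    (hrL : IsAdmissibleProcess P 𝓕 ρ (rate (deviate (S.feedback N) n v) μ ψ n)) :
    goal P γ ρ lam μ ψ (rate (deviate (S.feedback N) n v) μ ψ) n
      = S.c * m0 ^ 2 / 2 + S.g - lam * ∫ p, (path (rate (deviate (S.feedback N) n v) μ ψ n) p
          - path (rate (S.feedback N) μ ψ n) p) ^ 2 ∂P.prod (discount ρ) := by
  set r := rate (deviate (S.feedback N) n v) μ ψ with hr
  have : Nontrivial (Fin N) := Fin.nontrivial_iff_two_le.2 hN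
  -- The agents other than n keep the symmetric feedback and hence share one position, whatever
  -- agent n does. Any of them represents y, which reduces the game to a control problem in (x, y,
  -- m).
  obtain ⟨j, hj⟩ := exists_ne n
  have hdev : ∀ i, i ≠ n → ∀ m x, deviate (S.feedback N) n v m x i = S.feedback N m x i :=
    fun i hi m x => Function.update_of_ne hi _ _
  have heq : ∀ i, ∀ᵐ ω ∂P, i ≠ n → ∀ t, ψ i t ω = ψ j t ω := by
    intro i
    by_cases hi : i = n
    · exact Eventually.of_forall fun ω h' => absurd hi h'
    · filter_upwards [hψ.eq_of_feedback (hdev i hi) (hdev j hj)] with ω hω _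
      exact hω
  have heq' : ∀ᵐ ω ∂P, ∀ i, i ≠ n → ∀ t, ψ i t ω = ψ j t ω := ae_all_iff.2 heq
  obtain ⟨k, hk⟩ : ∃ k, k = ((N : ℝ) - 2) * S.bbar - S.cbar := ⟨_, rfl⟩
  set Y : Ω × ℝ → ℝ := fun p => S.abar * path μ p + S.bbar * path (ψ n) p + k * path (ψ j) p with hY
  have hsum : ∀ᵐ ω ∂P, ∀ t, ∑ i, ψ i t ω = ψ n t ω + ((N : ℝ) - 1) * ψ j t ω := by
    filter_upwards [heq'] with ω hω t
    rw [← Finset.add_sum_erase Finset.univ (fun i => ψ i t ω) (Finset.mem_univ n),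
      Finset.sum_congr rfl fun i hi => hω i (Finset.ne_of_mem_erase hi) t, Finset.sum_const,
      Finset.card_erase_of_mem (Finset.mem_univ n), Finset.card_univ, Fintype.card_fin, nsmul_eq_mul,
      Nat.cast_sub (by lia), Nat.cast_one]
  have hrate : ∀ᵐ ω ∂P, ∀ i, i ≠ n → ∀ t : ℝ, path (r i) (ω, t) = Y (ω, t) := by
    filter_upwards [heq', hsum] with ω h1 h2 i hi t
    simp only [path, hY, hr, rate, hdev i hi, Coeffs.feedback_apply, h2, h1 i hi]
    rw [hk]
    ring
  have hrsum : ∀ᵐ ω ∂P, ∀ t : ℝ, ∑ i, path (r i) (ω, t)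
      = path (r n) (ω, t) + ((N : ℝ) - 1) * Y (ω, t) := by
    filter_upwards [hrate] with ω hω t
    rw [← Finset.add_sum_erase Finset.univ (fun i => path (r i) (ω, t)) (Finset.mem_univ n),
      Finset.sum_congr rfl fun i hi => hω i (Finset.ne_of_mem_erase hi) t, Finset.sum_const,
      Finset.card_erase_of_mem (Finset.mem_univ n), Finset.card_univ, Fintype.card_fin, nsmul_eq_mul,
      Nat.cast_sub (by lia), Nat.cast_one]
  have hfb : ∀ᵐ ω ∂P, ∀ t : ℝ, path (rate (S.feedback N) μ ψ n) (ω, t)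
      = S.abar * path μ (ω, t) + ((N : ℝ) - 1) * S.bbar * path (ψ j) (ω, t)
        - S.cbar * path (ψ n) (ω, t) := by
    filter_upwards [hsum] with ω hω t
    simp only [path, rate, Coeffs.feedback_apply, hω]
    ring
  have ha : ∀ {X : ℝ≥0 → Ω → ℝ}, IsStronglyProgressive 𝓕 X → ∀ s : ℝ, 0 ≤ s →
      StronglyMeasurable[𝓕 s.toNNReal] fun ω => path X (ω, s) :=
    fun hX s _ => hX.stronglyAdapted s.toNNReal
  have hL : ∀ i, MemLp (path (ψ i)) 2 (P.prod (discount ρ)) :=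
    fun i => (isAdmissibleProcess_iff.1 (hψL i)).2
  have hprim := hψ.isPrimitive
  have hYa : ∀ s : ℝ, 0 ≤ s → StronglyMeasurable[𝓕 s.toNNReal] fun ω => Y (ω, s) := fun s hs =>
    (((ha (h.adapted.isStronglyProgressive_of_continuous h.continuous_path) s hs).const_mul _).add
      ((ha (hψ.progressive n) s hs).const_mul _)).add ((ha (hψ.progressive j) s hs).const_mul _)
  have hYp : ∀ᵐ ω ∂P, IsPrimitive 0 (fun t => path (ψ j) (ω, t)) fun t => Y (ω, t) := by
    filter_upwards [hprim, hrate] with ω h1 h2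
    exact (h1 j).congr rfl (fun _ _ => rfl) fun t _ => h2 j hj t
  obtain ⟨hint, hval⟩ := h.verification hρ hσ hβ hlam hN hS hk (x := path (ψ n)) (y := path (ψ j))
    (u := path (r n)) (Y := Y) (fun p => rfl) (hL n) (hL j) (isAdmissibleProcess_iff.1 hrL).2
    (ha hrL.1) hYa (hprim.mono fun ω hω => hω n) hYp
  have h1 : ∫ p, (path (r n) p - path (rate (S.feedback N) μ ψ n) p) ^ 2 ∂P.prod (discount ρ)
      = ∫ p, (path (r n) p - (S.abar * path μ p + ((N : ℝ) - 1) * S.bbar * path (ψ j) p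
        - S.cbar * path (ψ n) p)) ^ 2 ∂P.prod (discount ρ) := by
    apply integral_congr_ae
    filter_upwards [Measure.quasiMeasurePreserving_fst.ae hfb] with p hp
    rw [hp p.2]
  rw [h1, ← hval, integral_prod _ hint, goal]
  apply integral_congr_ae
  filter_upwards [hrsum] with ω hω
  rw [integral_discount]
  congr with t
  rw [← hω t]
  rfl

/-- The equilibrium is the deviation of agent n to the own component of the feedback, for which the
penalty vanishes. -/
theorem IsSignal.goal_equilibrium [IsProbabilityMeasure P] (hρ : 0 < ρ) (hσ : 0 < σ) (hβ : 0 < β)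
    (hlam : 0 < lam) (hN : 2 ≤ N) (h : IsSignal P 𝓕 β σ m0 W μ)
    (hS : S.SolvesSystem N β σ γ ρ lam) (hM : 0 < S.Mrate N) {φ : Fin N → ℝ≥0 → Ω → ℝ}
    (hφ : IsPosition P 𝓕 μ (S.feedback N) φ) (n : Fin N) :
    goal P γ ρ lam μ φ (rate (S.feedback N) μ φ) n = S.c * m0 ^ 2 / 2 + S.g := by
  obtain ⟨ψ, hψ, huniq, hψL, hrL⟩ := h.isAdmissibleFeedback hρ hσ hβ hM (N := N)
  have hdev : deviate (S.feedback N) n (fun m x => S.feedback N m x n) = S.feedback N := by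
    ext m x i
    rw [deviate, Function.update_eq_self]
  have key := h.goal_deviate hρ hσ hβ hlam hN hS (n := n) (v := fun m x => S.feedback N m x n)
    (ψ := ψ) (by rwa [hdev]) hψL (by rw [hdev]; exact hrL n)
  rw [hdev] at key
  rw [goal_congr (fun _ _ => rfl) (huniq φ hφ) n, key]
  simp

/-- Square-integrability is known for the solution that witnesses admissibility of the deviation.
Uniqueness transfers the goal functional to any other solution. -/
theorem IsSignal.isClosedLoopNash [IsProbabilityMeasure P] (hρ : 0 < ρ) (hσ : 0 < σ) (hβ : 0 < β)
    (hlam : 0 < lam) (hN : 2 ≤ N) (h : IsSignal P 𝓕 β σ m0 W μ)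
    (hS : S.SolvesSystem N β σ γ ρ lam) (hM : 0 < S.Mrate N) :
    IsClosedLoopNash P 𝓕 γ ρ lam μ (S.feedback N) := by
  refine ⟨h.isAdmissibleFeedback hρ hσ hβ hM, fun n v hv φ ψ hφ hψ => ?_⟩
  obtain ⟨ψ', hψ', huniq, hψL, hrL⟩ := hv
  rw [goal_congr (fun _ _ => rfl) (huniq ψ hψ) n, h.goal_equilibrium hρ hσ hβ hlam hN hS hM hφ,
    h.goal_deviate hρ hσ hβ hlam hN hS hψ' hψL (hrL n)]
  exact sub_le_self _ (mul_nonneg hlam.le (integral_nonneg fun p => sq_nonneg _))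

end Equilibrium

end PriceImpactGame
end

theorem proposition1 (N : ℕ) (hN : 2 ≤ N) :
    -- the limiting scalar equation has a unique root `δ0`, which depends on `N` only
    ∃ δ0 : ℝ,
      (δ0 ∈ PriceImpactGame.rootInterval N ∧ PriceImpactGame.Phi0 N δ0 = 0 ∧
        ∀ y ∈ PriceImpactGame.rootInterval N, PriceImpactGame.Phi0 N y = 0 → y = δ0) ∧
      0 < PriceImpactGame.Delta N δ0 ∧
      ∀ β σ γ ρ : ℝ, 0 < β → 0 < σ → 0 < γ → 0 < ρ →
        -- `Phi0` is the limiting version of the scalar equation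
        (∀ y ∈ PriceImpactGame.rootInterval N,
          Tendsto (fun lam => PriceImpactGame.Phi N γ ρ lam y) (𝓝[>] 0)
            (𝓝 (γ * PriceImpactGame.Phi0 N y))) ∧
        -- the equilibrium coefficients exist for small `lam`
        (∃ (δ : ℝ → ℝ) (S : ℝ → PriceImpactGame.Coeffs),
          PriceImpactGame.IsEquilibriumBranch N β σ γ ρ δ0 δ S) ∧
        ∀ (δ : ℝ → ℝ) (S : ℝ → PriceImpactGame.Coeffs),
          PriceImpactGame.IsEquilibriumBranch N β σ γ ρ δ0 δ S →
          ∃ C lam0 : ℝ, 0 < C ∧ 0 < lam0 ∧ ∀ lam : ℝ, 0 < lam → lam < lam0 →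
            0 < (S lam).Mrate N ∧ 0 < (S lam).Maim N γ ∧
            |(S lam).Mrate N - √(γ / lam) * PriceImpactGame.Delta N δ0| ≤ C ∧
            |(S lam).Maim N γ - 1| ≤ C * √lam ∧
            ∀ (Ω : Type*) [mΩ : MeasurableSpace Ω] (P : Measure Ω) [IsProbabilityMeasure P]
              (𝓕 : Filtration ℝ≥0 mΩ) (m0 : ℝ) (W μ : ℝ≥0 → Ω → ℝ),
              PriceImpactGame.IsSignal P 𝓕 β σ m0 W μ →
              PriceImpactGame.IsClosedLoopNash P 𝓕 γ ρ lam μ ((S lam).feedback N) ∧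
              ∀ φ : Fin N → ℝ≥0 → Ω → ℝ,
                PriceImpactGame.IsPosition P 𝓕 μ ((S lam).feedback N) φ →
                (∀ᵐ ω ∂P, ∀ (n : Fin N) (t : ℝ≥0),
                  PriceImpactGame.rate ((S lam).feedback N) μ φ n t ω =
                    (S lam).Mrate N * ((S lam).Maim N γ * (μ t ω / γ) - φ n t ω)) ∧
                (m0 = 0 → ∀ n : Fin N,
                  |PriceImpactGame.goal P γ ρ lam μ φ
                      (PriceImpactGame.rate ((S lam).feedback N) μ φ) n
                    - (σ ^ 2 / (2 * ρ * γ * (2 * β + ρ))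
                      - √lam * σ ^ 2 * (1 + 2 * PriceImpactGame.Delta N δ0 ^ 2 * N)
                        / (4 * γ ^ (3 / 2 : ℝ) * ρ * PriceImpactGame.Delta N δ0))|
                  ≤ C * lam) := by
  obtain ⟨z, y, h⟩ := PriceImpactGame.exists_isLimitRoot
    (n := (N : ℝ)) (by exact_mod_cast hN)
  refine ⟨y, ⟨h.mem_rootInterval hN, h.phi0_eq_zero hN, fun y' hy' h0 => h.unique hN hy' h0⟩,
    h.delta_pos hN, fun β σ γ ρ hβ hσ hγ hρ => ⟨fun y' hy' =>
      PriceImpactGame.tendsto_phi hN hγ hy'.1, h.exists_branch hN hβ σ hγ hρ, ?_⟩⟩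
  intro δ S hB
  obtain ⟨C, lam0, hC, hlam0, key⟩ := hB.asymptotics hN h hβ hγ hρ
  refine ⟨C, lam0, hC, hlam0, fun lam hlam hlt => ?_⟩
  obtain ⟨hS, hM, hA, hM', hA', hg⟩ := key lam hlam hlt
  refine ⟨hM, hA, hM', hA', fun Ω mΩ P _ 𝓕 m0 W μ hμ => ⟨hμ.isClosedLoopNash hρ hσ hβ hlam hN hS hM,
    fun φ hφ => ⟨?_, fun hm0 n => ?_⟩⟩⟩
  · filter_upwards [hφ.rate_eq] with ω hω n t
    rw [hω n t, PriceImpactGame.Coeffs.Maim]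
    field_simp
  · rw [hμ.goal_equilibrium hρ hσ hβ hlam hN hS hM hφ n, hm0]
    simpa using hg
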